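/- **Notation.** $\mathbb N$ is the set of positive integers. For $m\in\mathbb N$ let $\pi(m)$ be the set of primes dividing $m$, let $m_p$ be the largest power of the prime $p$ dividing $m$, let $m_{\pi}=\prod_{p\in\pi}m_p$ for a set $\pi$ of primes, and let $m_{2'}=m/m_2$. Let $\mathcal U_m=(\mathbb Z/m\mathbb Z)^\times$, and for $q\mid m$ let $\mathrm{Res}_q:\mathcal U_m\to\mathcal U_q$ be the natural map. For a cyclic subgroup $T$ of $\mathcal U_m$ let $\mathrm{inv}(T)=(r,\epsilon,o)$, where $r$ is the greatest divisor of $m$ such that $\mathrm{Res}_{r_{2'}}(T)=1$ and $\mathrm{Res}_{r_2}(T)\subseteq\langle -1\rangle$; $\epsilon=1$ if $\mathrm{Res}_{r_2}(T)=1$ and $\epsilon=-1$ otherwise; and $o=|\mathrm{Res}_{m_\nu}(T_{\nu'})|$, where $\nu=\pi(m)\setminus\pi(r)$ and $T_{\nu'}$ is the subgroup of the elements of $T$ whose order is divisible by no prime in $\nu$. For $n,s\in\mathbb N$ put $[T,n,s]=m_\nu\prod_{p\in\pi(r)}m'_p$, where $m'_p=m'_p(m,n,s,r,\epsilon,o)$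 is given by (1) if $\epsilon^{p-1}=1$: $$m'_p=\min\Bigl(m_p,\;o_pr_p,\;\max\Bigl(r_p,\;s_p,\;r_p\frac{s_po_p}{n_p}\Bigr)\Bigr);$$ if $p=2$ and $\epsilon=-1$: $$m'_2=\begin{cases} r_2, & \text{if } o_2\le 2 \text{ or } m_2\le 2r_2;\\ \frac{m_2}{2}, & \text{if } 4\le o_2<n_2,\ 4r_2\le m_2, \text{ and, if } s_2\ne n_2r_2, \text{ then } 2s_2=m_2<n_2r_2;\\ m_2, & \text{otherwise}\end{cases}$$ (the cases being read in order). A finite group $G$ is metacyclic if it has a cyclic normal subgroup with cyclic quotient. A metacyclic factorization is an expression $G=AB$ with $A$ a cyclic normal subgroup and $B$ a cyclic subgroup of $G$. For such an $A$, let $T_G(A)\le\mathcal U_{|A|}$ be the group of those $u$ for which $a\mapsto a^u$ is the restriction to $A$ of an inner automorphism of $G$, and let $r_G(A)$ be the first entry of $\mathrm{inv}(T_G(A))$. The factorization is minimal if $(|A|,r_G(A),[G:B])$ is lexicographically minimal among all metacyclic factorizations of $G$. Then $$\mathrm{MCINV}(G)=\bigl(|A|,\,[G:A],\,[G:B],\,\mathrm{Res}_{[T,n,s]}(T)\bigr),\qquad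 T=T_G(A),\ n=[G:A],\ s=[G:B],$$ for a minimal factorization $G=AB$ (the result does not depend on the one chosen). The last entry is a subgroup of $\mathcal U_{[T,n,s]}$, and the modulus $[T,n,s]$ is part of it. **Theorem.** Let $m,n,s\in\mathbb N$, let $m'\mid m$, and let $\Delta$ be a cyclic subgroup of $\mathcal U_{m'}$. Let $\mathrm{inv}(\Delta)=(r,\epsilon,o)$ and $\nu=\pi(m)\setminus\pi(r)$. The following are equivalent: 1. $(m,n,s,\Delta)=\mathrm{MCINV}(G)$ for some finite metacyclic group $G$. 2. All of the following hold: - (a) $s\mid m$, $|\Delta|$ divides $n$, $m_\nu=s_\nu=m'_\nu$, and if $4\mid m$ then $4\mid r$; - (b) for every $p\in\pi(r)$, the $p$-part $m'_p$ of $m'$ is given by formula (1); - (c) if $\epsilon=-1$, then $\frac{m_2}{r_2}\le n_2$, $m_2\le 2s_2$ and $s_2\ne n_2r_2$; if moreover $4\mid n$, $8\mid m$ and $o_2<n_2$, then $r_2\le s_2$; - (d) for every $p\in\pi(r)$ with $\epsilon^{p-1}=1$: $\frac{m_p}{r_p}\le s_p\le n_p$, and if $r_p>s_p$ then $n_p<s_po_p$.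 -/

import Mathlib

open scoped Pointwise

/-! ### Arithmetic notation -/

/-- The `p`-part `m_p` of `m`: the largest power of the prime `p` dividing `m`. -/
def pPart (m p : ℕ) : ℕ := p ^ m.factorization p

/-- `m_π = ∏_{p ∈ π} m_p` for a finite set `π` of primes. -/
def piPart (m : ℕ) (π : Finset ℕ) : ℕ := ∏ p ∈ π, pPart m p

/-- The image `Res_q(T)` of `T ≤ 𝒰_m` under the natural map `𝒰_m → 𝒰_q`, where `q ∣ m`. -/
def Res {m q : ℕ} (h : q ∣ m) (T : Subgroup (ZMod m)ˣ) : Subgroup (ZMod q)ˣ :=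
  T.map (ZMod.unitsMap h)

/-- The Hall `π`-subgroup of a (finite) subgroup `T` of an abelian group: the elements of `T`
whose order has all its prime divisors in `π`. -/
def hallPart {U : Type*} [CommGroup U] (π : Set ℕ) (T : Subgroup U) : Subgroup U where
  carrier := {u | u ∈ T ∧ ∀ p : ℕ, p.Prime → p ∣ orderOf u → p ∈ π}
  one_mem' := ⟨T.one_mem, fun p hp h => by
    rw [orderOf_one] at h
    exact absurd (Nat.dvd_one.mp h) hp.ne_one⟩
  mul_mem' := by
    rintro a b ⟨ha, ha'⟩ ⟨hb, hb'⟩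
    refine ⟨T.mul_mem ha hb, fun p hp h => ?_⟩
    have h1 : p ∣ Nat.lcm (orderOf a) (orderOf b) :=
      h.trans (Commute.all a b).orderOf_mul_dvd_lcm
    have h2 : p ∣ orderOf a * orderOf b := h1.trans (Nat.lcm_dvd_mul _ _)
    rcases hp.dvd_mul.mp h2 with h3 | h3
    · exact ha' p hp h3
    · exact hb' p hp h3
  inv_mem' := by
    rintro a ⟨ha, ha'⟩
    refine ⟨T.inv_mem ha, fun p hp h => ha' p hp ?_⟩
    rwa [orderOf_inv] at h

theorem piPart_dvd (m : ℕ) {π : Finset ℕ} (h : π ⊆ m.primeFactors) : piPart m π ∣ m := by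
  rcases Nat.eq_zero_or_pos m with rfl | hm
  · exact dvd_zero _
  · have h1 : piPart m m.primeFactors = m := by
      have := Nat.prod_factorization_pow_eq_self hm.ne'
      simpa [piPart, pPart, Finsupp.prod, Nat.support_factorization] using this
    calc piPart m π ∣ piPart m m.primeFactors := Finset.prod_dvd_prod_of_subset _ _ _ h
      _ = m := h1

/-! ### The triple `(r, ε, o)` attached to a subgroup `T` of `𝒰_m` -/

section Inv

variable {m : ℕ}

/-- `d` is a divisor of `m` with `Res_{d_{2'}}(T) = 1` and `Res_{d_2}(T) ⊆ ⟨-1⟩`. -/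
def IsAdmissible (T : Subgroup (ZMod m)ˣ) (d : ℕ) : Prop :=
  d ∣ m ∧ (∃ h : d / pPart d 2 ∣ m, Res h T = ⊥) ∧
    ∃ h : pPart d 2 ∣ m, Res h T ≤ Subgroup.zpowers (-1)

/-- The entry `r`: the greatest divisor `d` of `m` satisfying `IsAdmissible`. -/
noncomputable def invR (T : Subgroup (ZMod m)ˣ) : ℕ := sSup {d : ℕ | IsAdmissible T d}

open Classical in
/-- The entry `ε`: it is `1` if `Res_{r_2}(T) = 1`, and `-1` otherwise. -/
noncomputable def invEps (T : Subgroup (ZMod m)ˣ) : ℤ :=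
  if ∃ h : pPart (invR T) 2 ∣ m, Res h T = ⊥ then 1 else -1

/-- The set of primes `ν = π(m) \ π(r)`. -/
noncomputable def invNu (T : Subgroup (ZMod m)ˣ) : Finset ℕ :=
  m.primeFactors \ (invR T).primeFactors

/-- The entry `o`: the order of `Res_{m_ν}(T_{ν'})`. -/
noncomputable def invO (T : Subgroup (ZMod m)ˣ) : ℕ :=
  Nat.card (Res (piPart_dvd m (Finset.sdiff_subset : invNu T ⊆ m.primeFactors))
    (hallPart {p | p ∉ invNu T} T))

/-- The triple `(r, ε, o)` of `T`. -/
noncomputable def inv (T : Subgroup (ZMod m)ˣ) : ℕ × ℤ × ℕ := (invR T, invEps T, invO T)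

theorem isAdmissible_invR (hm : m ≠ 0) (T : Subgroup (ZMod m)ˣ) : IsAdmissible T (invR T) := by
  refine Nat.sSup_mem (s := {d : ℕ | IsAdmissible T d}) ⟨1, one_dvd _, ?_, ?_⟩
    ⟨m, fun d hd => Nat.le_of_dvd (Nat.pos_of_ne_zero hm) hd.1⟩
  · have h1 : 1 / pPart 1 2 = 1 := by simp [pPart]
    rw [h1]
    exact ⟨one_dvd _, Subsingleton.elim _ _⟩
  · have h1 : pPart 1 2 = 1 := by simp [pPart]
    rw [h1]
    exact ⟨one_dvd _, fun x _ => by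
      rw [Subsingleton.elim x 1]
      exact Subgroup.one_mem _⟩

theorem invR_dvd (hm : m ≠ 0) (T : Subgroup (ZMod m)ˣ) : invR T ∣ m :=
  (isAdmissible_invR hm T).1

end Inv

/-! ### The numbers `m'_p` and `[T, n, s]` -/

/-- The number `m'_p` computed from `m, n, s` and `(r, ε, o)`, for a prime `p ∣ r`. The second
branch is only met at `p = 2`, `ε = -1`. In the first one all the numbers are powers of `p`, so
that the quotient `r_p s_p o_p / n_p` is exact unless it is less than `1 ≤ r_p`, and rounding it
down does not affect the maximum. -/
def mPrime (p m n s r : ℕ) (ε : ℤ) (o : ℕ) : ℕ :=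
  if ε ^ (p - 1) = 1 then
    min (pPart m p) (min (pPart o p * pPart r p)
      (max (pPart r p) (max (pPart s p) (pPart r p * (pPart s p * pPart o p) / pPart n p))))
  else if pPart o 2 ≤ 2 ∨ pPart m 2 ≤ 2 * pPart r 2 then pPart r 2
  else if 4 ≤ pPart o 2 ∧ pPart o 2 < pPart n 2 ∧ 4 * pPart r 2 ≤ pPart m 2 ∧
      (pPart s 2 ≠ pPart n 2 * pPart r 2 →
        2 * pPart s 2 = pPart m 2 ∧ pPart m 2 < pPart n 2 * pPart r 2) then pPart m 2 / 2
  else pPart m 2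

/-- The number `[T, n, s] = m_ν ∏_{p ∈ π(r)} m'_p`. -/
noncomputable def bracket {m : ℕ} (T : Subgroup (ZMod m)ˣ) (n s : ℕ) : ℕ :=
  piPart m (invNu T) *
    ∏ p ∈ (invR T).primeFactors, mPrime p m n s (invR T) (invEps T) (invO T)

theorem mPrime_dvd {p m r : ℕ} (n s o : ℕ) {ε : ℤ} (hp : p.Prime) (hm : m ≠ 0) (hr : r ∣ m)
    (hε : ε = 1 ∨ ε = -1) : mPrime p m n s r ε o ∣ pPart m p := by
  have hle : ∀ q, pPart r q ∣ pPart m q := fun q => pow_dvd_pow q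
    ((Nat.factorization_le_iff_dvd (ne_zero_of_dvd_ne_zero hm hr) hm).mpr hr q)
  have key : ∀ k : ℕ, (∃ i, k = p ^ i) → min (pPart m p) k ∣ pPart m p := by
    rintro _ ⟨i, rfl⟩
    rcases le_total (pPart m p) (p ^ i) with h | h
    · rw [min_eq_left h]
    · rw [min_eq_right h]
      exact pow_dvd_pow p ((Nat.pow_le_pow_iff_right hp.one_lt).mp h)
  have hmax : ∀ a b : ℕ, (∃ i, a = p ^ i) → (b = 0 ∨ ∃ i, b = p ^ i) → ∃ i, max a b = p ^ i := by
    rintro a b ha hb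
    rcases hb with rfl | hb
    · simpa using ha
    · rcases max_choice a b with h | h <;> rw [h] <;> assumption
  unfold mPrime
  split_ifs with h1 h2 h3
  · refine key _ ?_
    have hq : pPart r p * (pPart s p * pPart o p) / pPart n p = 0 ∨
        ∃ i, pPart r p * (pPart s p * pPart o p) / pPart n p = p ^ i := by
      unfold pPart
      rw [← pow_add, ← pow_add]
      rcases le_or_gt (n.factorization p)
        (r.factorization p + (s.factorization p + o.factorization p)) with h | h
      · exact Or.inr ⟨_, Nat.pow_div h hp.pos⟩
      · exact Or.inl (Nat.div_eq_of_lt (Nat.pow_lt_pow_right hp.one_lt h))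
    have hX := hmax (pPart r p) _ ⟨_, rfl⟩ (Or.inr (hmax (pPart s p) _ ⟨_, rfl⟩ hq))
    rcases min_choice (pPart o p * pPart r p) (max (pPart r p)
      (max (pPart s p) (pPart r p * (pPart s p * pPart o p) / pPart n p))) with h | h
    · rw [h]
      exact ⟨_, (pow_add p _ _).symm⟩
    · rw [h]
      exact hX
  all_goals
    have hp2 : p = 2 := by
      by_contra hne
      rcases hε with rfl | rfl
      · simp at h1
      · exact h1 (Even.neg_one_pow (hp.even_sub_one hne))
    subst hp2
  · exact hle 2
  · refine Nat.div_dvd_of_dvd ?_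
    have h4 : 1 < pPart m 2 := by
      have : 0 < pPart r 2 := pow_pos two_pos _
      omega
    have h5 : m.factorization 2 ≠ 0 := by
      intro h0
      simp [pPart, h0] at h4
    exact dvd_pow_self 2 h5
  · exact dvd_rfl

theorem bracket_dvd {m : ℕ} (hm : m ≠ 0) (T : Subgroup (ZMod m)ˣ) (n s : ℕ) :
    bracket T n s ∣ m := by
  have hr := invR_dvd hm T
  have hsub : (invR T).primeFactors ⊆ m.primeFactors := Nat.primeFactors_mono hr hm
  have hε : invEps T = 1 ∨ invEps T = -1 := by
    unfold invEps
    split_ifs <;> simp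
  have h1 : bracket T n s ∣ piPart m (invNu T) * piPart m (invR T).primeFactors :=
    mul_dvd_mul_left _ (Finset.prod_dvd_prod_of_dvd _ _ fun p hp =>
      mPrime_dvd n s _ (Nat.prime_of_mem_primeFactors hp) hm hr hε)
  have h2 : piPart m (invNu T) * piPart m (invR T).primeFactors = piPart m m.primeFactors :=
    Finset.prod_sdiff hsub
  rw [h2] at h1
  exact h1.trans (piPart_dvd m subset_rfl)

/-! ### Metacyclic groups and their minimal factorizations -/

/-- For a cyclic normal subgroup `A` of `G`, of order `m`, the group `T_G(A)` of those `u ∈ 𝒰_m`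
for which the automorphism `a ↦ a ^ u` of `A` is the restriction of an inner automorphism
of `G`. -/
def actionUnits {G : Type*} [Group G] (A : Subgroup G) : Subgroup (ZMod (Nat.card A))ˣ where
  carrier := {u | ∃ g : G, ∀ a ∈ A, g⁻¹ * a * g = a ^ (u : ZMod (Nat.card A)).val}
  one_mem' := by
    refine ⟨1, fun a ha => ?_⟩
    have h1 : a ^ Nat.card A = 1 := orderOf_dvd_iff_pow_eq_one.mp (A.orderOf_dvd_natCard ha)
    rw [Units.val_one, ZMod.val_one_eq_one_mod, ← pow_eq_pow_mod 1 h1]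
    simp
  mul_mem' := by
    rintro u v ⟨g, hg⟩ ⟨k, hk⟩
    refine ⟨g * k, fun a ha => ?_⟩
    have h1 : a ^ Nat.card A = 1 := orderOf_dvd_iff_pow_eq_one.mp (A.orderOf_dvd_natCard ha)
    rw [Units.val_mul, ZMod.val_mul, ← pow_eq_pow_mod _ h1, pow_mul, ← hk _ (A.pow_mem ha _),
      ← hg a ha]
    group
  inv_mem' := by
    rintro u ⟨g, hg⟩
    refine ⟨g⁻¹, fun a ha => ?_⟩
    have h1 : a ^ Nat.card A = 1 := orderOf_dvd_iff_pow_eq_one.mp (A.orderOf_dvd_natCard ha)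
    have h2 := hg _ (A.pow_mem ha ((u⁻¹ : (ZMod (Nat.card A))ˣ) : ZMod (Nat.card A)).val)
    rw [← pow_mul, pow_eq_pow_mod (_ * _) h1, ← ZMod.val_mul, ← Units.val_mul, inv_mul_cancel,
      Units.val_one, ZMod.val_one_eq_one_mod, ← pow_eq_pow_mod 1 h1, pow_one] at h2
    nth_rewrite 1 [← h2]
    group

/-- A group is metacyclic if it has a cyclic normal subgroup with cyclic quotient. -/
def IsMetacyclic (G : Type*) [Group G] : Prop :=
  ∃ (A : Subgroup G) (_ : A.Normal), IsCyclic A ∧ IsCyclic (G ⧸ A)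

/-- A metacyclic factorization `G = AB`. -/
structure MetacyclicFactorization (G : Type*) [Group G] where
  A : Subgroup G
  B : Subgroup G
  normal : A.Normal
  cyclic_left : IsCyclic A
  cyclic_right : IsCyclic B
  mul_eq : (A : Set G) * (B : Set G) = Set.univ

namespace MetacyclicFactorization

variable {G : Type*} [Group G]

/-- The triple `(|A|, r_G(A), [G : B])`, ordered lexicographically. -/
noncomputable def key (F : MetacyclicFactorization G) : ℕ ×ₗ ℕ ×ₗ ℕ :=
  toLex (Nat.card F.A, toLex (invR (actionUnits F.A), F.B.index))

/-- `G = AB` is a minimal factorization. -/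
def IsMinimal (F : MetacyclicFactorization G) : Prop :=
  ∀ F' : MetacyclicFactorization G, F.key ≤ F'.key

/-- The tuple `(|A|, [G : A], [G : B], Δ(AB))`, where `Δ(AB) = Res_{[T, n, s]}(T)` with
`T = T_G(A)`, `n = [G : A]`, `s = [G : B]`. A subgroup of some `𝒰_k` is given along with `k`. -/
noncomputable def data [Finite G] (F : MetacyclicFactorization G) :
    ℕ × ℕ × ℕ × (Σ k : ℕ, Subgroup (ZMod k)ˣ) :=
  (Nat.card F.A, F.A.index, F.B.index,
    ⟨bracket (actionUnits F.A) F.A.index F.B.index,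
      Res (bracket_dvd Nat.card_pos.ne' (actionUnits F.A) F.A.index F.B.index)
        (actionUnits F.A)⟩)

theorem exists_isMinimal (hG : IsMetacyclic G) :
    ∃ F : MetacyclicFactorization G, F.IsMinimal := by
  obtain ⟨A, hA, hA1, hA2⟩ := hG
  obtain ⟨q, hq⟩ := hA2.exists_generator
  obtain ⟨b, rfl⟩ := QuotientGroup.mk_surjective q
  have hne : Nonempty (MetacyclicFactorization G) := by
    refine ⟨⟨A, Subgroup.zpowers b, hA, hA1, inferInstance, ?_⟩⟩
    refine Set.eq_univ_of_forall fun g => ?_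
    obtain ⟨k, hk⟩ := Subgroup.mem_zpowers_iff.mp (hq (g : G ⧸ A))
    rw [← QuotientGroup.mk_zpow, QuotientGroup.eq] at hk
    refine Set.mem_mul.mpr ⟨g * (b ^ k)⁻¹, ?_, b ^ k, ⟨k, rfl⟩, by group⟩
    have h := hA.conj_mem _ hk (b ^ k)
    have e : b ^ k * ((b ^ k)⁻¹ * g) * (b ^ k)⁻¹ = g * (b ^ k)⁻¹ := by group
    rwa [e] at h
  obtain ⟨F, -, hF⟩ := (InvImage.wf (key (G := G)) wellFounded_lt).has_min Set.univ
    ⟨hne.some, trivial⟩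
  exact ⟨F, fun F' => not_lt.mp (hF F' trivial)⟩

end MetacyclicFactorization

/-- The invariant `MCINV(G) = (|A|, [G : A], [G : B], Δ(AB))` of a finite metacyclic group `G`,
where `G = AB` is a minimal factorization. -/
noncomputable def MCINV (G : Type*) [Group G] [Finite G] (hG : IsMetacyclic G) :
    ℕ × ℕ × ℕ × (Σ k : ℕ, Subgroup (ZMod k)ˣ) :=
  (MetacyclicFactorization.exists_isMinimal hG).choose.data

/-!
A metacyclic factorization `G = ⟨a⟩⟨b⟩` is described by `m = |⟨a⟩|`, `n = [G : ⟨a⟩]` and integers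
`e`, `t` modulo `m` with `b ^ n = a ^ e` and `b⁻¹ a b = a ^ t` (`IsPres`). In these terms
`[G : ⟨b⟩] = gcd (m, e)`, the group of exponents of inner automorphisms on `⟨a⟩` is generated by
`t`, and the commutator subgroup is `⟨a ^ (t - 1)⟩`. The entry `r` is read off from `t` one prime
at a time (`pow_dvd_invR_iff`), and `o` has the same `p`-part, for `p ∉ ν`, as the order of `t`
modulo `m_ν` (`factorization_invO`). Call the inequalities between `m, n, s, r, ε, o` in the last
two conditions of the theorem *the numerical conditions* (`IsMinimalData`). The theorem rests on
three facts.

*A minimal factorization satisfies the numerical conditions*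
(`IsPres.isMinimalData_of_isMinimalTriple`). Some of them hold for every factorization, because `m`
divides `t ^ n - 1` and `e (t - 1)`. For the others, a violation yields a smaller factorization.
Replacing `b` by `b a ^ z` adds a multiple of `1 + t + ⋯ + t ^ (n - 1)` to `e`, so minimality of
`gcd (m, e)` forces it to divide this sum (`IsPres.index_dvd_geomSum`). Replacing `a` by
`a ^ q · b ^ J a ^ (u x)`, where `m = q u` with `q = m_p` and `b ^ J` centralizes the `p'`-part
`⟨a ^ q⟩` of `⟨a⟩` (`IsPres.exists_modification`), gives a smaller `m` (`IsPres.exponent_index_lt`)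
or, if `ε = -1`, the same `m` with a smaller `r` (`IsPres.exponent_invR_le`).

*A factorization satisfying the numerical conditions is minimal, and every other minimal one has
the same invariants* (`IsPres.dataTuple_eq_of_le`). Compare it with a factorization `⟨a'⟩⟨b'⟩`.
The part of `⟨a⟩` of order `m_ν` lies in the commutator subgroup, hence in `⟨a'⟩`, and `b'` may be
chosen to act on it like `b` (`IsPres.exists_pow_of_isCoprime`). For a prime `p ∣ r`, `G` has a
normal `p`-complement, and passing to the quotient reduces the comparison of `p`-parts to a
`p`-group (`IsPres.exists_pGroup_exponents`), where writing `a' = b ^ y a ^ x` and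
`b' = b ^ j a ^ z` one has `o_p ∣ y` and `o_p ∣ j - 1`. If `ε ^ (p - 1) = 1`, then the order of `a`
is least by `IsPres.exponent_le`, `r_p` is determined by the commutator subgroup, the index of
`⟨b⟩` is least by `IsPres.index_exponent_le`, and `t' ≡ t` modulo `m'_p` by `IsPres.pow_dvd_sub`.
If `p = 2` and `ε = -1`, then `b` inverts `⟨a⟩` modulo `4` and the corresponding facts are
`IsPres.exponent_le_of_neg`, `IsPres.rho_le_of_neg`, `IsPres.sigma_le_of_neg` and
`IsPres.exists_pow_dvd_sub_of_neg`.

*Every tuple satisfying the conditions of the theorem comes from such a factorization*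
(`exists_isPres_of_conditions`). The subgroup `Δ` of `𝒰_{m'}` lifts to a cyclic subgroup `⟨t⟩` of
`𝒰_m` with the same `r` (`exists_lift_invR`), and therefore with the same `ε` and with the same
`o_p` for `p ∣ r`. The conditions imply that `m` divides `t ^ n - 1` and `s (t - 1)`
(`dvd_of_isMinimalData`), which makes `b ^ n a ^ (-s)` central in `ℤ / m ℤ ⋊ ℤ`; the quotient by
the subgroup that it generates is the required group (`exists_isPres`).
-/

open scoped commutatorElement

universe u

/-! ### Geometric sums of integers -/

theorem geomSum_mul_range (t : ℤ) (M N : ℕ) :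
    ∑ l ∈ Finset.range (M * N), t ^ l =
      (∑ l ∈ Finset.range M, t ^ l) * ∑ i ∈ Finset.range N, (t ^ M) ^ i := by
  induction N with
  | zero => simp
  | succ N ih =>
    rw [Nat.mul_succ, Finset.sum_range_add, ih, Finset.sum_range_succ, mul_add]
    congr 1
    rw [Finset.sum_mul]
    refine Finset.sum_congr rfl fun l _ => ?_
    rw [pow_add, pow_mul, mul_comm]

theorem dvd_geomSum_sub {d t : ℤ} (h : d ∣ t - 1) (N : ℕ) :
    d ∣ (∑ l ∈ Finset.range N, t ^ l) - N := by
  induction N with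
  | zero => simp
  | succ N ih =>
    rw [Finset.sum_range_succ, Nat.cast_succ]
    have h1 : d ∣ t ^ N - 1 := by simpa using h.trans (sub_dvd_pow_sub_pow t 1 N)
    rw [show ∀ x : ℤ, x + t ^ N - (N + 1) = x - N + (t ^ N - 1) from fun x => by ring]
    exact dvd_add ih h1

theorem dvd_pow_sub_one {d t : ℤ} (h : d ∣ t - 1) (N : ℕ) : d ∣ t ^ N - 1 := by
  simpa using h.trans (sub_dvd_pow_sub_pow t 1 N)

theorem pow_dvd_geomSum {p : ℕ} {t : ℤ} (h : (p : ℤ) ∣ t - 1) (k : ℕ) :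
    (p : ℤ) ^ k ∣ ∑ l ∈ Finset.range (p ^ k), t ^ l := by
  induction k with
  | zero => simp
  | succ k ih =>
    rw [pow_succ, pow_succ, geomSum_mul_range]
    refine mul_dvd_mul ih ?_
    have h1 := dvd_geomSum_sub (dvd_pow_sub_one h (p ^ k)) p
    simpa using dvd_add h1 (dvd_refl (p : ℤ))

theorem pow_dvd_geomSum_of_dvd {p : ℕ} {t : ℤ} (h : (p : ℤ) ∣ t - 1) {k N : ℕ}
    (hN : p ^ k ∣ N) : (p : ℤ) ^ k ∣ ∑ l ∈ Finset.range N, t ^ l := by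
  obtain ⟨c, rfl⟩ := hN
  rw [geomSum_mul_range]
  exact (pow_dvd_geomSum h k).mul_right _

theorem pow_dvd_pow_sub_one {p : ℕ} {t : ℤ} {ρ : ℕ} (hρ : ρ ≠ 0) (h : (p : ℤ) ^ ρ ∣ t - 1)
    {k N : ℕ} (hN : p ^ k ∣ N) : (p : ℤ) ^ (ρ + k) ∣ t ^ N - 1 := by
  rw [← mul_geom_sum, pow_add]
  exact mul_dvd_mul h (pow_dvd_geomSum_of_dvd ((dvd_pow_self _ hρ).trans h) hN)

/-- The geometric sum `1 + t + ⋯ + t ^ (N - 1)` and `N` have the same `p`-part when `t` is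
congruent to `1` modulo `p`, and modulo `4` if `p = 2`. -/
theorem pow_dvd_geomSum_iff {p : ℕ} (hp : p.Prime) {t : ℤ} (h : (p : ℤ) ∣ t - 1)
    (h2 : p = 2 → (4 : ℤ) ∣ t - 1) (k N : ℕ) :
    (p : ℤ) ^ k ∣ ∑ l ∈ Finset.range N, t ^ l ↔ p ^ k ∣ N := by
  have hpI : Prime (p : ℤ) := Nat.prime_iff_prime_int.mp hp
  rcases eq_or_ne t 1 with rfl | ht
  · simp only [one_pow, Finset.sum_const, Finset.card_range, nsmul_eq_mul, mul_one]
    exact_mod_cast Iff.rfl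
  have hpt : ¬ (p : ℤ) ∣ t := fun h3 => by
    have := dvd_sub h3 h
    rw [sub_sub_cancel] at this
    exact hpI.not_isUnit (isUnit_of_dvd_one this)
  have hE : emultiplicity (p : ℤ) (t ^ N - 1) =
      emultiplicity (p : ℤ) (t - 1) + emultiplicity p N := by
    rcases eq_or_ne p 2 with rfl | hp2
    · have := Int.two_pow_sub_pow' (x := t) (y := 1) N (h2 rfl) hpt
      simp only [one_pow] at this
      rw [← Int.natCast_emultiplicity]
      exact_mod_cast this
    · have := Int.emultiplicity_pow_sub_pow hp (hp.odd_of_ne_two hp2) (x := t) (y := 1) h hpt N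
      simpa using this
  rw [← mul_geom_sum, emultiplicity_mul hpI] at hE
  have hfin : emultiplicity (p : ℤ) (t - 1) ≠ ⊤ := by
    refine finiteMultiplicity_iff_emultiplicity_ne_top.mp
      (Int.finiteMultiplicity_iff.mpr ⟨?_, sub_ne_zero.mpr ht⟩)
    simpa using hp.ne_one
  have hS := WithTop.add_left_cancel hfin hE
  rw [pow_dvd_iff_le_emultiplicity, hS, pow_dvd_iff_le_emultiplicity]

theorem two_mul_geomSum (t : ℤ) (N : ℕ) : ∑ l ∈ Finset.range (2 * N), t ^ l =
    (t + 1) * ∑ i ∈ Finset.range N, (t ^ 2) ^ i := by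
  rw [geomSum_mul_range]
  congr 1
  simp [Finset.sum_range_succ, add_comm]

theorem four_dvd_sq_sub_one {t : ℤ} (h : (4 : ℤ) ∣ t + 1) : (4 : ℤ) ∣ t ^ 2 - 1 := by
  have : t ^ 2 - 1 = (t + 1) * (t - 1) := by ring
  rw [this]; exact h.mul_right _

/-- When `t` is `-1` modulo `4`, a geometric sum with an even number `2 N` of terms has the same
`2`-part as `(t + 1) N`. -/
theorem two_pow_dvd_geomSum {t : ℤ} (h : (4 : ℤ) ∣ t + 1) {ρ k N : ℕ}
    (hρ : (2 : ℤ) ^ ρ ∣ t + 1) (hk : 2 ^ k ∣ N) :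
    (2 : ℤ) ^ (ρ + k) ∣ ∑ l ∈ Finset.range (2 * N), t ^ l := by
  rw [two_mul_geomSum, pow_add]
  refine mul_dvd_mul hρ ?_
  exact_mod_cast (pow_dvd_geomSum_iff Nat.prime_two (t := t ^ 2)
    (Dvd.dvd.trans (by norm_num) (four_dvd_sq_sub_one h))
    (fun _ => four_dvd_sq_sub_one h) k N).mpr hk

theorem not_pow_succ_dvd_mul {p : ℕ} (hp : p.Prime) {a b : ℤ} {i j : ℕ}
    (ha : ¬ (p : ℤ) ^ (i + 1) ∣ a) (hb : ¬ (p : ℤ) ^ (j + 1) ∣ b) :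
    ¬ (p : ℤ) ^ (i + j + 1) ∣ a * b := by
  have hpI : Prime (p : ℤ) := Nat.prime_iff_prime_int.mp hp
  intro h
  rw [pow_dvd_iff_le_emultiplicity, not_le] at ha hb
  rw [pow_dvd_iff_le_emultiplicity, emultiplicity_mul hpI] at h
  have ha' : emultiplicity (p : ℤ) a ≤ i := by
    push_cast at ha; exact Order.lt_add_one_iff_of_not_isMax (by simp) |>.mp ha
  have hb' : emultiplicity (p : ℤ) b ≤ j := by
    push_cast at hb; exact Order.lt_add_one_iff_of_not_isMax (by simp) |>.mp hb
  have := h.trans (add_le_add ha' hb')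
  have h3 : i + j + 1 ≤ i + j := by exact_mod_cast this
  omega

/-- Sharpness of `two_pow_dvd_geomSum`. -/
theorem not_two_pow_dvd_geomSum {t : ℤ} (h : (4 : ℤ) ∣ t + 1) {ρ k N : ℕ}
    (hρ : ¬ (2 : ℤ) ^ (ρ + 1) ∣ t + 1) (hk : ¬ 2 ^ (k + 1) ∣ N) :
    ¬ (2 : ℤ) ^ (ρ + k + 1) ∣ ∑ l ∈ Finset.range (2 * N), t ^ l := by
  rw [two_mul_geomSum]
  refine not_pow_succ_dvd_mul Nat.prime_two hρ fun h3 => hk ?_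
  exact (pow_dvd_geomSum_iff Nat.prime_two (t := t ^ 2)
    (Dvd.dvd.trans (by norm_num) (four_dvd_sq_sub_one h))
    (fun _ => four_dvd_sq_sub_one h) (k + 1) N).mp h3

theorem two_dvd_sub_one {t : ℤ} (h : (4 : ℤ) ∣ t + 1) : (2 : ℤ) ∣ t - 1 := by omega

theorem two_pow_dvd_pow_sub_one {t : ℤ} (h : (4 : ℤ) ∣ t + 1) {ρ k N : ℕ}
    (hρ : (2 : ℤ) ^ ρ ∣ t + 1) (hk : 2 ^ k ∣ N) :
    (2 : ℤ) ^ (ρ + k + 1) ∣ t ^ (2 * N) - 1 := by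
  rw [← mul_geom_sum, pow_succ']
  exact mul_dvd_mul (two_dvd_sub_one h) (two_pow_dvd_geomSum h hρ hk)

theorem not_two_pow_dvd_pow_sub_one {t : ℤ} (h : (4 : ℤ) ∣ t + 1) {ρ k N : ℕ}
    (hρ : ¬ (2 : ℤ) ^ (ρ + 1) ∣ t + 1) (hk : ¬ 2 ^ (k + 1) ∣ N) :
    ¬ (2 : ℤ) ^ (ρ + k + 2) ∣ t ^ (2 * N) - 1 := by
  rw [← mul_geom_sum, show ρ + k + 2 = 1 + (ρ + k) + 1 by ring]
  refine not_pow_succ_dvd_mul Nat.prime_two (fun h3 => ?_) (not_two_pow_dvd_geomSum h hρ hk)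
  norm_num at h3
  omega

/-! ### Prime powers and divisibility -/

theorem dvd_of_forall_prime_pow_dvd {a b : ℕ} (h : ∀ p k : ℕ, p.Prime → p ^ k ∣ a → p ^ k ∣ b) :
    a ∣ b := (Nat.dvd_iff_prime_pow_dvd_dvd b a).mpr h

/-- If `gcd (m, e)` does not divide `S`, then it can be made smaller by adding a multiple of `S` to
`e`: the multiplier is the `p'`-part of `m`, for a prime `p` at which divisibility fails. -/
theorem exists_gcd_add_mul_lt {m : ℕ} (hm : m ≠ 0) {e S : ℤ} (h : ¬ (Int.gcd m e : ℤ) ∣ S) :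
    ∃ z : ℤ, Int.gcd m (e + z * S) < Int.gcd m e := by
  have h1 : ¬ Int.gcd m e ∣ S.natAbs := fun h2 => h (Int.natCast_dvd.mpr h2)
  have h1' : ∃ p k : ℕ, p.Prime ∧ p ^ k ∣ Int.gcd m e ∧ ¬ p ^ k ∣ S.natAbs := by
    by_contra hcon
    push Not at hcon
    exact h1 (dvd_of_forall_prime_pow_dvd hcon)
  obtain ⟨p, k, hp, hk1, hk2⟩ := h1'
  have hkS : ¬ (p : ℤ) ^ k ∣ S := fun h3 => hk2 (by
    have := Int.natAbs_dvd_natAbs.mpr h3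
    simpa [Int.natAbs_pow] using this)
  obtain ⟨hkm, hke⟩ : (p : ℤ) ^ k ∣ m ∧ (p : ℤ) ^ k ∣ e := by
    have h3 : ((p ^ k : ℕ) : ℤ) ∣ (Int.gcd m e : ℤ) := Int.natCast_dvd_natCast.mpr hk1
    push_cast at h3
    exact ⟨h3.trans (Int.gcd_dvd_left ..), h3.trans (Int.gcd_dvd_right ..)⟩
  set z : ℕ := m / p ^ m.factorization p with hz
  have hzp : ¬ p ∣ z := Nat.not_dvd_ordCompl hp hm
  have hmz : m = p ^ m.factorization p * z := (Nat.ordProj_mul_ordCompl_eq_self m p).symm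
  have hkey : ¬ (p : ℤ) ^ k ∣ e + z * S := by
    intro h3
    have h4 : (p : ℤ) ^ k ∣ z * S := (dvd_add_right hke).mp h3
    refine hkS (IsCoprime.dvd_of_dvd_mul_left ?_ h4)
    rw [← Nat.cast_pow, Nat.isCoprime_iff_coprime]
    exact (Nat.Prime.coprime_iff_not_dvd hp).mpr hzp |>.pow_left k
  have hdvd : Int.gcd m (e + z * S) ∣ Int.gcd m e := by
    refine dvd_of_forall_prime_pow_dvd fun q i hq hi => ?_
    have h3 : ((q ^ i : ℕ) : ℤ) ∣ (Int.gcd m (e + z * S) : ℤ) := Int.natCast_dvd_natCast.mpr hi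
    have hm3 : ((q ^ i : ℕ) : ℤ) ∣ m := h3.trans (Int.gcd_dvd_left ..)
    have he3 : ((q ^ i : ℕ) : ℤ) ∣ e + z * S := h3.trans (Int.gcd_dvd_right ..)
    refine Int.natCast_dvd_natCast.mp (Int.dvd_coe_gcd hm3 ?_)
    rcases eq_or_ne q p with rfl | hqp
    · have hik : i ≤ k := by
        by_contra hik
        refine hkey (Dvd.dvd.trans ?_ he3)
        push_cast
        exact pow_dvd_pow _ (by omega)
      refine Dvd.dvd.trans ?_ hke
      push_cast
      exact pow_dvd_pow _ hik
    · have h5 : q ^ i ∣ z := by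
        have h6 : q ^ i ∣ p ^ m.factorization p * z := hmz ▸ Int.natCast_dvd_natCast.mp hm3
        exact (Nat.Coprime.pow _ _ ((Nat.coprime_primes hq hp).mpr hqp)).dvd_of_dvd_mul_left h6
      exact (dvd_add_left ((Int.natCast_dvd_natCast.mpr h5).mul_right S)).mp he3
  refine ⟨z, lt_of_le_of_ne
    (Nat.le_of_dvd (Int.gcd_pos_of_ne_zero_left _ (by exact_mod_cast hm)) hdvd) ?_⟩
  intro heq
  rw [← heq] at hk1
  refine hkey (Dvd.dvd.trans ?_ (Int.gcd_dvd_right (m : ℤ) _))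
  exact_mod_cast Int.natCast_dvd_natCast.mpr hk1

/-! ### Generators of a metacyclic factorization -/

/-- Generators `a`, `b` of a metacyclic factorization `⟨a⟩⟨b⟩` of `G`, with `|⟨a⟩| = m`,
`[G : ⟨a⟩] = n`, `b ^ n = a ^ e` and `b⁻¹ a b = a ^ t`. The integers `e` and `t` only matter
modulo `m`. -/
structure IsPres {G : Type*} [Group G] (a b : G) (m n : ℕ) (e t : ℤ) : Prop where
  orderOf_left : orderOf a = m
  conj : b⁻¹ * a * b = a ^ t
  mem_iff : ∀ j : ℕ, b ^ j ∈ Subgroup.zpowers a ↔ n ∣ j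
  pow_right : b ^ n = a ^ e
  gen : ∀ g : G, ∃ (j : ℕ) (i : ℤ), g = b ^ j * a ^ i

section Conj

variable {G : Type*} [Group G] {a b : G} {t : ℤ}

theorem inv_mul_zpow_mul (h : b⁻¹ * a * b = a ^ t) (i : ℤ) : b⁻¹ * a ^ i * b = a ^ (t * i) := by
  have := conj_zpow (i := i) (a := b⁻¹) (b := a)
  rw [inv_inv, h] at this
  rw [← this, zpow_mul]

theorem zpow_mul_pow (h : b⁻¹ * a * b = a ^ t) (i : ℤ) (j : ℕ) :
    a ^ i * b ^ j = b ^ j * a ^ (i * t ^ j) := by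
  induction j with
  | zero => simp
  | succ j ih =>
    rw [pow_succ, ← mul_assoc, ih, mul_assoc, mul_assoc]
    congr 1
    rw [← inv_mul_eq_iff_eq_mul, ← mul_assoc, inv_mul_zpow_mul h]
    congr 1
    ring

theorem inv_mul_zpow_mul_pow (h : b⁻¹ * a * b = a ^ t) (i : ℤ) (j : ℕ) :
    (b ^ j)⁻¹ * a ^ i * b ^ j = a ^ (i * t ^ j) := by
  rw [mul_assoc, zpow_mul_pow h, inv_mul_cancel_left]

/-- The powers of an element of `⟨b⟩⟨a⟩`. -/
theorem mul_zpow_pow (h : b⁻¹ * a * b = a ^ t) (i : ℤ) (j N : ℕ) :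
    (b ^ j * a ^ i) ^ N = b ^ (j * N) * a ^ (i * ∑ l ∈ Finset.range N, (t ^ j) ^ l) := by
  induction N with
  | zero => simp
  | succ N ih =>
    rw [pow_succ', ih, mul_assoc, ← mul_assoc (a ^ i), zpow_mul_pow h, mul_assoc, ← zpow_add,
      ← mul_assoc, ← pow_add, Finset.sum_range_succ, Nat.mul_succ, add_comm j, pow_mul]
    congr 2
    ring

end Conj

theorem orderOf_zpow_eq {G : Type*} [Group G] [Finite G] (a : G) (e : ℤ) :
    orderOf (a ^ e) * Int.gcd (orderOf a) e = orderOf a := by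
  have h : orderOf (a ^ e) = orderOf a / Nat.gcd (orderOf a) e.natAbs := by
    rcases Int.natAbs_eq e with h | h
    · conv_lhs => rw [h]
      rw [zpow_natCast, orderOf_pow]
    · conv_lhs => rw [h]
      rw [zpow_neg, zpow_natCast, orderOf_inv, orderOf_pow]
  rw [h, Int.gcd, Int.natAbs_natCast]
  exact Nat.div_mul_cancel (Nat.gcd_dvd_left _ _)

theorem zpow_mem_zpowers_iff {G : Type*} [Group G] (a : G) (e k : ℤ) :
    a ^ k ∈ Subgroup.zpowers (a ^ e) ↔ (Int.gcd (orderOf a) e : ℤ) ∣ k := by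
  constructor
  · rintro h
    obtain ⟨i, hi⟩ := Subgroup.mem_zpowers_iff.mp h
    rw [← zpow_mul, zpow_eq_zpow_iff_modEq] at hi
    have h1 : (Int.gcd (orderOf a) e : ℤ) ∣ k - e * i :=
      (Int.gcd_dvd_left ..).trans hi.dvd
    have h2 : (Int.gcd (orderOf a) e : ℤ) ∣ e * i := (Int.gcd_dvd_right ..).mul_right i
    simpa using dvd_add h1 h2
  · rintro ⟨c, rfl⟩
    refine Subgroup.mem_zpowers_iff.mpr ⟨Int.gcdB (orderOf a) e * c, ?_⟩
    rw [← zpow_mul, zpow_eq_zpow_iff_modEq, Int.gcd_eq_gcd_ab]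
    refine (Int.modEq_iff_dvd.mpr ?_)
    exact ⟨Int.gcdA (orderOf a) e * c, by ring⟩

namespace IsPres

variable {G : Type*} [Group G] {a b : G} {m n : ℕ} {e t : ℤ}

theorem zpow_eq_zpow_iff (h : IsPres a b m n e t) {i k : ℤ} : a ^ i = a ^ k ↔ (m : ℤ) ∣ k - i := by
  rw [zpow_eq_zpow_iff_modEq, h.orderOf_left, Int.modEq_iff_dvd]

theorem zpow_eq_one_iff (h : IsPres a b m n e t) {i : ℤ} : a ^ i = 1 ↔ (m : ℤ) ∣ i := by
  rw [← orderOf_dvd_iff_zpow_eq_one, h.orderOf_left]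

theorem zpow_mem_iff (h : IsPres a b m n e t) {i k : ℤ} :
    a ^ k ∈ Subgroup.zpowers (a ^ i) ↔ (Int.gcd m i : ℤ) ∣ k := by
  rw [zpow_mem_zpowers_iff, h.orderOf_left]

theorem pos_left [Finite G] (h : IsPres a b m n e t) : 0 < m :=
  h.orderOf_left ▸ orderOf_pos a

theorem normal_zpow (h : IsPres a b m n e t) (k : ℤ) : (Subgroup.zpowers (a ^ k)).Normal := by
  refine ⟨fun x hx g => ?_⟩
  obtain ⟨j, i, hg⟩ := h.gen g⁻¹
  obtain ⟨l, rfl⟩ := Subgroup.mem_zpowers_iff.mp hx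
  rw [show g = (b ^ j * a ^ i)⁻¹ by rw [← hg, inv_inv]]
  have h1 : (b ^ j * a ^ i)⁻¹ * (a ^ k) ^ l * (b ^ j * a ^ i)⁻¹⁻¹ =
      (a ^ i)⁻¹ * ((b ^ j)⁻¹ * (a ^ k) ^ l * b ^ j) * a ^ i := by group
  rw [h1, ← zpow_mul, inv_mul_zpow_mul_pow h.conj]
  refine Subgroup.mem_zpowers_iff.mpr ⟨l * t ^ j, ?_⟩
  rw [← zpow_neg, ← zpow_add, ← zpow_add, ← zpow_mul]
  congr 1
  ring

theorem normal (h : IsPres a b m n e t) : (Subgroup.zpowers a).Normal := by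
  simpa using h.normal_zpow 1

/-- The commutator subgroup is `⟨a ^ (t - 1)⟩`. -/
theorem commutator_eq (h : IsPres a b m n e t) :
    commutator G = Subgroup.zpowers (a ^ (t - 1)) := by
  refine le_antisymm ?_ ?_
  · have hN := h.normal_zpow (t - 1)
    set N := Subgroup.zpowers (a ^ (t - 1)) with hNdef
    have hab : Commute (QuotientGroup.mk' N b) (QuotientGroup.mk' N a) := by
      rw [Commute, SemiconjBy, ← map_mul, ← map_mul, QuotientGroup.mk'_eq_mk']
      refine ⟨(b * a)⁻¹ * (a * b), ?_, by group⟩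
      have h1 : (b * a)⁻¹ * (a * b) = a⁻¹ * (b⁻¹ * a * b) := by group
      rw [h1, h.conj, ← zpow_neg_one, ← zpow_add, neg_add_eq_sub]
      exact Subgroup.mem_zpowers _
    rw [commutator_def, Subgroup.commutator_le]
    intro g _ k _
    obtain ⟨j, i, rfl⟩ := h.gen g
    obtain ⟨j', i', rfl⟩ := h.gen k
    rw [← QuotientGroup.ker_mk' N, MonoidHom.mem_ker, map_commutatorElement,
      commutatorElement_eq_one_iff_commute]
    simp only [map_mul, map_pow, map_zpow]
    refine Commute.mul_left (Commute.mul_right ?_ ?_) (Commute.mul_right ?_ ?_)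
    · exact (Commute.refl _).pow_pow _ _
    · exact (hab.pow_left _).zpow_right _
    · exact (hab.symm.zpow_left _).pow_right _
    · exact (Commute.refl _).zpow_zpow _ _
  · rw [Subgroup.zpowers_le]
    have h1 : a ^ (t - 1) = ⁅a⁻¹, b⁻¹⁆ := by
      rw [commutatorElement_def, inv_inv, inv_inv, mul_assoc, mul_assoc, ← mul_assoc b⁻¹, h.conj,
        ← zpow_neg_one, ← zpow_add, neg_add_eq_sub]
    rw [h1]
    exact Subgroup.commutator_mem_commutator (Subgroup.mem_top _) (Subgroup.mem_top _)

/-- The commutator subgroup lies in the left factor of every factorization. -/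
theorem zpow_sub_one_mem {a' b' : G} {m' n' : ℕ} {e' t' : ℤ} (h : IsPres a b m n e t)
    (h' : IsPres a' b' m' n' e' t') : a ^ (t - 1) ∈ Subgroup.zpowers a' := by
  have h1 : a ^ (t - 1) ∈ commutator G := h.commutator_eq ▸ Subgroup.mem_zpowers _
  rw [h'.commutator_eq] at h1
  exact (Subgroup.zpowers_le.mpr (Subgroup.zpow_mem _ (Subgroup.mem_zpowers a') _)) h1

theorem card_commutator [Finite G] (h : IsPres a b m n e t) :
    Nat.card (commutator G) * Int.gcd m (t - 1) = m := by
  rw [h.commutator_eq, Nat.card_zpowers, ← h.orderOf_left, orderOf_zpow_eq]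

theorem dvd_pow_sub_one (h : IsPres a b m n e t) : (m : ℤ) ∣ t ^ n - 1 := by
  have h1 := inv_mul_zpow_mul_pow h.conj 1 n
  rw [h.pow_right, one_mul, ← zpow_neg, ← zpow_add, ← zpow_add, h.zpow_eq_zpow_iff] at h1
  simpa using h1

theorem dvd_mul_sub_one (h : IsPres a b m n e t) : (m : ℤ) ∣ e * (t - 1) := by
  have h1 := inv_mul_zpow_mul h.conj e
  rw [← h.pow_right, mul_assoc, ← pow_succ, pow_succ', inv_mul_cancel_left, h.pow_right,
    h.zpow_eq_zpow_iff] at h1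
  convert h1 using 1
  ring

theorem isCoprime (h : IsPres a b m n e t) (hn : n ≠ 0) : IsCoprime (m : ℤ) t := by
  obtain ⟨c, hc⟩ := h.dvd_pow_sub_one
  obtain ⟨k, rfl⟩ := Nat.exists_eq_succ_of_ne_zero hn
  refine ⟨-c, t ^ k, ?_⟩
  rw [Nat.succ_eq_add_one, pow_succ] at hc
  linear_combination hc

theorem index_left [Finite G] (h : IsPres a b m n e t) : (Subgroup.zpowers a).index = n := by
  have hN := h.normal
  have hgen : ∀ x : G ⧸ Subgroup.zpowers a, x ∈ Subgroup.zpowers (b : G ⧸ Subgroup.zpowers a) := by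
    intro x
    obtain ⟨g, rfl⟩ := QuotientGroup.mk_surjective x
    obtain ⟨j, i, rfl⟩ := h.gen g
    refine Subgroup.mem_zpowers_iff.mpr ⟨j, ?_⟩
    rw [zpow_natCast, ← QuotientGroup.mk_pow, QuotientGroup.eq, inv_mul_cancel_left]
    exact Subgroup.zpow_mem _ (Subgroup.mem_zpowers a) i
  rw [Subgroup.index, ← orderOf_eq_card_of_forall_mem_zpowers hgen]
  have key : ∀ j : ℕ, orderOf (b : G ⧸ Subgroup.zpowers a) ∣ j ↔ n ∣ j := by
    intro j
    rw [orderOf_dvd_iff_pow_eq_one, ← QuotientGroup.mk_pow, QuotientGroup.eq_one_iff, h.mem_iff]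
  exact Nat.dvd_antisymm ((key n).mpr dvd_rfl) ((key _).mp dvd_rfl)

theorem pos_right [Finite G] (h : IsPres a b m n e t) : 0 < n :=
  h.index_left ▸ Nat.pos_of_ne_zero Subgroup.index_ne_zero_of_finite

theorem card_eq [Finite G] (h : IsPres a b m n e t) : Nat.card G = m * n := by
  rw [← (Subgroup.zpowers a).card_mul_index, h.index_left, Nat.card_zpowers, h.orderOf_left]

theorem orderOf_right_mul [Finite G] (h : IsPres a b m n e t) :
    orderOf b * Int.gcd m e = m * n := by
  have h1 : n ∣ orderOf b := (h.mem_iff _).mp (by rw [pow_orderOf_eq_one]; exact Subgroup.one_mem _)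
  have h2 := orderOf_pow_of_dvd h.pos_right.ne' h1
  have h3 := orderOf_zpow_eq a e
  rw [h.orderOf_left, ← h.pow_right, h2] at h3
  obtain ⟨c, hc⟩ := h1
  rw [hc, Nat.mul_div_cancel_left _ h.pos_right] at h3
  rw [hc, mul_assoc, h3, mul_comm]

theorem index_right [Finite G] (h : IsPres a b m n e t) :
    (Subgroup.zpowers b).index = Int.gcd m e := by
  have h1 := (Subgroup.zpowers b).card_mul_index
  rw [h.card_eq, Nat.card_zpowers, ← h.orderOf_right_mul] at h1
  exact Nat.eq_of_mul_eq_mul_left (orderOf_pos b) h1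

theorem mem_zpowers_iff_int [Finite G] (h : IsPres a b m n e t) (j : ℤ) :
    b ^ j ∈ Subgroup.zpowers a ↔ (n : ℤ) ∣ j := by
  have hpos := orderOf_pos b
  have h1 : n ∣ orderOf b := (h.mem_iff _).mp (by rw [pow_orderOf_eq_one]; exact Subgroup.one_mem _)
  obtain ⟨k, hk⟩ := Int.eq_ofNat_of_zero_le (Int.emod_nonneg j
    (show (orderOf b : ℤ) ≠ 0 by exact_mod_cast hpos.ne'))
  rw [← zpow_mod_orderOf, hk, zpow_natCast, h.mem_iff, ← Int.natCast_dvd_natCast, ← hk]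
  rw [Int.dvd_iff_emod_eq_zero, Int.dvd_iff_emod_eq_zero,
    Int.emod_emod_of_dvd j (Int.natCast_dvd_natCast.mpr h1)]

end IsPres

/-- Generators of the factors of a metacyclic factorization. -/
theorem exists_isPres_of_gen {G : Type*} [Group G] [Finite G] {a b : G}
    (hN : (Subgroup.zpowers a).Normal) (hgen : ∀ g : G, ∃ (j : ℕ) (i : ℤ), g = b ^ j * a ^ i) :
    ∃ e t, IsPres a b (orderOf a) (Subgroup.zpowers a).index e t := by
  have hgen' : ∀ x : G ⧸ Subgroup.zpowers a, x ∈ Subgroup.zpowers (b : G ⧸ Subgroup.zpowers a) := by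
    intro x
    obtain ⟨g, rfl⟩ := QuotientGroup.mk_surjective x
    obtain ⟨j, i, rfl⟩ := hgen g
    refine Subgroup.mem_zpowers_iff.mpr ⟨j, ?_⟩
    rw [zpow_natCast, ← QuotientGroup.mk_pow, QuotientGroup.eq, inv_mul_cancel_left]
    exact Subgroup.zpow_mem _ (Subgroup.mem_zpowers a) i
  have hmem : ∀ j : ℕ, b ^ j ∈ Subgroup.zpowers a ↔ (Subgroup.zpowers a).index ∣ j := by
    intro j
    rw [Subgroup.index, ← orderOf_eq_card_of_forall_mem_zpowers hgen', orderOf_dvd_iff_pow_eq_one,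
      ← QuotientGroup.mk_pow, QuotientGroup.eq_one_iff]
  obtain ⟨e, he⟩ := Subgroup.mem_zpowers_iff.mp ((hmem _).mpr dvd_rfl)
  have hc := hN.conj_mem a (Subgroup.mem_zpowers a) b⁻¹
  rw [inv_inv] at hc
  obtain ⟨t, ht⟩ := Subgroup.mem_zpowers_iff.mp hc
  exact ⟨e, t, rfl, ht.symm, hmem, he.symm, hgen⟩

/-- The product `⟨a⟩⟨b⟩` is written with `b` on the left and with a natural exponent of `b`, as in
`IsPres.gen`. -/
theorem exists_pow_mul_zpow {G : Type*} [Group G] [Finite G] {a b : G}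
    (h : (Subgroup.zpowers a : Set G) * (Subgroup.zpowers b : Set G) = Set.univ) (g : G) :
    ∃ (j : ℕ) (i : ℤ), g = b ^ j * a ^ i := by
  have hg : g⁻¹ ∈ (Subgroup.zpowers a : Set G) * (Subgroup.zpowers b : Set G) := h ▸ Set.mem_univ _
  obtain ⟨x, hx, y, hy, hxy⟩ := Set.mem_mul.mp hg
  obtain ⟨i, rfl⟩ := Subgroup.mem_zpowers_iff.mp hx
  obtain ⟨j, hj⟩ := (isOfFinOrder_of_finite b).mem_powers_iff_mem_zpowers.mpr
    (Subgroup.inv_mem _ hy)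
  refine ⟨j, -i, ?_⟩
  have hj' : b ^ j = y⁻¹ := hj
  rw [hj', zpow_neg, ← mul_inv_rev, hxy, inv_inv]

namespace MetacyclicFactorization

variable {G : Type*} [Group G]

/-- The metacyclic factorization `⟨a⟩⟨b⟩` of a group generated by `a` and `b`. -/
def ofGenerators (a b : G) (hN : (Subgroup.zpowers a).Normal)
    (hgen : ∀ g : G, ∃ (j : ℕ) (i : ℤ), g = b ^ j * a ^ i) : MetacyclicFactorization G where
  A := Subgroup.zpowers a
  B := Subgroup.zpowers b
  normal := hN
  cyclic_left := inferInstance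
  cyclic_right := inferInstance
  mul_eq := by
    refine Set.eq_univ_of_forall fun g => ?_
    obtain ⟨j, i, hg⟩ := hgen g⁻¹
    refine Set.mem_mul.mpr ⟨a ^ (-i), Subgroup.zpow_mem _ (Subgroup.mem_zpowers a) _, (b ^ j)⁻¹,
      Subgroup.inv_mem _ (Subgroup.pow_mem _ (Subgroup.mem_zpowers b) _), ?_⟩
    rw [zpow_neg, ← mul_inv_rev, ← hg, inv_inv]

theorem exists_isPres [Finite G] (F : MetacyclicFactorization G) {a b : G}
    (ha : Subgroup.zpowers a = F.A) (hb : Subgroup.zpowers b = F.B) :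
    ∃ e t, IsPres a b (Nat.card F.A) F.A.index e t := by
  have hN : (Subgroup.zpowers a).Normal := ha ▸ F.normal
  have hmul := F.mul_eq
  rw [← ha, ← hb] at hmul
  have := exists_isPres_of_gen hN (exists_pow_mul_zpow hmul)
  rwa [← Nat.card_zpowers, ha] at this

end MetacyclicFactorization

/-- The group of exponents of inner automorphisms of `G` on `⟨a⟩` is generated by `t`. -/
theorem IsPres.actionUnits_eq {G : Type*} [Group G] [Finite G] {a b : G} {n : ℕ} {e t : ℤ}
    {A : Subgroup G} (hA : Subgroup.zpowers a = A) (h : IsPres a b (Nat.card A) n e t) :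
    ∃ τ : (ZMod (Nat.card A))ˣ, ((τ : ZMod (Nat.card A)) = (t : ZMod (Nat.card A))) ∧
      actionUnits A = Subgroup.zpowers τ := by
  set m := Nat.card A with hm
  have hm0 : NeZero m := ⟨h.pos_left.ne'⟩
  obtain ⟨u, v, huv⟩ := h.isCoprime h.pos_right.ne'
  have hv : (v : ZMod m) * t = 1 := by
    have := congrArg (Int.cast : ℤ → ZMod m) huv
    push_cast at this
    simpa using this
  let τ : (ZMod m)ˣ := ⟨t, v, by rw [mul_comm]; exact hv, hv⟩
  have hcast : ∀ (u : ZMod m) (k : ℤ), u = (k : ZMod m) ↔ a ^ u.val = a ^ k := by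
    intro u k
    rw [← zpow_natCast, h.zpow_eq_zpow_iff, ← ZMod.intCast_eq_intCast_iff_dvd_sub]
    simp
  refine ⟨τ, rfl, ?_⟩
  ext u
  constructor
  · rintro ⟨g, hg⟩
    obtain ⟨j, i, rfl⟩ := h.gen g
    have h1 := hg a (hA ▸ Subgroup.mem_zpowers a)
    have h2 : (b ^ j * a ^ i)⁻¹ * a * (b ^ j * a ^ i) = a ^ (t ^ j) := by
      have h3 := inv_mul_zpow_mul_pow h.conj 1 j
      rw [zpow_one, one_mul] at h3
      have h4 : (b ^ j * a ^ i)⁻¹ * a * (b ^ j * a ^ i) =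
        (a ^ i)⁻¹ * ((b ^ j)⁻¹ * a * b ^ j) * a ^ i := by group
      rw [h4, h3, ← zpow_neg, ← zpow_add, ← zpow_add]
      congr 1
      ring
    rw [h2] at h1
    refine Subgroup.mem_zpowers_iff.mpr ⟨j, Units.ext ?_⟩
    rw [(hcast u (t ^ j)).mpr h1.symm]
    push_cast
    simp [τ]
  · intro hu
    obtain ⟨j, hj⟩ := (isOfFinOrder_of_finite τ).mem_powers_iff_mem_zpowers.mpr hu
    have hj' : τ ^ j = u := hj
    refine ⟨b ^ j, fun x hx => ?_⟩
    rw [← hA] at hx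
    obtain ⟨i, rfl⟩ := Subgroup.mem_zpowers_iff.mp hx
    rw [inv_mul_zpow_mul_pow h.conj, mul_comm, zpow_mul, ← (hcast u (t ^ j)).mp ?_]
    · rw [← zpow_natCast, ← zpow_natCast, ← zpow_mul, ← zpow_mul, mul_comm]
    · rw [← hj']
      push_cast
      rfl

/-! ### Comparison of two metacyclic factorizations of a `p`-group -/

/-- A positive representative of `t` modulo `m`, for use as a number of terms of a geometric sum.
-/
theorem exists_pos_natCast_sub_dvd {m : ℕ} (hm : 0 < m) (t : ℤ) :
    ∃ T : ℕ, 1 ≤ T ∧ (m : ℤ) ∣ T - t := by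
  obtain ⟨k, hk⟩ := Int.eq_ofNat_of_zero_le (Int.emod_nonneg t
    (show (m : ℤ) ≠ 0 by exact_mod_cast hm.ne'))
  refine ⟨k + m, by omega, ?_⟩
  have h1 : (m : ℤ) ∣ t - k := by
    rw [← show t % m = k from hk]; exact Int.dvd_self_sub_emod
  rw [show ((k + m : ℕ) : ℤ) - t = m - (t - k) by push_cast; ring]
  exact dvd_sub dvd_rfl h1

/-- The effect of `b' = b ^ j a ^ z` on `a' = b ^ y a ^ x` in terms of the parameters of `a`
and `b`. -/
theorem IsPres.exists_conj_eq {G : Type*} [Group G] {a b a' b' : G} {m n m' n' : ℕ}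
    {e t e' t' : ℤ} (h : IsPres a b m n e t) (h' : IsPres a' b' m' n' e' t') {y j T : ℕ} {x z : ℤ}
    (ha' : a' = b ^ y * a ^ x) (hb' : b' = b ^ j * a ^ z) (hT : 1 ≤ T) (hTt : (m' : ℤ) ∣ T - t') :
    ∃ c : ℕ, y * (T - 1) = n * c ∧
      (m : ℤ) ∣ e * c -
        (x * t ^ j + z * (1 - t ^ y) - x * ∑ l ∈ Finset.range T, (t ^ y) ^ l) := by
  have h1 : b'⁻¹ * a' * b' = b ^ y * a ^ (x * t ^ j + z * (1 - t ^ y)) := by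
    have e1 : b'⁻¹ * a' * b' = (a ^ z)⁻¹ * b ^ y * ((b ^ j)⁻¹ * a ^ x * b ^ j) * a ^ z := by
      rw [ha', hb', mul_inv_rev]
      have : (b ^ j)⁻¹ * b ^ y = b ^ y * (b ^ j)⁻¹ :=
        ((Commute.refl b).pow_pow y j).inv_right.eq.symm
      simp only [mul_assoc]
      rw [← mul_assoc (b ^ j)⁻¹, this, mul_assoc]
    rw [e1, inv_mul_zpow_mul_pow h.conj, ← zpow_neg, zpow_mul_pow h.conj, mul_assoc, mul_assoc,
      ← zpow_add, ← zpow_add]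
    congr 2
    ring
  have h2 : b'⁻¹ * a' * b' = b ^ (y * T) * a ^ (x * ∑ l ∈ Finset.range T, (t ^ y) ^ l) := by
    rw [h'.conj, ← mul_zpow_pow h.conj, ← ha', ← zpow_natCast, h'.zpow_eq_zpow_iff]
    exact hTt
  rw [h1] at h2
  have h3 : b ^ (y * (T - 1)) = a ^ (x * t ^ j + z * (1 - t ^ y) -
      x * ∑ l ∈ Finset.range T, (t ^ y) ^ l) := by
    have hy : y * T = y + y * (T - 1) := by
      obtain ⟨k, rfl⟩ := Nat.exists_eq_add_of_le hT
      simp; ring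
    rw [hy, pow_add, mul_assoc, mul_right_inj] at h2
    rw [zpow_sub, h2, mul_inv_cancel_right]
  obtain ⟨c, hc⟩ := (h.mem_iff _).mp (h3 ▸ Subgroup.zpow_mem _ (Subgroup.mem_zpowers a) _)
  refine ⟨c, hc, ?_⟩
  rw [hc, pow_mul, h.pow_right, ← zpow_natCast, ← zpow_mul, h.zpow_eq_zpow_iff] at h3
  rwa [dvd_sub_comm]

section PGroup

variable {P : Type*} [Group P] [Finite P] {p : ℕ} {a b a' b' : P}
  {μ η σ ρ ω μ' η' σ' : ℕ} {e t e' t' : ℤ} {y j : ℕ} {x z : ℤ}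

theorem pow_dvd_of_gcd_eq {k : ℤ} (h : Int.gcd (p ^ μ : ℕ) k = p ^ ρ) : (p : ℤ) ^ ρ ∣ k := by
  have := Int.gcd_dvd_right ((p ^ μ : ℕ) : ℤ) k
  rw [h] at this
  exact_mod_cast this

theorem le_of_gcd_eq (hp : p.Prime) {k : ℤ} (h : Int.gcd (p ^ μ : ℕ) k = p ^ ρ) : ρ ≤ μ := by
  have := Int.gcd_dvd_left ((p ^ μ : ℕ) : ℤ) k
  rw [h] at this
  exact (Nat.pow_dvd_pow_iff_le_right hp.one_lt).mp (by exact_mod_cast this)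

theorem le_of_pow_dvd_of_gcd_eq (hp : p.Prime) {k : ℤ} (h : Int.gcd (p ^ μ : ℕ) k = p ^ ρ) {i : ℕ}
    (hi : i ≤ μ) (hk : (p : ℤ) ^ i ∣ k) : i ≤ ρ := by
  have : ((p ^ i : ℕ) : ℤ) ∣ Int.gcd (p ^ μ : ℕ) k :=
    Int.dvd_coe_gcd (by exact_mod_cast pow_dvd_pow p hi) (by exact_mod_cast hk)
  rw [h] at this
  exact (Nat.pow_dvd_pow_iff_le_right hp.one_lt).mp (by exact_mod_cast this)

namespace IsPres

theorem exponent_add_eq (hp : p.Prime) (h : IsPres a b (p ^ μ) (p ^ η) e t)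
    (h' : IsPres a' b' (p ^ μ') (p ^ η') e' t') : μ + η = μ' + η' := by
  have h1 := h.card_eq.symm.trans h'.card_eq
  rw [← pow_add, ← pow_add] at h1
  exact Nat.pow_right_injective hp.two_le h1

/-- If `a' = b ^ y a ^ x` and `b' = b ^ j a ^ z` generate `P`, where `p ∣ y`, then `p ∤ x`:
otherwise `a'` would lie in the Frattini subgroup, modulo which `a` and `b` are independent since
`p ∣ e`. -/
theorem not_dvd_of_factorization (hp : p.Prime) (h : IsPres a b (p ^ μ) (p ^ η) e t)
    (h' : IsPres a' b' (p ^ μ') (p ^ η') e' t') (hρ : (p : ℤ) ∣ t - 1) (he : (p : ℤ) ∣ e)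
    (hμ : μ ≠ 0) (hω : ω ≠ 0) (hωη : ω ≤ η)
    (ha' : a' = b ^ y * a ^ x) (hy : p ^ ω ∣ y) (hb' : b' = b ^ j * a ^ z)
    (hj : (p : ℤ) ^ ω ∣ j - 1) : ¬ (p : ℤ) ∣ x := by
  intro hx
  obtain ⟨i, l, hil⟩ := h'.gen a
  have hN := h.normal_zpow (p : ℤ)
  set N := Subgroup.zpowers (a ^ (p : ℤ)) with hNdef
  have hgcd : Int.gcd (p ^ μ : ℕ) (p : ℤ) = p := by
    rw [Int.gcd_natCast_natCast]
    exact Nat.gcd_eq_right (dvd_pow_self p hμ)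
  have hmemN : ∀ k : ℤ, a ^ k ∈ N ↔ (p : ℤ) ∣ k := fun k => by rw [hNdef, h.zpow_mem_iff, hgcd]
  have hab : Commute (QuotientGroup.mk' N b) (QuotientGroup.mk' N a) := by
    rw [Commute, SemiconjBy, ← map_mul, ← map_mul, QuotientGroup.mk'_eq_mk']
    refine ⟨(b * a)⁻¹ * (a * b), ?_, by group⟩
    have h1 : (b * a)⁻¹ * (a * b) = a⁻¹ * (b⁻¹ * a * b) := by group
    rw [h1, h.conj, ← zpow_neg_one, ← zpow_add, neg_add_eq_sub]
    exact (hmemN _).mpr hρ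
  have h1 := congrArg (QuotientGroup.mk' N) hil
  rw [hb', ha'] at h1
  simp only [map_mul, map_pow, map_zpow] at h1
  set α := QuotientGroup.mk' N a with hα
  set β := QuotientGroup.mk' N b with hβ
  have h2 : α = β ^ ((j * i + y * l : ℤ)) * α ^ (z * i + x * l) := by
    have c1 : Commute (β ^ j) (α ^ z) := (hab.pow_left _).zpow_right _
    have c2 : Commute (β ^ y) (α ^ x) := (hab.pow_left _).zpow_right _
    rw [c1.mul_pow, c2.mul_zpow, ← pow_mul, ← zpow_natCast β (j * i), ← zpow_natCast (α ^ z),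
      ← zpow_mul, ← zpow_natCast β y, ← zpow_mul, ← zpow_mul, mul_assoc,
      ← mul_assoc (α ^ (z * (i : ℤ))),
      ← ((hab.zpow_left (y * l)).zpow_right (z * i)).eq, mul_assoc, ← zpow_add, ← mul_assoc,
      ← zpow_add] at h1
    exact_mod_cast h1
  have h3 : b ^ (j * i + y * l : ℤ) * a ^ (z * i + x * l - 1) ∈ N := by
    rw [← QuotientGroup.ker_mk' N, MonoidHom.mem_ker, map_mul, map_zpow, map_zpow, zpow_sub,
      ← mul_assoc, ← h2, zpow_one, mul_inv_cancel]
  have hNle : N ≤ Subgroup.zpowers a :=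
    Subgroup.zpowers_le.mpr (Subgroup.zpow_mem _ (Subgroup.mem_zpowers a) _)
  have h4 : b ^ (j * i + y * l : ℤ) ∈ Subgroup.zpowers a :=
    (Subgroup.mul_mem_cancel_right _ (Subgroup.zpow_mem _ (Subgroup.mem_zpowers a) _)).mp
      (hNle h3)
  rw [h.mem_zpowers_iff_int] at h4
  have hpη : (p : ℤ) ∣ (p ^ η : ℕ) := by
    exact_mod_cast dvd_pow_self p (by omega : η ≠ 0)
  have hpi : (p : ℤ) ∣ i := by
    have h5 : (p : ℤ) ∣ j * i + y * l := hpη.trans h4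
    have h6 : (p : ℤ) ∣ y * l := by
      refine Dvd.dvd.mul_right ?_ l
      exact_mod_cast (dvd_pow_self p hω).trans hy
    have h7 := (dvd_add_left h6).mp h5
    have h8 : (p : ℤ) ∣ (j - 1) * i := ((dvd_pow_self _ hω).trans hj).mul_right _
    have := dvd_sub h7 h8
    rwa [show (j : ℤ) * i - (j - 1) * i = i by ring] at this
  obtain ⟨c, hc⟩ := h4
  rw [hc, zpow_mul, zpow_natCast, h.pow_right, ← zpow_mul, ← zpow_add, hmemN] at h3
  have h9 : (p : ℤ) ∣ z * i + x * l - 1 := (dvd_add_right (he.mul_right c)).mp h3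
  have h10 : (p : ℤ) ∣ z * i + x * l := dvd_add (hpi.mul_left z) (hx.mul_right l)
  have := dvd_sub h10 h9
  rw [sub_sub_cancel] at this
  exact (Nat.prime_iff_prime_int.mp hp).not_isUnit (isUnit_of_dvd_one this)

omit [Finite P] in
theorem mul_zpow_pow_eq (h : IsPres a b (p ^ μ) (p ^ η) e t) (N : ℕ) (hN : p ^ η ∣ j * N) :
    ∃ c : ℕ, j * N = p ^ η * c ∧ (b ^ j * a ^ z) ^ N =
      a ^ (e * c + z * ∑ l ∈ Finset.range N, (t ^ j) ^ l) := by
  obtain ⟨c, hc⟩ := hN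
  refine ⟨c, hc, ?_⟩
  rw [mul_zpow_pow h.conj, hc, pow_mul, h.pow_right, ← zpow_natCast, ← zpow_mul, ← zpow_add]

/-- In a `p`-group in which `b` acts on `⟨a⟩` as some `t ≡ 1` modulo `p`, the order of `a` is least
if `s ≤ n` and either `r ≤ s` or `n < s o`. Here `m, n, s, r, o` are the powers of `p` with
exponents `μ, η, σ, ρ, ω`, and the second factorization is assumed to have `a' ∈ ⟨b ^ o⟩⟨a⟩` and
`b' ∈ b ⟨b ^ o⟩⟨a⟩`. -/
theorem exponent_le (hp : p.Prime) (h : IsPres a b (p ^ μ) (p ^ η) e t)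
    (h' : IsPres a' b' (p ^ μ') (p ^ η') e' t') (hσ : Int.gcd (p ^ μ : ℕ) e = p ^ σ)
    (hρ : Int.gcd (p ^ μ : ℕ) (t - 1) = p ^ ρ) (hρ0 : ρ ≠ 0) (hωη : ω ≤ η)
    (hση : σ ≤ η) (hc : ρ ≤ σ ∨ η < σ + ω)
    (ha' : a' = b ^ y * a ^ x) (hy : p ^ ω ∣ y) (hb' : b' = b ^ j * a ^ z)
    (hj : (p : ℤ) ^ ω ∣ j - 1) : μ ≤ μ' := by
  have hadd := exponent_add_eq hp h h'
  have he := pow_dvd_of_gcd_eq hσ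
  have ht := pow_dvd_of_gcd_eq hρ
  have hρμ := le_of_gcd_eq hp hρ
  have hpt : (p : ℤ) ∣ t - 1 := (dvd_pow_self _ hρ0).trans ht
  by_cases hρσ : ρ ≤ σ
  · obtain ⟨c, -, hc⟩ := h.mul_zpow_pow_eq (j := j) (z := z) (p ^ η) (dvd_mul_left _ _)
    -- the commutator subgroup contains `b' ^ (p ^ η)` and lies in `⟨a'⟩`, so `η' ≤ η`
    have h1 : b' ^ p ^ η ∈ Subgroup.zpowers a' := by
      rw [hb', hc]
      have h2 : a ^ (e * c + z * ∑ l ∈ Finset.range (p ^ η), (t ^ j) ^ l) ∈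
          Subgroup.zpowers (a ^ (t - 1)) := by
        rw [h.zpow_mem_iff, hρ]
        push_cast
        refine dvd_add (((pow_dvd_pow _ hρσ).trans he).mul_right _) (Dvd.dvd.mul_left ?_ _)
        exact (pow_dvd_pow _ (hρσ.trans hση)).trans
          (pow_dvd_geomSum (_root_.dvd_pow_sub_one hpt j) η)
      exact (Subgroup.zpowers_le.mpr (h.zpow_sub_one_mem h')) h2
    rw [h'.mem_iff, Nat.pow_dvd_pow_iff_le_right hp.one_lt] at h1
    omega
  · have hc' : η < σ + ω := hc.resolve_left hρσ
    have hx : ¬ (p : ℤ) ∣ x := not_dvd_of_factorization hp h h' hpt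
      ((dvd_pow_self _ (by omega)).trans he) (by omega) (by omega : ω ≠ 0) hωη ha' hy hb' hj
    obtain ⟨κ, -, hκ⟩ : ∃ κ ≤ μ', Int.gcd (p ^ μ' : ℕ) (t' - 1) = p ^ κ :=
      (Nat.dvd_prime_pow hp).mp (Int.natCast_dvd_natCast.mp (Int.gcd_dvd_left ..))
    have hcard := h.card_commutator
    have hcard' := h'.card_commutator
    rw [hρ] at hcard
    rw [hκ] at hcard'
    by_contra hlt
    -- if `μ' < μ`, then `a' ^ (p ^ (ρ - 1))` lies in the commutator subgroup `⟨a ^ (p ^ ρ)⟩`; it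
    -- equals `a ^ (e c + x W)` with `p ^ ρ ∣ e c` and `W ≡ p ^ (ρ - 1)` modulo `p ^ ρ`, so that
    -- `p ∣ x`
    have hκρ : κ < ρ := by
      refine (Nat.pow_lt_pow_iff_right hp.one_lt).mp ?_
      refine lt_of_mul_lt_mul_left (a := Nat.card (commutator P)) ?_ (Nat.zero_le _)
      rw [hcard, hcard']
      exact Nat.pow_lt_pow_right hp.one_lt (by omega)
    have h1 : a' ^ p ^ (ρ - 1) ∈ Subgroup.zpowers (a ^ (t - 1)) := by
      rw [← h.commutator_eq, h'.commutator_eq, ← zpow_natCast, h'.zpow_mem_iff, hκ]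
      exact_mod_cast pow_dvd_pow p (by omega : κ ≤ ρ - 1)
    have h2 : p ^ η ∣ y * p ^ (ρ - 1) := by
      rw [← h.mem_iff]
      have h3 := (Subgroup.zpowers_le.mpr
        (Subgroup.zpow_mem _ (Subgroup.mem_zpowers a) (t - 1))) h1
      rw [ha', mul_zpow_pow h.conj] at h3
      exact (Subgroup.mul_mem_cancel_right _
        (Subgroup.zpow_mem _ (Subgroup.mem_zpowers a) _)).mp h3
    obtain ⟨c, hc1, hc2⟩ := h.mul_zpow_pow_eq (j := y) (z := x) (p ^ (ρ - 1)) h2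
    rw [ha', hc2, h.zpow_mem_iff, hρ] at h1
    push_cast at h1
    have h4 : (p : ℤ) ^ ρ ∣ e * c := by
      obtain ⟨y', rfl⟩ := hy
      have h5 : (p : ℤ) ^ (σ + ω + (ρ - 1)) ∣ p ^ η * (e * c) := by
        have h6 : (p : ℤ) ^ η * (e * c) = e * (p ^ ω * y' * p ^ (ρ - 1)) := by
          have : ((p : ℤ) ^ ω * y' * p ^ (ρ - 1)) = p ^ η * c := by exact_mod_cast hc1
          rw [this]; ring
        rw [h6, pow_add, pow_add, mul_assoc]
        exact mul_dvd_mul he ⟨y', by ring⟩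
      have h7 : (p : ℤ) ^ η * p ^ ρ ∣ p ^ η * (e * c) := by
        rw [← pow_add]
        exact (pow_dvd_pow _ (by omega)).trans h5
      exact Int.dvd_of_mul_dvd_mul_left (pow_ne_zero _ (by exact_mod_cast hp.ne_zero)) h7
    have h8 := (dvd_add_right h4).mp h1
    have h9 : (p : ℤ) ^ ρ ∣ x * ((∑ l ∈ Finset.range (p ^ (ρ - 1)), (t ^ y) ^ l) -
        (p ^ (ρ - 1) : ℕ)) :=
      (dvd_geomSum_sub (ht.trans (_root_.dvd_pow_sub_one dvd_rfl y)) _).mul_left x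
    have h10 := dvd_sub h8 h9
    rw [← mul_sub, sub_sub_cancel] at h10
    have h11 : (p : ℤ) ^ (ρ - 1) * p ∣ p ^ (ρ - 1) * x := by
      rw [← pow_succ, Nat.sub_add_cancel (by omega), mul_comm]
      exact_mod_cast h10
    exact hx (Int.dvd_of_mul_dvd_mul_left (pow_ne_zero _ (by exact_mod_cast hp.ne_zero)) h11)

/-- Both sides are `|⟨a⟩|` divided by the order of the commutator subgroup. -/
theorem gcd_sub_one_eq (h : IsPres a b (p ^ μ) (p ^ η) e t)
    (h' : IsPres a' b' (p ^ μ) (p ^ η') e' t') :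
    Int.gcd (p ^ μ : ℕ) (t' - 1) = Int.gcd (p ^ μ : ℕ) (t - 1) := by
  have h1 := h.card_commutator
  have h2 := h'.card_commutator
  exact Nat.eq_of_mul_eq_mul_left Nat.card_pos (h2.trans h1.symm)

/-- When `s ≤ n`, no element has order greater than that of `b`, so that `⟨b⟩` has least index. -/
theorem index_exponent_le (hp : p.Prime) (h : IsPres a b (p ^ μ) (p ^ η) e t)
    (h' : IsPres a' b' (p ^ μ') (p ^ η') e' t') (hσ : Int.gcd (p ^ μ : ℕ) e = p ^ σ)
    (hσ' : Int.gcd (p ^ μ' : ℕ) e' = p ^ σ') (ht : (p : ℤ) ∣ t - 1) (hση : σ ≤ η) : σ ≤ σ' := by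
  have hσμ := le_of_gcd_eq hp hσ
  have h1 := h.orderOf_right_mul
  have h2 := h'.orderOf_right_mul
  rw [← h'.card_eq, h.card_eq, ← h1, hσ, hσ'] at h2
  have hord : orderOf b = p ^ (η + μ - σ) := by
    refine Nat.eq_of_mul_eq_mul_right (Nat.pow_pos hp.pos : 0 < p ^ σ) ?_
    rw [← hσ, h1, hσ, ← pow_add, ← pow_add]
    congr 1; omega
  obtain ⟨j, z, hb'⟩ := h.gen b'
  have h3 : orderOf b' ∣ orderOf b := by
    rw [orderOf_dvd_iff_pow_eq_one, hb', mul_zpow_pow h.conj, mul_comm j, pow_mul,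
      pow_orderOf_eq_one, one_pow, one_mul, h.zpow_eq_one_iff, hord]
    push_cast
    refine Dvd.dvd.mul_left ?_ _
    exact (pow_dvd_pow _ (by omega)).trans (pow_dvd_geomSum (_root_.dvd_pow_sub_one ht j) _)
  have h4 : orderOf b' ≤ orderOf b := Nat.le_of_dvd (orderOf_pos b) h3
  refine (Nat.pow_le_pow_iff_right hp.one_lt).mp ?_
  by_contra hlt
  have := Nat.mul_lt_mul_of_le_of_lt h4 (not_le.mp hlt) (orderOf_pos b)
  omega

omit [Finite P] in
/-- If `p ∤ e`, then `a` is a power of `b` and the group is abelian. -/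
theorem dvd_exponent_of (hp : p.Prime) (h : IsPres a b (p ^ μ) (p ^ η) e t)
    (hρ : Int.gcd (p ^ μ : ℕ) (t - 1) = p ^ ρ) (hρμ : ρ < μ) : (p : ℤ) ∣ e := by
  by_contra hpe
  have h1 := h.dvd_mul_sub_one
  have h2 : IsCoprime ((p ^ μ : ℕ) : ℤ) e := by
    rw [Nat.cast_pow]
    exact ((Nat.prime_iff_prime_int.mp hp).coprime_iff_not_dvd.mpr hpe).pow_left
  have h3 := le_of_pow_dvd_of_gcd_eq hp hρ le_rfl (by exact_mod_cast h2.dvd_of_dvd_mul_left h1)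
  omega

/-- The actions of `b` on `⟨a⟩` and of `b'` on `⟨a'⟩` agree modulo `p ^ M`, for `p ^ M` at most
`o r` and at most one of `r`, `s` and `r s o / n`. -/
theorem pow_dvd_sub (hp : p.Prime) (h : IsPres a b (p ^ μ) (p ^ η) e t)
    (h' : IsPres a' b' (p ^ μ) (p ^ η') e' t') (hσ : Int.gcd (p ^ μ : ℕ) e = p ^ σ)
    (hρ : Int.gcd (p ^ μ : ℕ) (t - 1) = p ^ ρ) (hρ0 : ρ ≠ 0) (hωη : ω ≤ η)
    (ha' : a' = b ^ y * a ^ x) (hy : p ^ ω ∣ y) (hb' : b' = b ^ j * a ^ z)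
    (hj : (p : ℤ) ^ ω ∣ j - 1) {M : ℕ} (hM1 : M ≤ μ) (hM2 : M ≤ ω + ρ)
    (hM3 : M ≤ ρ ∨ M ≤ σ ∨ M + η ≤ ρ + σ + ω) : (p : ℤ) ^ M ∣ t' - t := by
  have hρ' := (gcd_sub_one_eq h h').trans hρ
  have ht := pow_dvd_of_gcd_eq hρ
  have ht' := pow_dvd_of_gcd_eq hρ'
  have he := pow_dvd_of_gcd_eq hσ
  have hp0 : (p : ℤ) ≠ 0 := by exact_mod_cast hp.ne_zero
  by_cases hMρ : M ≤ ρ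
  · have := (pow_dvd_pow _ hMρ).trans (dvd_sub ht' ht)
    rwa [sub_sub_sub_cancel_right] at this
  have hx : ¬ (p : ℤ) ∣ x := not_dvd_of_factorization hp h h' ((dvd_pow_self _ hρ0).trans ht)
    (h.dvd_exponent_of hp hρ (by omega)) (by omega) (by omega : ω ≠ 0) hωη ha' hy hb' hj
  obtain ⟨T, hT1, hT2⟩ := exists_pos_natCast_sub_dvd (Nat.pow_pos hp.pos : 0 < p ^ μ) t'
  obtain ⟨c, hc1, hc2⟩ := h.exists_conj_eq h' ha' hb' hT1 hT2
  push_cast at hc2 hT2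
  -- `b ^ (y (T - 1)) = a ^ (e c)` is trivial modulo `p ^ M`
  have hec : (p : ℤ) ^ M ∣ e * c := by
    have hT3 : (p : ℤ) ^ ρ ∣ T - 1 := by
      have := dvd_add ((pow_dvd_pow _ (le_of_gcd_eq hp hρ)).trans hT2) ht'
      rwa [sub_add_sub_cancel] at this
    rcases hM3.resolve_left hMρ with hM4 | hM4
    · exact ((pow_dvd_pow _ hM4).trans he).mul_right _
    · have h7 : (p : ℤ) ^ η * p ^ M ∣ p ^ η * (e * c) := by
        have h6 : (p : ℤ) ^ η * (e * c) = e * (y * (T - 1)) := by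
          have : ((y * (T - 1 : ℕ) : ℕ) : ℤ) = p ^ η * c := by exact_mod_cast hc1
          rw [show (y : ℤ) * (T - 1) = p ^ η * c by rw [← this]; push_cast [hT1]; ring]; ring
        rw [h6, ← pow_add]
        refine (pow_dvd_pow _ (by omega : η + M ≤ σ + (ω + ρ))).trans ?_
        rw [pow_add, pow_add]
        exact mul_dvd_mul he (mul_dvd_mul (by exact_mod_cast hy) hT3)
      exact Int.dvd_of_mul_dvd_mul_left (pow_ne_zero _ hp0) h7
  have hty : (p : ℤ) ^ M ∣ t ^ y - 1 :=
    (pow_dvd_pow _ (by omega)).trans (pow_dvd_pow_sub_one hρ0 ht hy)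
  have htj : (p : ℤ) ^ M ∣ t ^ j - t := by
    obtain ⟨w, rfl⟩ : ∃ w, j = w + 1 := by
      refine Nat.exists_eq_succ_of_ne_zero fun hj0 => ?_
      rw [hj0] at hj
      have := (dvd_pow_self (p : ℤ) (by omega : ω ≠ 0)).trans hj
      rw [Nat.cast_zero, zero_sub, dvd_neg] at this
      exact (Nat.prime_iff_prime_int.mp hp).not_isUnit (isUnit_of_dvd_one this)
    have hw : p ^ ω ∣ w := by
      have : ((p ^ ω : ℕ) : ℤ) ∣ (w : ℤ) := by simpa using hj
      exact_mod_cast this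
    rw [show t ^ (w + 1) - t = t * (t ^ w - 1) by ring]
    exact ((pow_dvd_pow _ (by omega)).trans (pow_dvd_pow_sub_one hρ0 ht hw)).mul_left t
  have hS := dvd_geomSum_sub hty T
  have key : (p : ℤ) ^ M ∣ x * (t' - t) := by
    have h1 := (pow_dvd_pow (p : ℤ) hM1).trans hc2
    have h2 := (pow_dvd_pow (p : ℤ) hM1).trans hT2
    have h3 := dvd_sub (dvd_add (dvd_add (dvd_sub h1 hec) (htj.mul_left x))
      ((dvd_sub_comm.mp hty).mul_left z)) ((dvd_add hS h2).mul_left x)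
    obtain ⟨w, hw⟩ := h3
    exact ⟨w, by linear_combination hw⟩
  exact (((Nat.prime_iff_prime_int.mp hp).coprime_iff_not_dvd.mpr hx).pow_left).dvd_of_dvd_mul_left
    key

end IsPres

end PGroup

/-! ### The dihedral type: `b` inverts `⟨a⟩` modulo `4` in a `2`-group -/

/-- `∑ (1 + q d) ^ l ≡ T + q d · T (T - 1) / 2` modulo `2 q`, for even `q`. -/
theorem geomSum_one_add_modEq {q d : ℤ} (hq : 2 ∣ q) (T : ℕ) :
    ∃ g : ℕ, 2 * g = T * (T - 1) ∧
      2 * q ∣ (∑ l ∈ Finset.range T, (1 + q * d) ^ l) - (T + q * d * g) := by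
  have hsq : ∀ l : ℕ, 2 * q ∣ (1 + q * d) ^ l - (1 + q * d * l) := by
    intro l
    induction l with
    | zero => simp
    | succ l ih =>
      obtain ⟨c, hc⟩ := ih
      obtain ⟨q', rfl⟩ := hq
      refine ⟨c * (1 + 2 * q' * d) + q' * d * d * l, ?_⟩
      rw [pow_succ]
      push_cast
      linear_combination (1 + 2 * q' * d) * hc
  refine ⟨∑ l ∈ Finset.range T, l, ?_, ?_⟩
  · rw [mul_comm, Finset.sum_range_id_mul_two]
  · push_cast
    have : (T : ℤ) + q * d * ∑ l ∈ Finset.range T, (l : ℤ) =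
        ∑ l ∈ Finset.range T, (1 + q * d * l) := by
      rw [Finset.sum_add_distrib, Finset.mul_sum]; simp
    rw [this, ← Finset.sum_sub_distrib]
    exact Finset.dvd_sum fun l _ => hsq l

theorem dvd_pow_add_one_of_odd {d t : ℤ} (h : d ∣ t + 1) {k : ℕ} (hk : Odd k) : d ∣ t ^ k + 1 := by
  simpa using h.trans (hk.add_dvd_pow_add_pow t 1)

theorem four_dvd_pow_sub_one_of_even {t : ℤ} (h : (4 : ℤ) ∣ t + 1) {k : ℕ} (hk : Even k) :
    (4 : ℤ) ∣ t ^ k - 1 := by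
  obtain ⟨l, rfl⟩ := hk
  rw [← two_mul, pow_mul]
  exact dvd_pow_sub_one (four_dvd_sq_sub_one h) l

/-- The arithmetic of `IsPres.exists_pow_dvd_of_neg` when `b ^ y ∉ ⟨a⟩`. Then `t ^ y - 1`, `e` and
`t' - t ^ j` are all divisible by `q = 2 ^ (μ - 1)`, and the relation `hc22`, which expresses that
`b'` acts on `a'` as `t'`, becomes a relation between the parities of the quotients. Except for the
excluded parameters, it gives `t' ≡ t ^ j` modulo `2 q` or, when `t ^ y ≡ 1 + q`, `t' ≡ t ^ (j +
y)`. -/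
theorem exists_pow_dvd_of_congruence {μ η σ ρ ω y j N c c2 T : ℕ} {e t t' x z : ℤ}
    (hμ : 3 ≤ μ) (hη2 : 2 ≤ η) (hωη : ω < η) (ht : (4 : ℤ) ∣ t + 1) (hj : Odd j)
    (he : (2 : ℤ) ^ σ ∣ e) (hσ2 : ¬ (σ < μ ∧ (2 : ℤ) ^ (σ + 1) ∣ e))
    (hρt : (2 : ℤ) ^ ρ ∣ t + 1) (hρ2 : ¬ (ρ < μ ∧ (2 : ℤ) ^ (ρ + 1) ∣ t + 1))
    (hσμ : σ ≤ μ) (hρμ : ρ ≤ μ) (hμσ : μ ≤ σ + 1) (hμρη : μ ≤ ρ + η)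
    (hxodd : ¬ (2 : ℤ) ∣ x) (hcodd : ¬ 2 ∣ c) (hc2odd : ¬ 2 ∣ c2) (hT4 : T % 4 = 3)
    (hN : N = 2 ^ (η - 2) * c) (hyN : y = 2 * N) (hy : 2 ^ ω ∣ y)
    (hpred : (2 : ℤ) ^ (μ - 1) ∣ t' - t ^ j) (hT2 : (2 : ℤ) ^ μ ∣ T - t')
    (hc22 : (2 : ℤ) ^ μ ∣ e * c2 -
      (x * t ^ j + z * (1 - t ^ y) - x * ∑ l ∈ Finset.range T, (t ^ y) ^ l)) :
    ∃ k : ℕ, Odd k ∧ (2 : ℤ) ^ ω ∣ k - j ∧ (2 : ℤ) ^ (μ - 1) ∣ t' - t ^ k ∧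
      ((2 ≤ η ∧ ω < η ∧ ¬ (μ = η + ρ ↔ σ + 1 = μ)) ∨ (2 : ℤ) ^ μ ∣ t' - t ^ k) := by
  set q : ℤ := 2 ^ (μ - 1) with hq
  have hqμ : (2 : ℤ) ^ μ = 2 * q := by rw [hq, ← pow_succ', Nat.sub_add_cancel (by omega)]
  have hq0 : q ≠ 0 := by positivity
  have htyd : (2 : ℤ) ^ (ρ + η - 1) ∣ t ^ y - 1 := by
    have := two_pow_dvd_pow_sub_one ht hρt (k := η - 2) (N := N) (hN ▸ dvd_mul_right _ _)
    rwa [← hyN, show ρ + (η - 2) + 1 = ρ + η - 1 by omega] at this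
  obtain ⟨d1, hd1⟩ : q ∣ t ^ y - 1 := (pow_dvd_pow _ (by omega)).trans htyd
  obtain ⟨d2, hd2⟩ : q ∣ e := (pow_dvd_pow _ (by omega)).trans he
  have hty : t ^ y = 1 + q * d1 := by linarith
  have hd1odd : ¬ (2 : ℤ) ∣ d1 ↔ μ = η + ρ := by
    constructor
    · intro h1
      by_contra hne
      have h2 : (2 : ℤ) ^ μ ∣ t ^ y - 1 := (pow_dvd_pow _ (by omega)).trans htyd
      rw [hd1, hqμ, mul_comm] at h2
      exact h1 (Int.dvd_of_mul_dvd_mul_left hq0 h2)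
    · intro h1 h2
      have h3 : ¬ (2 : ℤ) ^ (ρ + 1) ∣ t + 1 := fun h3 => hρ2 ⟨by omega, h3⟩
      have h4 := not_two_pow_dvd_pow_sub_one ht h3 (k := η - 2) (N := N) (fun h5 => by
        rw [hN, pow_succ] at h5
        exact hcodd (Nat.dvd_of_mul_dvd_mul_left (by positivity) h5))
      rw [← hyN, show ρ + (η - 2) + 2 = μ by omega, hd1, hqμ, mul_comm] at h4
      exact h4 (mul_dvd_mul_left _ h2)
  have hd2odd : ¬ (2 : ℤ) ∣ d2 ↔ σ + 1 = μ := by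
    constructor
    · intro h1
      by_contra hne
      have h2 : (2 : ℤ) ^ μ ∣ e := (pow_dvd_pow _ (by omega)).trans he
      rw [hd2, hqμ, mul_comm] at h2
      exact h1 (Int.dvd_of_mul_dvd_mul_left hq0 h2)
    · intro h1 h2
      have h3 : (2 : ℤ) ^ μ ∣ e := by
        rw [hd2, hqμ, mul_comm]
        exact mul_dvd_mul_left _ h2
      exact hσ2 ⟨by omega, h1 ▸ h3⟩
  obtain ⟨g, hg1, hg2⟩ := geomSum_one_add_modEq (q := q) (d := d1)
    (dvd_pow_self 2 (by omega)) T
  have hgodd : ¬ 2 ∣ g := by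
    obtain ⟨T', hT'⟩ : ∃ T', T = 4 * T' + 3 := ⟨T / 4, by omega⟩
    rw [hT', show 4 * T' + 3 - 1 = 2 * (2 * T' + 1) by omega] at hg1
    have h2 : g = (4 * T' + 3) * (2 * T' + 1) := by nlinarith
    rw [h2]
    intro h3
    rcases (Nat.Prime.dvd_mul Nat.prime_two).mp h3 with h4 | h4 <;> omega
  obtain ⟨D, hD⟩ : q ∣ T - t ^ j := by
    have h1 : q ∣ T - t' := (pow_dvd_pow _ (by omega)).trans hT2
    have := dvd_add h1 hpred
    rwa [sub_add_sub_cancel] at this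
  have hpar : (2 : ℤ) ∣ x * D + d2 * c2 + z * d1 + x * d1 * g := by
    rw [hqμ, hty] at hc22
    have h1 := dvd_sub hc22 (hg2.mul_left x)
    have h2 : q * 2 ∣ q * (x * D + d2 * c2 + z * d1 + x * d1 * g) := by
      rw [mul_comm q 2]
      obtain ⟨w, hw⟩ := h1
      exact ⟨w, by linear_combination hw - x * hD - c2 * hd2⟩
    exact Int.dvd_of_mul_dvd_mul_left hq0 h2
  have hx1 : x % 2 = 1 := by omega
  have hg1' : (g : ℤ) % 2 = 1 := by omega
  have hc1' : (c2 : ℤ) % 2 = 1 := by omega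
  have hpar2 : (2 : ℤ) ∣ D + d2 + z * d1 + d1 := by
    have e1 : (2 : ℤ) ∣ (x - 1) * (D + d1 * g) := Dvd.dvd.mul_right (by omega) _
    have e2 : (2 : ℤ) ∣ d2 * (c2 - 1) := Dvd.dvd.mul_left (by omega) _
    have e3 : (2 : ℤ) ∣ d1 * (g - 1) := Dvd.dvd.mul_left (by omega) _
    obtain ⟨w, hw⟩ := dvd_sub (dvd_sub (dvd_sub hpar e1) e2) e3
    exact ⟨w, by linear_combination hw⟩
  by_cases hiff : (μ = η + ρ ↔ σ + 1 = μ)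
  · have hd12 : (2 : ℤ) ∣ d1 + d2 := by
      rw [← hd1odd, ← hd2odd] at hiff
      omega
    have hDz : (2 : ℤ) ∣ D + z * d1 := by
      obtain ⟨w, hw⟩ := dvd_sub hpar2 hd12
      exact ⟨w, by linear_combination hw⟩
    have hfin : ∀ k : ℕ, (2 : ℤ) ^ μ ∣ T - t ^ k → (2 : ℤ) ^ μ ∣ t' - t ^ k := fun k hk => by
      have := dvd_sub hk hT2
      rwa [sub_sub_sub_cancel_left] at this
    by_cases hzd : (2 : ℤ) ∣ z * d1
    · refine ⟨j, hj, by simp, hpred, Or.inr (hfin j ?_)⟩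
      rw [hD, hqμ, mul_comm]
      exact mul_dvd_mul_left q ((dvd_add_left hzd).mp hDz)
    · have hdodd : ¬ (2 : ℤ) ∣ d1 := fun h2 => hzd (h2.mul_left z)
      have hk : (2 : ℤ) ^ μ ∣ t' - t ^ (j + y) := by
        refine hfin _ ?_
        have h1 : (T : ℤ) - t ^ (j + y) = q * (D - t ^ j * d1) := by
          rw [pow_add, hty]; linear_combination hD
        rw [h1, hqμ, mul_comm]
        refine mul_dvd_mul_left q ?_
        have h2 : ¬ (2 : ℤ) ∣ t ^ j * d1 := fun h2 => by
          rcases Int.prime_two.dvd_or_dvd h2 with h3 | h3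
          · have := Int.prime_two.dvd_of_dvd_pow h3
            omega
          · exact hdodd h3
        omega
      refine ⟨j + y, ?_, ?_, (pow_dvd_pow _ (by omega)).trans hk, Or.inr hk⟩
      · rw [hyN]
        exact hj.add_even (even_two_mul N)
      · push_cast
        rw [add_sub_cancel_left]
        exact_mod_cast hy
  · exact ⟨j, hj, by simp, hpred, Or.inl ⟨hη2, hωη, hiff⟩⟩

section TwoGroup

variable {P : Type*} [Group P] [Finite P] {a b a' b' : P}
  {μ η σ ρ ω μ' η' σ' ρ' : ℕ} {e t e' t' : ℤ} {y j : ℕ} {x z : ℤ}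

namespace IsPres

theorem gcd_sub_one_eq_two (hμ : μ ≠ 0) (ht : (4 : ℤ) ∣ t + 1) :
    Int.gcd (2 ^ μ : ℕ) (t - 1) = 2 := by
  obtain ⟨κ, -, hκ⟩ : ∃ κ ≤ μ, Int.gcd (2 ^ μ : ℕ) (t - 1) = 2 ^ κ :=
    (Nat.dvd_prime_pow Nat.prime_two).mp (Int.natCast_dvd_natCast.mp (Int.gcd_dvd_left ..))
  have h1 : 1 ≤ κ := le_of_pow_dvd_of_gcd_eq Nat.prime_two hκ (Nat.one_le_iff_ne_zero.mpr hμ)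
    (by norm_num; omega)
  have h2 : κ < 2 := by
    by_contra h2
    have := (pow_dvd_pow (2 : ℤ) (not_lt.mp h2)).trans (pow_dvd_of_gcd_eq hκ)
    omega
  rw [hκ, show κ = 1 by omega, pow_one]

omit [Finite P] in
theorem odd_of_pow (h : IsPres a b (2 ^ μ) (2 ^ η) e t) (hμ : μ ≠ 0) : ¬ (2 : ℤ) ∣ t := by
  intro h2
  have h1 := h.isCoprime (by positivity)
  have h3 : (2 : ℤ) ∣ ((2 ^ μ : ℕ) : ℤ) := by exact_mod_cast dvd_pow_self 2 hμ
  exact Int.prime_two.not_isUnit (h1.isUnit_of_dvd' h3 h2)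

/-- The commutator subgroup has index `2` in `⟨a⟩`, and at least `2` in `⟨a'⟩` as `t'` is odd. -/
theorem exponent_le_of_neg (h : IsPres a b (2 ^ μ) (2 ^ η) e t)
    (h' : IsPres a' b' (2 ^ μ') (2 ^ η') e' t') (hμ : 2 ≤ μ) (ht : (4 : ℤ) ∣ t + 1) :
    μ ≤ μ' ∧ (μ' = μ → (4 : ℤ) ∣ t' + 1) := by
  have h1 := h.card_commutator
  have h2 := h'.card_commutator
  rw [gcd_sub_one_eq_two (by omega) ht] at h1
  obtain ⟨κ, hκμ, hκ⟩ : ∃ κ ≤ μ', Int.gcd (2 ^ μ' : ℕ) (t' - 1) = 2 ^ κ :=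
    (Nat.dvd_prime_pow Nat.prime_two).mp (Int.natCast_dvd_natCast.mp (Int.gcd_dvd_left ..))
  rw [hκ] at h2
  have hc : Nat.card (commutator P) = 2 ^ (μ - 1) := by
    refine Nat.eq_of_mul_eq_mul_right two_pos (h1.trans ?_)
    rw [← pow_succ]; congr 1; omega
  rw [hc, ← pow_add] at h2
  have h3 := Nat.pow_right_injective le_rfl h2
  have hμ' : μ' ≠ 0 := by omega
  have hodd := h'.odd_of_pow hμ'
  have hκ1 : 1 ≤ κ := le_of_pow_dvd_of_gcd_eq Nat.prime_two hκ (Nat.one_le_iff_ne_zero.mpr hμ')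
    (by norm_num; omega)
  refine ⟨by omega, fun hμμ => ?_⟩
  have hκ2 : κ = 1 := by omega
  have h4 : ¬ (4 : ℤ) ∣ t' - 1 := fun h4 => by
    have := le_of_pow_dvd_of_gcd_eq Nat.prime_two hκ (i := 2) (by omega) (by norm_num; exact h4)
    omega
  omega

omit [Finite P] in
/-- The group is not abelian, as `t ≡ -1` modulo `4`. -/
theorem ne_zero_of_neg (h : IsPres a b (2 ^ μ) (2 ^ η) e t) (hμ : 2 ≤ μ) (ht : (4 : ℤ) ∣ t + 1) :
    η ≠ 0 := by
  rintro rfl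
  have h1 := h.dvd_pow_sub_one
  have h2 : (4 : ℤ) ∣ (2 ^ μ : ℕ) := by
    exact_mod_cast (pow_dvd_pow 2 hμ : 2 ^ 2 ∣ 2 ^ μ)
  have h3 := h2.trans h1
  rw [pow_zero, pow_one] at h3
  omega

omit [Finite P] in
/-- `2 ^ μ` divides `t ^ (2 ^ η) - 1`, whose `2`-part is `2 ^ (ρ + η)` unless `ρ = μ`. -/
theorem le_add_of_neg (h : IsPres a b (2 ^ μ) (2 ^ η) e t) (hμ : 2 ≤ μ) (ht : (4 : ℤ) ∣ t + 1)
    (hρ : Int.gcd (2 ^ μ : ℕ) (t + 1) = 2 ^ ρ) : μ ≤ ρ + η := by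
  have hη := h.ne_zero_of_neg hμ ht
  by_contra hlt
  have h1 : ¬ (2 : ℤ) ^ (ρ + 1) ∣ t + 1 := fun h1 => by
    have := le_of_pow_dvd_of_gcd_eq Nat.prime_two hρ (i := ρ + 1) (by omega) h1
    omega
  have h2 := not_two_pow_dvd_pow_sub_one ht h1 (k := η - 1) (N := 2 ^ (η - 1)) (fun h2 => by
    have := (Nat.pow_dvd_pow_iff_le_right one_lt_two).mp h2
    omega)
  rw [← pow_succ', Nat.sub_add_cancel (by omega)] at h2
  refine h2 ((pow_dvd_pow (2 : ℤ) (by omega : ρ + (η - 1) + 2 ≤ μ)).trans ?_)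
  exact_mod_cast h.dvd_pow_sub_one

omit [Finite P] in
/-- `2 ^ μ` divides `e (t - 1)`, and `t - 1` is twice an odd number. -/
theorem le_succ_of_neg (h : IsPres a b (2 ^ μ) (2 ^ η) e t) (ht : (4 : ℤ) ∣ t + 1)
    (hσ : Int.gcd (2 ^ μ : ℕ) e = 2 ^ σ) : μ ≤ σ + 1 := by
  by_contra hlt
  have h1 : ¬ (2 : ℤ) ^ (σ + 1) ∣ e := fun h1 => by
    have := le_of_pow_dvd_of_gcd_eq Nat.prime_two hσ (i := σ + 1) (by omega) h1
    omega
  have h2 : ¬ (2 : ℤ) ^ (1 + 1) ∣ t - 1 := by norm_num; omega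
  refine not_pow_succ_dvd_mul Nat.prime_two h1 h2 ?_
  refine (pow_dvd_pow _ (by omega)).trans (b := (2 : ℤ) ^ μ) ?_
  exact_mod_cast h.dvd_mul_sub_one

omit [Finite P] in
/-- The generator `a ^ 2` of the commutator subgroup is a power of `a'`, so that `b'` conjugates it
to its power with exponent `t'` as well as to that with exponent `t ^ j`. -/
theorem pow_pred_dvd_of_neg (h : IsPres a b (2 ^ μ) (2 ^ η) e t)
    (h' : IsPres a' b' (2 ^ μ) (2 ^ η') e' t') (hμ : 2 ≤ μ) (ht : (4 : ℤ) ∣ t + 1)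
    (hb' : b' = b ^ j * a ^ z) : (2 : ℤ) ^ (μ - 1) ∣ t' - t ^ j := by
  have h1 : a ^ (2 : ℤ) ∈ Subgroup.zpowers a' := by
    refine (Subgroup.zpowers_le.mpr (h.zpow_sub_one_mem h')) (h.zpow_mem_iff.mpr ?_)
    rw [gcd_sub_one_eq_two (by omega) ht]
    rfl
  obtain ⟨k, hk⟩ := Subgroup.mem_zpowers_iff.mp h1
  have h2 := inv_mul_zpow_mul h'.conj k
  have h3 := inv_mul_zpow_mul_pow h.conj 2 j
  rw [mul_comm t', zpow_mul, hk, hb', mul_inv_rev] at h2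
  have h4 : (a ^ z)⁻¹ * (b ^ j)⁻¹ * a ^ (2 : ℤ) * (b ^ j * a ^ z) =
      (a ^ z)⁻¹ * ((b ^ j)⁻¹ * a ^ (2 : ℤ) * b ^ j) * a ^ z := by group
  rw [h4, h3, ← zpow_neg, ← zpow_add, ← zpow_add, ← zpow_mul, h.zpow_eq_zpow_iff] at h2
  have h5 : (2 : ℤ) * 2 ^ (μ - 1) ∣ 2 * (t' - t ^ j) := by
    rw [← pow_succ', Nat.sub_add_cancel (by omega)]
    push_cast at h2
    convert h2 using 1
    ring
  exact Int.dvd_of_mul_dvd_mul_left two_ne_zero h5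

/-- As `t'` is `-1` modulo `4`, the exponent `j` with `t' ≡ t ^ j` modulo `4` is odd. -/
theorem odd_of_neg (h : IsPres a b (2 ^ μ) (2 ^ η) e t)
    (h' : IsPres a' b' (2 ^ μ) (2 ^ η') e' t') (hμ : 3 ≤ μ) (ht : (4 : ℤ) ∣ t + 1)
    (hb' : b' = b ^ j * a ^ z) : Odd j := by
  have h1 := h.pow_pred_dvd_of_neg h' (by omega) ht hb'
  have h2 := (h.exponent_le_of_neg h' (by omega) ht).2 rfl
  by_contra hj
  have h3 := four_dvd_pow_sub_one_of_even ht (Nat.not_odd_iff_even.mp hj)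
  have h4 : (4 : ℤ) ∣ t' - t ^ j := (pow_dvd_pow (2 : ℤ) (by omega : 2 ≤ μ - 1)).trans h1
  omega

/-- In a `2`-group with `t ≡ -1` modulo `4`, another factorization with the same `|⟨a⟩| = 2 ^ μ`
has the same action up to a twist of the exponent `j` of `b`, except for the parameters with
`μ = η + ρ` or `σ + 1 = μ` but not both, when the two actions may differ by `2 ^ (μ - 1)`. -/
theorem exists_pow_dvd_of_neg (h : IsPres a b (2 ^ μ) (2 ^ η) e t)
    (h' : IsPres a' b' (2 ^ μ) (2 ^ η) e' t') (hμ : 3 ≤ μ) (ht : (4 : ℤ) ∣ t + 1)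
    (hσ : Int.gcd (2 ^ μ : ℕ) e = 2 ^ σ) (hρ : Int.gcd (2 ^ μ : ℕ) (t + 1) = 2 ^ ρ)
    (ha' : a' = b ^ y * a ^ x) (hy : 2 ^ ω ∣ y) (hb' : b' = b ^ j * a ^ z) :
    ∃ k : ℕ, Odd k ∧ (2 : ℤ) ^ ω ∣ k - j ∧ (2 : ℤ) ^ (μ - 1) ∣ t' - t ^ k ∧
      ((2 ≤ η ∧ ω < η ∧ ¬ (μ = η + ρ ↔ σ + 1 = μ)) ∨ (2 : ℤ) ^ μ ∣ t' - t ^ k) := by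
  have hj := h.odd_of_neg h' hμ ht hb'
  have hη := h.ne_zero_of_neg (by omega) ht
  have hμρη := h.le_add_of_neg (by omega) ht hρ
  have hμσ := h.le_succ_of_neg ht hσ
  have hσμ := le_of_gcd_eq Nat.prime_two hσ
  have hρμ := le_of_gcd_eq Nat.prime_two hρ
  have hpred := h.pow_pred_dvd_of_neg h' (by omega) ht hb'
  have ht' := (h.exponent_le_of_neg h' (by omega) ht).2 rfl
  have he := pow_dvd_of_gcd_eq hσ
  have hρt := pow_dvd_of_gcd_eq hρ
  push_cast at he hρt
  -- `a' ^ 2` generates the commutator subgroup, so it lies in `⟨a⟩`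
  have hsq : a' ^ 2 ∈ Subgroup.zpowers a := by
    have h1 : a' ^ (2 : ℤ) ∈ Subgroup.zpowers a := by
      refine (Subgroup.zpowers_le.mpr (h'.zpow_sub_one_mem h)) (h'.zpow_mem_iff.mpr ?_)
      rw [gcd_sub_one_eq_two (by omega) ht']
      rfl
    exact_mod_cast h1
  have h2y : 2 ^ η ∣ y * 2 := by
    rw [← h.mem_iff]
    rw [ha', mul_zpow_pow h.conj] at hsq
    exact (Subgroup.mul_mem_cancel_right _
      (Subgroup.zpow_mem _ (Subgroup.mem_zpowers a) _)).mp hsq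
  obtain ⟨c, hc, hsq2⟩ := h.mul_zpow_pow_eq (z := x) 2 h2y
  rw [← ha'] at hsq2
  by_cases hyη : 2 ^ η ∣ y
  · refine ⟨j, hj, by simp, hpred, Or.inr ?_⟩
    obtain ⟨f, hf⟩ : ∃ f : ℤ, a' = a ^ f := by
      have : a' ∈ Subgroup.zpowers a := by
        rw [ha']
        exact Subgroup.mul_mem _ ((h.mem_iff _).mpr hyη)
          (Subgroup.zpow_mem _ (Subgroup.mem_zpowers a) _)
      obtain ⟨f, hf⟩ := Subgroup.mem_zpowers_iff.mp this
      exact ⟨f, hf.symm⟩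
    have h1 := h'.conj
    rw [hb', mul_inv_rev] at h1
    have h4 : (a ^ z)⁻¹ * (b ^ j)⁻¹ * a' * (b ^ j * a ^ z) = a' ^ (t ^ j) := by
      have : (a ^ z)⁻¹ * (b ^ j)⁻¹ * a' * (b ^ j * a ^ z) =
        (a ^ z)⁻¹ * ((b ^ j)⁻¹ * a' * b ^ j) * a ^ z := by group
      rw [this, hf, inv_mul_zpow_mul_pow h.conj, ← zpow_neg, ← zpow_add, ← zpow_add, ← zpow_mul]
      congr 1
      ring
    rw [h4, h'.zpow_eq_zpow_iff] at h1
    exact_mod_cast h1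
  -- now `b ^ y` is an involution modulo `⟨a⟩`
  have hc2 : y = 2 ^ (η - 1) * c := by
    have : 2 ^ η = 2 * 2 ^ (η - 1) := by rw [← pow_succ', Nat.sub_add_cancel (by omega)]
    rw [this] at hc
    nlinarith
  have hcodd : ¬ 2 ∣ c := fun h2 => by
    refine hyη ?_
    rw [hc2, ← Nat.sub_add_cancel (by omega : 1 ≤ η), pow_succ, Nat.sub_add_cancel (by omega)]
    exact Nat.mul_dvd_mul_left _ h2
  have hf4 : ¬ (4 : ℤ) ∣ e * c + x * ∑ l ∈ Finset.range 2, (t ^ y) ^ l := by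
    intro h4
    have h1 : a' ^ (2 * 2 ^ (μ - 2)) = 1 := by
      rw [pow_mul, hsq2, ← zpow_natCast, ← zpow_mul, h.zpow_eq_one_iff]
      rw [show μ = 2 + (μ - 2) by omega, pow_add]
      push_cast
      exact mul_dvd_mul (by simpa using h4) (by simp)
    have h2 := orderOf_dvd_of_pow_eq_one h1
    rw [h'.orderOf_left, ← pow_succ', Nat.pow_dvd_pow_iff_le_right one_lt_two] at h2
    omega
  have he4 : (4 : ℤ) ∣ e := (pow_dvd_pow (2 : ℤ) (by omega : 2 ≤ σ)).trans he
  have hsum2 : ∑ l ∈ Finset.range 2, (t ^ y) ^ l = 1 + t ^ y := by simp [Finset.sum_range_succ]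
  rw [hsum2] at hf4
  have hη2 : 2 ≤ η := by
    by_contra hlt
    have hη1 : η = 1 := by omega
    have hyodd : Odd y := by
      rw [hc2, hη1, Nat.sub_self, pow_zero, one_mul]
      exact Nat.odd_iff.mpr (by omega)
    refine hf4 (dvd_add (he4.mul_right _) (Dvd.dvd.mul_left ?_ x))
    rw [add_comm]
    exact dvd_pow_add_one_of_odd ht hyodd
  obtain ⟨N, hN⟩ : ∃ N, N = 2 ^ (η - 2) * c := ⟨_, rfl⟩
  have hyN : y = 2 * N := by
    rw [hc2, hN, ← mul_assoc, ← pow_succ']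
    congr 2
    omega
  have hty4 : (4 : ℤ) ∣ t ^ y - 1 := four_dvd_pow_sub_one_of_even ht ⟨N, by omega⟩
  have hxodd : ¬ (2 : ℤ) ∣ x := by
    rintro ⟨w, rfl⟩
    refine hf4 (dvd_add (he4.mul_right _) ?_)
    obtain ⟨v, hv⟩ : (2 : ℤ) ∣ 1 + t ^ y := by omega
    rw [hv]
    exact ⟨w * v, by ring⟩
  have hωη : ω < η := by
    by_contra hle
    have h1 : 2 ^ η ∣ y := (pow_dvd_pow 2 (not_lt.mp hle)).trans hy
    exact hyη h1
  obtain ⟨T, hT1, hT2⟩ := exists_pos_natCast_sub_dvd (by positivity : 0 < 2 ^ μ) t'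
  obtain ⟨c2, hc21, hc22⟩ := h.exists_conj_eq h' ha' hb' hT1 hT2
  push_cast at hc22 hT2
  have hT4 : T % 4 = 3 := by
    have h1 : (4 : ℤ) ∣ T - t' := (pow_dvd_pow (2 : ℤ) (by omega : 2 ≤ μ)).trans hT2
    omega
  have hc2odd : ¬ 2 ∣ c2 := by
    have h1 : c * (T - 1) = 2 * c2 := by
      have : 2 ^ η = 2 * 2 ^ (η - 1) := by rw [← pow_succ', Nat.sub_add_cancel (by omega)]
      rw [hc2, this] at hc21
      refine Nat.eq_of_mul_eq_mul_left (by positivity : 0 < 2 ^ (η - 1)) ?_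
      linarith
    obtain ⟨T', hT'⟩ : ∃ T', T - 1 = 2 * (2 * T' + 1) := ⟨(T - 3) / 4, by omega⟩
    rw [hT'] at h1
    have h2 : c2 = c * (2 * T' + 1) := by nlinarith
    rw [h2]
    intro h3
    rcases (Nat.Prime.dvd_mul Nat.prime_two).mp h3 with h4 | h4
    · exact hcodd h4
    · omega
  exact exists_pow_dvd_of_congruence hμ hη2 hωη ht hj (pow_dvd_of_gcd_eq hσ)
    (fun h1 => by
      have := le_of_pow_dvd_of_gcd_eq Nat.prime_two hσ (i := σ + 1) (by omega) h1.2
      omega) (pow_dvd_of_gcd_eq hρ)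
    (fun h1 => by
      have := le_of_pow_dvd_of_gcd_eq Nat.prime_two hρ (i := ρ + 1) (by omega) h1.2
      omega) hσμ hρμ hμσ hμρη hxodd hcodd hc2odd hT4 hN hyN hy hpred hT2 hc22

/-- Under the condition `hc`, another factorization with the same `|⟨a⟩|` has at least the same
`r`. -/
theorem rho_le_of_neg (h : IsPres a b (2 ^ μ) (2 ^ η) e t)
    (h' : IsPres a' b' (2 ^ μ) (2 ^ η) e' t') (hμ : 2 ≤ μ) (ht : (4 : ℤ) ∣ t + 1)
    (hσ : Int.gcd (2 ^ μ : ℕ) e = 2 ^ σ) (hρ : Int.gcd (2 ^ μ : ℕ) (t + 1) = 2 ^ ρ)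
    (ha' : a' = b ^ y * a ^ x) (hy : 2 ^ ω ∣ y) (hb' : b' = b ^ j * a ^ z)
    (hc : 2 ≤ η → 3 ≤ μ → ω < η → ρ ≤ σ) : (2 : ℤ) ^ ρ ∣ t' + 1 := by
  have ht' := (h.exponent_le_of_neg h' (by omega) ht).2 rfl
  have hρμ := le_of_gcd_eq Nat.prime_two hρ
  have hσμ := le_of_gcd_eq Nat.prime_two hσ
  have hμρη := h.le_add_of_neg hμ ht hρ
  rcases hμ.eq_or_lt with hμ2 | hμ3
  · exact (pow_dvd_pow (2 : ℤ) (by omega : ρ ≤ 2)).trans (by norm_num; exact ht')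
  obtain ⟨k, hk1, hk2, hk3, hk4⟩ := h.exists_pow_dvd_of_neg h' hμ3 ht hσ hρ ha' hy hb'
  have hρt := pow_dvd_of_gcd_eq hρ
  push_cast at hρt
  have h1 := dvd_pow_add_one_of_odd hρt hk1
  have h2 : (2 : ℤ) ^ ρ ∣ t' - t ^ k := by
    by_cases hlt : ρ < μ
    · exact (pow_dvd_pow _ (by omega)).trans hk3
    · rcases hk4 with ⟨h3, h4, h5⟩ | h3
      · have := hc h3 hμ3 h4
        omega
      · exact (pow_dvd_pow _ hρμ).trans h3
  have := dvd_add h2 h1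
  rwa [← add_assoc, sub_add_cancel] at this

/-- If `s ≠ n r`, then `⟨b⟩` has least index. As `2 s' ≥ m`, only the case `s = m` is in question,
in which `b' ^ n = 1` has to be shown: a geometric sum of `n` terms with ratio `t ^ j` is divisible
by `n r / 2` if `j` is odd, and `n r` is a proper multiple of `m`. -/
theorem sigma_le_of_neg (h : IsPres a b (2 ^ μ) (2 ^ η) e t)
    (h' : IsPres a' b' (2 ^ μ) (2 ^ η) e' t') (hμ : 2 ≤ μ) (ht : (4 : ℤ) ∣ t + 1)
    (hσ : Int.gcd (2 ^ μ : ℕ) e = 2 ^ σ) (hσ' : Int.gcd (2 ^ μ : ℕ) e' = 2 ^ σ')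
    (hρ : Int.gcd (2 ^ μ : ℕ) (t + 1) = 2 ^ ρ)
    (hc : σ ≠ η + ρ) : σ ≤ σ' := by
  have ht' := (h.exponent_le_of_neg h' (by omega) ht).2 rfl
  have hρμ := le_of_gcd_eq Nat.prime_two hρ
  have hσμ := le_of_gcd_eq Nat.prime_two hσ
  have hμρη := h.le_add_of_neg hμ ht hρ
  have hη := h.ne_zero_of_neg hμ ht
  have h1 := h'.le_succ_of_neg ht' hσ'
  have he := pow_dvd_of_gcd_eq hσ
  have hρt := pow_dvd_of_gcd_eq hρ
  push_cast at he hρt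
  rcases (by omega : σ < μ ∨ σ = μ) with hlt | rfl
  · omega
  obtain ⟨j, z, hb'⟩ := h.gen b'
  obtain ⟨y, x, ha'⟩ := h.gen a'
  suffices hone : b' ^ 2 ^ η = 1 by
    refine le_of_pow_dvd_of_gcd_eq Nat.prime_two hσ' le_rfl ?_
    rw [h'.pow_right, h'.zpow_eq_one_iff] at hone
    exact_mod_cast hone
  obtain ⟨c, -, hc2⟩ := h.mul_zpow_pow_eq (j := j) (z := z) (2 ^ η) (dvd_mul_left _ _)
  rw [hb', hc2, h.zpow_eq_one_iff]
  push_cast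
  refine dvd_add (he.mul_right _) (Dvd.dvd.mul_left ?_ z)
  by_cases hj : Odd j
  · have := two_pow_dvd_geomSum (dvd_pow_add_one_of_odd ht hj) (dvd_pow_add_one_of_odd hρt hj)
      (k := η - 1) (N := 2 ^ (η - 1)) dvd_rfl
    rw [← pow_succ', Nat.sub_add_cancel (by omega)] at this
    exact (pow_dvd_pow _ (by omega)).trans this
  have hσ2 : σ = 2 := by
    by_contra hne
    exact hj (h.odd_of_neg h' (by omega) ht hb')
  subst hσ2
  have hjE := Nat.not_odd_iff_even.mp hj
  have htj := four_dvd_pow_sub_one_of_even ht hjE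
  by_cases hη2 : 2 ≤ η
  · exact (pow_dvd_pow _ hη2).trans (pow_dvd_geomSum (p := 2)
      (Dvd.dvd.trans (by norm_num) htj) η)
  -- the dihedral group of order `8`
  exfalso
  have hη1 : η = 1 := by omega
  subst hη1
  have hb2 : b ^ 2 = 1 := by
    have := h.pow_right
    rw [pow_one] at this
    rw [this, h.zpow_eq_one_iff]
    exact_mod_cast he
  rcases Nat.even_or_odd y with hy | hy
  · have ha2 : a' = a ^ x := by
      obtain ⟨k, rfl⟩ := hy
      rw [ha', ← two_mul, pow_mul, hb2, one_pow, one_mul]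
    have hb2' : b' = a ^ z := by
      obtain ⟨k, rfl⟩ := hjE
      rw [hb', ← two_mul, pow_mul, hb2, one_pow, one_mul]
    have h3 := h'.conj
    have h4 : b'⁻¹ * a' * b' = a' ^ (1 : ℤ) := by
      rw [ha2, hb2', zpow_one, ← zpow_neg, ← zpow_add, ← zpow_add]
      congr 1
      ring
    rw [h4, h'.zpow_eq_zpow_iff] at h3
    norm_num at h3
    omega
  · have h3 : a' ^ 2 = 1 := by
      rw [ha', mul_zpow_pow h.conj, mul_comm, pow_mul, hb2, one_pow, one_mul, h.zpow_eq_one_iff]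
      have := dvd_pow_add_one_of_odd ht hy
      simp only [Finset.sum_range_succ, Finset.sum_range_zero, pow_zero, pow_one, zero_add]
      rw [add_comm]
      exact Dvd.dvd.mul_left (by exact_mod_cast this) x
    have := orderOf_dvd_of_pow_eq_one h3
    rw [h'.orderOf_left] at this
    norm_num at this

/-- Up to a change of the generator of `⟨b⟩`, the actions of `b` on `⟨a⟩` and of `b'` on `⟨a'⟩`
agree modulo `2 ^ M`, for `2 ^ M` at most `r`, or at most `m / 2`, or at most `m` in the cases
excluded from the exception of `exists_pow_dvd_of_neg`. -/
theorem exists_pow_dvd_sub_of_neg (h : IsPres a b (2 ^ μ) (2 ^ η) e t)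
    (h' : IsPres a' b' (2 ^ μ) (2 ^ η) e' t') (hμ : 2 ≤ μ) (ht : (4 : ℤ) ∣ t + 1)
    (hσ : Int.gcd (2 ^ μ : ℕ) e = 2 ^ σ) (hρ : Int.gcd (2 ^ μ : ℕ) (t + 1) = 2 ^ ρ)
    (ha' : a' = b ^ y * a ^ x) (hy : 2 ^ ω ∣ y) (hb' : b' = b ^ j * a ^ z)
    (hj : (2 : ℤ) ^ ω ∣ j - 1)
    (hc1 : σ ≠ η + ρ) (hc : 2 ≤ η → 3 ≤ μ → ω < η → ρ ≤ σ) {M : ℕ} (hM : M ≤ μ)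
    (hM1 : M ≤ ρ ∨ 3 ≤ μ ∧ (M + 1 ≤ μ ∨ η ≤ ω ∨ σ = μ ∨ μ = η + ρ)) :
    ∃ k : ℕ, Odd k ∧ (2 : ℤ) ^ ω ∣ k - 1 ∧ (2 : ℤ) ^ M ∣ t' - t ^ k := by
  by_cases hMρ : M ≤ ρ
  · refine ⟨1, odd_one, by simp, (pow_dvd_pow _ hMρ).trans ?_⟩
    have h1 := h.rho_le_of_neg h' hμ ht hσ hρ ha' hy hb' hc
    have h2 := pow_dvd_of_gcd_eq hρ
    have := dvd_sub h1 h2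
    rwa [add_sub_add_right_eq_sub, ← pow_one t] at this
  obtain ⟨hμ3, hM2⟩ := hM1.resolve_left hMρ
  obtain ⟨k, hk1, hk2, hk3, hk4⟩ := h.exists_pow_dvd_of_neg h' hμ3 ht hσ hρ ha' hy hb'
  have hσμ := le_of_gcd_eq Nat.prime_two hσ
  have hμρη := h.le_add_of_neg hμ ht hρ
  have hμσ := h.le_succ_of_neg ht hσ
  refine ⟨k, hk1, ?_, ?_⟩
  · have := dvd_add hk2 hj
    rwa [sub_add_sub_cancel] at this
  · rcases hk4 with ⟨h3, h4, h5⟩ | h3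
    · exact (pow_dvd_pow _ (by omega)).trans hk3
    · exact (pow_dvd_pow _ hM).trans h3

end IsPres

end TwoGroup

/-! ### The triple `(r, ε, o)` of the group generated by `t` -/

theorem Res_zpowers {m q : ℕ} (h : q ∣ m) (τ : (ZMod m)ˣ) :
    Res h (Subgroup.zpowers τ) = Subgroup.zpowers (ZMod.unitsMap h τ) :=
  MonoidHom.map_zpowers _ _

theorem coe_unitsMap_eq {m q : ℕ} (h : q ∣ m) {τ : (ZMod m)ˣ} {t : ℤ}
    (hτ : (τ : ZMod m) = (t : ZMod m)) : (ZMod.unitsMap h τ : ZMod q) = (t : ZMod q) := by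
  rw [ZMod.unitsMap_def, Units.coe_map, hτ]
  simp

theorem coe_eq_intCast_iff {q : ℕ} {u v : ℤ} : (u : ZMod q) = (v : ZMod q) ↔ (q : ℤ) ∣ u - v := by
  rw [eq_comm, ZMod.intCast_eq_intCast_iff_dvd_sub]

theorem pow_eq_one_iff_dvd {q : ℕ} {τ : (ZMod q)ˣ} {t : ℤ}
    (hτ : (τ : ZMod q) = (t : ZMod q)) (j : ℕ) : τ ^ j = 1 ↔ (q : ℤ) ∣ t ^ j - 1 := by
  rw [Units.ext_iff, Units.val_pow_eq_pow_val, hτ, Units.val_one, ← coe_eq_intCast_iff]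
  push_cast
  rfl

theorem Res_eq_bot_iff {m q : ℕ} (h : q ∣ m) {τ : (ZMod m)ˣ} {t : ℤ}
    (hτ : (τ : ZMod m) = (t : ZMod m)) :
    Res h (Subgroup.zpowers τ) = ⊥ ↔ (q : ℤ) ∣ t - 1 := by
  rw [Res_zpowers, Subgroup.zpowers_eq_bot]
  simpa using pow_eq_one_iff_dvd (coe_unitsMap_eq h hτ) 1

theorem Res_le_iff {m q : ℕ} (h : q ∣ m) {τ : (ZMod m)ˣ} {t : ℤ}
    (hτ : (τ : ZMod m) = (t : ZMod m)) :
    Res h (Subgroup.zpowers τ) ≤ Subgroup.zpowers (-1) ↔ (q : ℤ) ∣ t - 1 ∨ (q : ℤ) ∣ t + 1 := by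
  have h1 : ∀ u : (ZMod q)ˣ, u ∈ Subgroup.zpowers (-1 : (ZMod q)ˣ) ↔ u = 1 ∨ u = -1 := by
    intro u
    constructor
    · intro hu
      obtain ⟨k, rfl⟩ := Subgroup.mem_zpowers_iff.mp hu
      rcases Int.even_or_odd k with hk | hk
      · exact Or.inl hk.neg_one_zpow
      · exact Or.inr hk.neg_one_zpow
    · rintro (rfl | rfl)
      · exact Subgroup.one_mem _
      · exact Subgroup.mem_zpowers _
  rw [Res_zpowers, Subgroup.zpowers_le, h1]
  refine or_congr ?_ ?_
  · simpa using pow_eq_one_iff_dvd (coe_unitsMap_eq h hτ) 1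
  · rw [Units.ext_iff, coe_unitsMap_eq h hτ, Units.val_neg, Units.val_one,
      show (t : ℤ) + 1 = t - (-1) by ring, ← coe_eq_intCast_iff]
    push_cast
    rfl

/-- The condition on `t` modulo `p ^ k` from the definition of `r`: `t` is `1`, or `±1` for
`p = 2`. -/
def IsTrivialAt (p k : ℕ) (t : ℤ) : Prop := (p : ℤ) ^ k ∣ t - 1 ∨ p = 2 ∧ (p : ℤ) ^ k ∣ t + 1

section InvZPowers

variable {m : ℕ} {τ : (ZMod m)ˣ} {t : ℤ}

/-- Admissibility can be checked on the prime powers dividing `d`. -/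
theorem isAdmissible_iff (hm : m ≠ 0) (hτ : (τ : ZMod m) = (t : ZMod m)) (d : ℕ) :
    IsAdmissible (Subgroup.zpowers τ) d ↔
      d ∣ m ∧ ∀ p k : ℕ, p.Prime → p ^ k ∣ d → IsTrivialAt p k t := by
  refine and_congr_right fun hd => ?_
  have hd0 : d ≠ 0 := ne_zero_of_dvd_ne_zero hm hd
  have hprod : pPart d 2 * (d / pPart d 2) = d := Nat.ordProj_mul_ordCompl_eq_self d 2
  have h2 : pPart d 2 ∣ m := (Dvd.intro _ hprod).trans hd
  have h2' : d / pPart d 2 ∣ m := (Dvd.intro_left _ hprod).trans hd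
  have hcop : (pPart d 2).Coprime (d / pPart d 2) :=
    (Nat.coprime_ordCompl Nat.prime_two hd0).pow_left _
  have e1 : (∃ h : d / pPart d 2 ∣ m, Res h (Subgroup.zpowers τ) = ⊥) ↔
      ((d / pPart d 2 : ℕ) : ℤ) ∣ t - 1 :=
    ⟨fun ⟨h, h'⟩ => (Res_eq_bot_iff h hτ).mp h', fun h => ⟨h2', (Res_eq_bot_iff h2' hτ).mpr h⟩⟩
  have e2 : (∃ h : pPart d 2 ∣ m, Res h (Subgroup.zpowers τ) ≤ Subgroup.zpowers (-1)) ↔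
      ((pPart d 2 : ℕ) : ℤ) ∣ t - 1 ∨ ((pPart d 2 : ℕ) : ℤ) ∣ t + 1 :=
    ⟨fun ⟨h, h'⟩ => (Res_le_iff h hτ).mp h', fun h => ⟨h2, (Res_le_iff h2 hτ).mpr h⟩⟩
  rw [e1, e2]
  constructor
  · rintro ⟨h3, h4⟩ p k hp hk
    rcases eq_or_ne p 2 with rfl | hp2
    · have h5 : ((2 ^ k : ℕ) : ℤ) ∣ (pPart d 2 : ℕ) := Int.natCast_dvd_natCast.mpr
        (pow_dvd_pow 2 ((hp.pow_dvd_iff_le_factorization hd0).mp hk))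
      push_cast at h5
      rcases h4 with h4 | h4
      · exact Or.inl (h5.trans h4)
      · exact Or.inr ⟨rfl, h5.trans h4⟩
    · left
      have h5 : p ^ k ∣ d / pPart d 2 := by
        rw [← hprod] at hk
        refine Nat.Coprime.dvd_of_dvd_mul_left ?_ hk
        exact Nat.Coprime.pow _ _ ((Nat.coprime_primes hp Nat.prime_two).mpr hp2)
      refine Dvd.dvd.trans ?_ h3
      exact_mod_cast h5
  · intro h3
    constructor
    · rw [Int.natCast_dvd]
      refine dvd_of_forall_prime_pow_dvd fun p k hp hk => ?_
      rcases h3 p k hp (hk.trans (Dvd.intro_left _ hprod)) with h4 | ⟨rfl, h4⟩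
      · rw [← Int.natCast_dvd]; exact_mod_cast h4
      · rcases Nat.eq_zero_or_pos k with rfl | hk0
        · simp
        · exact absurd ((dvd_pow_self 2 hk0.ne').trans hk) (Nat.not_dvd_ordCompl Nat.prime_two hd0)
    · rcases h3 2 _ Nat.prime_two (Nat.ordProj_dvd d 2) with h4 | ⟨-, h4⟩
      · left; simpa [pPart] using h4
      · right; simpa [pPart] using h4

/-- The number `r` is determined one prime at a time, since a least common multiple of admissible
numbers with admissible prime power parts is admissible. -/
theorem pow_dvd_invR_iff (hm : m ≠ 0) (hτ : (τ : ZMod m) = (t : ZMod m)) {p k : ℕ}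
    (hp : p.Prime) : p ^ k ∣ invR (Subgroup.zpowers τ) ↔ p ^ k ∣ m ∧ IsTrivialAt p k t := by
  have had := (isAdmissible_iff hm hτ _).mp (isAdmissible_invR hm (Subgroup.zpowers τ))
  constructor
  · exact fun h => ⟨h.trans had.1, had.2 p k hp h⟩
  · rintro ⟨h1, h2⟩
    set r := invR (Subgroup.zpowers τ) with hr
    have hr0 : r ≠ 0 := ne_zero_of_dvd_ne_zero hm had.1
    have hlcm : IsAdmissible (Subgroup.zpowers τ) (Nat.lcm r (p ^ k)) := by
      rw [isAdmissible_iff hm hτ]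
      refine ⟨Nat.lcm_dvd had.1 h1, fun q i hq hi => ?_⟩
      have hpk : p ^ k ≠ 0 := pow_ne_zero _ hp.ne_zero
      rw [hq.pow_dvd_iff_le_factorization (Nat.lcm_ne_zero hr0 hpk),
        Nat.factorization_lcm hr0 hpk, Finsupp.sup_apply, le_sup_iff] at hi
      rcases hi with hi | hi
      · exact had.2 q i hq ((hq.pow_dvd_iff_le_factorization hr0).mpr hi)
      · rcases eq_or_ne q p with rfl | hqp
        · rw [hp.factorization_pow, Finsupp.single_eq_same] at hi
          rcases h2 with h2 | ⟨h2, h3⟩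
          · exact Or.inl ((pow_dvd_pow _ hi).trans h2)
          · exact Or.inr ⟨h2, (pow_dvd_pow _ hi).trans h3⟩
        · rw [hp.factorization_pow, Finsupp.single_eq_of_ne hqp] at hi
          rw [Nat.le_zero.mp hi]
          exact Or.inl (by simp)
    have hle : Nat.lcm r (p ^ k) ≤ r :=
      le_csSup ⟨m, fun d hd => Nat.le_of_dvd (Nat.pos_of_ne_zero hm) hd.1⟩ hlcm
    have heq : Nat.lcm r (p ^ k) = r :=
      le_antisymm hle (Nat.le_of_dvd (Nat.pos_of_ne_zero
        (Nat.lcm_ne_zero hr0 (pow_ne_zero _ hp.ne_zero))) (Nat.dvd_lcm_left _ _))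
    rw [← heq]
    exact Nat.dvd_lcm_right _ _

theorem invR_ne_zero (hm : m ≠ 0) (T : Subgroup (ZMod m)ˣ) : invR T ≠ 0 :=
  ne_zero_of_dvd_ne_zero hm (invR_dvd hm T)

theorem le_factorization_invR_iff (hm : m ≠ 0) (hτ : (τ : ZMod m) = (t : ZMod m)) {p k : ℕ}
    (hp : p.Prime) : k ≤ (invR (Subgroup.zpowers τ)).factorization p ↔
      k ≤ m.factorization p ∧ IsTrivialAt p k t := by
  rw [← hp.pow_dvd_iff_le_factorization (invR_ne_zero hm _), pow_dvd_invR_iff hm hτ hp,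
    hp.pow_dvd_iff_le_factorization hm]

theorem invEps_eq_one_iff (hm : m ≠ 0) (hτ : (τ : ZMod m) = (t : ZMod m)) :
    invEps (Subgroup.zpowers τ) = 1 ↔
      (2 : ℤ) ^ (invR (Subgroup.zpowers τ)).factorization 2 ∣ t - 1 := by
  have h2 : pPart (invR (Subgroup.zpowers τ)) 2 ∣ m :=
    (Nat.ordProj_dvd _ 2).trans (invR_dvd hm _)
  have h3 := Res_eq_bot_iff h2 hτ
  have h4 : ((pPart (invR (Subgroup.zpowers τ)) 2 : ℕ) : ℤ) =
    2 ^ (invR (Subgroup.zpowers τ)).factorization 2 := by simp [pPart]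
  rw [h4] at h3
  rw [← h3]
  unfold invEps
  constructor
  · intro h
    split_ifs at h with h5
    exact h5.2
  · intro h
    rw [if_pos ⟨h2, h⟩]

theorem invEps_eq_or (T : Subgroup (ZMod m)ˣ) : invEps T = 1 ∨ invEps T = -1 := by
  unfold invEps
  split_ifs <;> simp

theorem mem_invNu_iff (hm : m ≠ 0) (T : Subgroup (ZMod m)ˣ) {p : ℕ} :
    p ∈ invNu T ↔ p.Prime ∧ p ∣ m ∧ ¬ p ∣ invR T := by
  unfold invNu
  rw [Finset.mem_sdiff, Nat.mem_primeFactors, Nat.mem_primeFactors]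
  have := invR_ne_zero hm T
  tauto

/-- Passing from `T` to its Hall `π`-subgroup does not change the `p`-part of the order of an
image of `T`, for `p` in `π`. -/
theorem factorization_card_map_hallPart {U V : Type*} [CommGroup U] [CommGroup V] [Finite U]
    (f : U →* V) (π : Set ℕ) (T : Subgroup U) {p : ℕ} (hp : p.Prime) (hpπ : p ∈ π) :
    (Nat.card ((hallPart π T).map f)).factorization p = (Nat.card (T.map f)).factorization p := by
  have hle : hallPart π T ≤ T := fun x hx => hx.1
  have hle' : (hallPart π T).map f ≤ T.map f := Subgroup.map_mono hle
  have hidx : ¬ p ∣ (hallPart π T).relIndex T := by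
    intro hdvd
    have : Fact p.Prime := ⟨hp⟩
    rw [Subgroup.relIndex, Subgroup.index] at hdvd
    obtain ⟨x, hx⟩ := exists_prime_orderOf_dvd_card' p hdvd
    obtain ⟨⟨u, hu⟩, rfl⟩ := QuotientGroup.mk_surjective x
    have h1 : (u ^ p) ∈ hallPart π T := by
      have h2 := pow_orderOf_eq_one ((⟨u, hu⟩ : T) : T ⧸ (hallPart π T).subgroupOf T)
      rw [hx, ← QuotientGroup.mk_pow, QuotientGroup.eq_one_iff, Subgroup.mem_subgroupOf] at h2
      exact h2
    have h3 : u ∈ hallPart π T := by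
      refine ⟨hu, fun q hq hqu => ?_⟩
      by_cases hqp : q = p
      · rwa [hqp]
      · refine h1.2 q hq ?_
        have h4 : orderOf u ∣ orderOf (u ^ p) * p := by
          rw [orderOf_dvd_iff_pow_eq_one, mul_comm, pow_mul, pow_orderOf_eq_one]
        exact (Nat.Coprime.dvd_of_dvd_mul_right ((Nat.coprime_primes hq hp).mpr hqp)
          (hqu.trans h4))
    have h5 : ((⟨u, hu⟩ : T) : T ⧸ (hallPart π T).subgroupOf T) = 1 := by
      rw [QuotientGroup.eq_one_iff, Subgroup.mem_subgroupOf]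
      exact h3
    rw [h5, orderOf_one] at hx
    exact hp.one_lt.ne hx
  have hidx' : ¬ p ∣ ((hallPart π T).map f).relIndex (T.map f) := fun h => by
    have hsup : T ⊔ f.ker = T ⊔ (hallPart π T ⊔ f.ker) := by
      rw [← sup_assoc, sup_eq_left.mpr hle]
    rw [Subgroup.relIndex_map_map, hsup, Subgroup.relIndex_sup_right] at h
    exact hidx (h.trans (Subgroup.relIndex_dvd_of_le_left _ le_sup_left))
  have hcard := Subgroup.relIndex_mul_relIndex ⊥ _ _ bot_le hle'
  rw [Subgroup.relIndex_bot_left, Subgroup.relIndex_bot_left] at hcard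
  have : Finite (T.map f) := Finite.Set.finite_image (T : Set U) f
  have h0 : Nat.card (T.map f) ≠ 0 := Nat.card_pos.ne'
  rw [← hcard] at h0
  rw [← hcard, Nat.factorization_mul (left_ne_zero_of_mul h0) (right_ne_zero_of_mul h0),
    Finsupp.add_apply, Nat.factorization_eq_zero_of_not_dvd hidx', add_zero]

/-- For `p ∉ ν` the numbers `o` and `d` have the same `p`-part, where `d` is the order of `t`
modulo `m_ν`. -/
theorem factorization_invO (hm : m ≠ 0) (hτ : (τ : ZMod m) = (t : ZMod m)) {p : ℕ} (hp : p.Prime)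
    (hpν : p ∉ invNu (Subgroup.zpowers τ)) :
    ∃ d : ℕ, d ≠ 0 ∧ (∀ j : ℕ, d ∣ j ↔ (piPart m (invNu (Subgroup.zpowers τ)) : ℤ) ∣ t ^ j - 1) ∧
      (invO (Subgroup.zpowers τ)).factorization p = d.factorization p := by
  have : NeZero m := ⟨hm⟩
  have hq := piPart_dvd m (Finset.sdiff_subset : invNu (Subgroup.zpowers τ) ⊆ m.primeFactors)
  have hq0 : NeZero (piPart m (invNu (Subgroup.zpowers τ))) := ⟨ne_zero_of_dvd_ne_zero hm hq⟩
  refine ⟨orderOf (ZMod.unitsMap hq τ), (orderOf_pos _).ne', fun j => ?_, ?_⟩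
  · rw [orderOf_dvd_iff_pow_eq_one, pow_eq_one_iff_dvd (coe_unitsMap_eq hq hτ)]
    rfl
  · unfold invO Res
    rw [factorization_card_map_hallPart _ _ _ hp hpν, MonoidHom.map_zpowers, Nat.card_zpowers]

end InvZPowers

/-! ### The normal `p`-complement -/

/-- If `b` acts on `⟨a⟩` as some `t ≡ 1` modulo `p`, then the `p'`-elements form a normal
subgroup `⟨a⟩_{p'} ⟨b⟩_{p'}` with a `p`-group as quotient. -/
theorem IsPres.exists_normal_complement {G : Type*} [Group G] [Finite G] {a b : G} {m n : ℕ}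
    {e t : ℤ} (h : IsPres a b m n e t) {p : ℕ} (hp : p.Prime) (ht : (p : ℤ) ∣ t - 1) :
    ∃ N : Subgroup G, N.Normal ∧ ¬ p ∣ Nat.card N ∧
      ∀ x : G, ∃ k : ℕ, x ^ p ^ k ∈ N := by
  have : Fact p.Prime := ⟨hp⟩
  set K := (Nat.card G).factorization p with hK
  have hG0 : Nat.card G ≠ 0 := Nat.card_pos.ne'
  have hcop : ∀ x : G, ¬ p ∣ orderOf (x ^ p ^ K) := by
    intro x hdvd
    refine Nat.not_dvd_ordCompl hp hG0 (hdvd.trans (orderOf_dvd_of_pow_eq_one ?_))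
    rw [← pow_mul, Nat.ordProj_mul_ordCompl_eq_self, pow_card_eq_one']
  set k := p ^ K with hk
  have hNa := h.normal_zpow (k : ℤ)
  rw [zpow_natCast] at hNa
  have hktk : (k : ℤ) ∣ t ^ k - 1 := by
    have := pow_dvd_pow_sub_one (ρ := 1) one_ne_zero (by simpa using ht) (k := K) (N := k) dvd_rfl
    refine Dvd.dvd.trans ?_ this
    rw [hk]
    push_cast
    exact pow_dvd_pow _ (by omega)
  set N := Subgroup.zpowers (a ^ k) ⊔ Subgroup.zpowers (b ^ k) with hN
  have hconj : ∀ g : G, g * b ^ k * g⁻¹ ∈ N := by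
    intro g
    obtain ⟨j, i, rfl⟩ := h.gen g
    have e1 : b ^ j * a ^ i * b ^ k * (b ^ j * a ^ i)⁻¹ =
        b ^ k * (b ^ j * a ^ (i * t ^ k - i) * (b ^ j)⁻¹) := by
      have hc : b ^ j * b ^ k = b ^ k * b ^ j := ((Commute.refl b).pow_pow j k).eq
      rw [mul_assoc (b ^ j), zpow_mul_pow h.conj, ← mul_assoc, hc, mul_inv_rev, zpow_sub]
      simp only [mul_assoc]
    rw [e1]
    refine Subgroup.mul_mem _ (Subgroup.mem_sup_right (Subgroup.mem_zpowers _))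
      (Subgroup.mem_sup_left (hNa.conj_mem _ ?_ _))
    obtain ⟨c, hc⟩ := hktk
    refine Subgroup.mem_zpowers_iff.mpr ⟨i * c, ?_⟩
    rw [← zpow_natCast, ← zpow_mul]
    congr 1
    linear_combination -i * hc
  refine ⟨N, ⟨fun x hx g => ?_⟩, fun hdvd => ?_, fun x => ⟨K, ?_⟩⟩
  · obtain ⟨u, hu, v, hv, rfl⟩ := Subgroup.mem_sup_of_normal_left.mp hx
    obtain ⟨i, rfl⟩ := Subgroup.mem_zpowers_iff.mp hv
    have e1 : g * (u * (b ^ k) ^ i) * g⁻¹ = g * u * g⁻¹ * (g * b ^ k * g⁻¹) ^ i := by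
      rw [conj_zpow]; group
    rw [e1]
    exact Subgroup.mul_mem _ (Subgroup.mem_sup_left (hNa.conj_mem _ hu _))
      (Subgroup.zpow_mem _ (hconj g) i)
  · obtain ⟨⟨x, hx⟩, hxp⟩ := exists_prime_orderOf_dvd_card' p hdvd
    rw [Subgroup.orderOf_mk] at hxp
    obtain ⟨u, hu, v, hv, rfl⟩ := Subgroup.mem_sup_of_normal_left.mp hx
    obtain ⟨i, rfl⟩ := Subgroup.mem_zpowers_iff.mp hv
    have h0 : ((b ^ k) ^ i) ^ orderOf (b ^ k) = 1 := by
      rw [← zpow_natCast, zpow_comm, zpow_natCast, pow_orderOf_eq_one, one_zpow]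
    have h1 : (u * (b ^ k) ^ i) ^ orderOf (b ^ k) ∈ Subgroup.zpowers (a ^ k) := by
      rw [← QuotientGroup.eq_one_iff, QuotientGroup.mk_pow, QuotientGroup.mk_mul,
        (QuotientGroup.eq_one_iff u).mpr hu, one_mul, ← QuotientGroup.mk_pow, h0,
        QuotientGroup.mk_one]
    obtain ⟨l, hl⟩ := Subgroup.mem_zpowers_iff.mp h1
    have h2 : (u * (b ^ k) ^ i) ^ (orderOf (b ^ k) * orderOf (a ^ k)) = 1 := by
      rw [pow_mul, ← hl, ← zpow_natCast, zpow_comm, zpow_natCast, pow_orderOf_eq_one, one_zpow]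
    have h3 := orderOf_dvd_of_pow_eq_one h2
    rw [hxp] at h3
    rcases hp.dvd_mul.mp h3 with h4 | h4
    · exact hcop b h4
    · exact hcop a h4
  · obtain ⟨j, i, rfl⟩ := h.gen x
    rw [mul_zpow_pow h.conj]
    refine Subgroup.mul_mem _ (Subgroup.mem_sup_right ?_) (Subgroup.mem_sup_left ?_)
    · rw [mul_comm, pow_mul]
      exact Subgroup.pow_mem _ (Subgroup.mem_zpowers _) _
    · obtain ⟨c, hc⟩ := pow_dvd_geomSum (_root_.dvd_pow_sub_one ht j) K
      refine Subgroup.mem_zpowers_iff.mpr ⟨i * c, ?_⟩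
      rw [← zpow_natCast, ← zpow_mul, hk]
      congr 1
      push_cast
      rw [hc]
      ring

section Map

variable {G P : Type*} [Group G] [Finite G] [Group P] [Finite P] {p : ℕ} {f : G →* P}

/-- The image of a subgroup in a `p`-group, modulo a `p'`-subgroup. -/
theorem card_map_eq_pow (hp : p.Prime) (hP : IsPGroup p P) (hker : ¬ p ∣ Nat.card f.ker)
    (H : Subgroup G) : Nat.card (H.map f) = p ^ (Nat.card H).factorization p := by
  have : Fact p.Prime := ⟨hp⟩
  obtain ⟨k, hk⟩ := IsPGroup.iff_card.mp (hP.to_subgroup (H.map f))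
  have h1 := (f.ker.subgroupOf H).card_mul_index
  have h2 : (f.ker.subgroupOf H).index = Nat.card (H.map f) := Subgroup.relIndex_ker _ f
  have h3 : ¬ p ∣ Nat.card (f.ker.subgroupOf H) := fun h =>
    hker (h.trans (Subgroup.card_comap_dvd_of_injective _ _ H.subtype_injective))
  rw [h2, hk] at h1
  rw [hk, ← h1, Nat.factorization_mul Nat.card_pos.ne' (pow_ne_zero _ hp.ne_zero),
    Finsupp.add_apply, Nat.factorization_eq_zero_of_not_dvd h3, zero_add,
    hp.factorization_pow, Finsupp.single_eq_same]

theorem index_map_eq_pow (hp : p.Prime) (hP : IsPGroup p P) (hker : ¬ p ∣ Nat.card f.ker)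
    (hf : Function.Surjective f) (H : Subgroup G) :
    (H.map f).index = p ^ H.index.factorization p := by
  have h1 := (H.map f).card_mul_index
  have h2 := card_map_eq_pow hp hP hker (⊤ : Subgroup G)
  rw [Subgroup.map_top_of_surjective f hf, Subgroup.card_top, Subgroup.card_top,
    ← H.card_mul_index, Nat.factorization_mul Nat.card_pos.ne' Subgroup.index_ne_zero_of_finite,
    Finsupp.add_apply, pow_add, ← card_map_eq_pow hp hP hker H, ← h1] at h2
  exact Nat.eq_of_mul_eq_mul_left Nat.card_pos h2

/-- The factorization induced on a quotient `p`-group by a `p'`-subgroup has the `p`-parts of `m,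
n, s` as parameters, and the same `t`. -/
theorem IsPres.exists_map {a b : G} {m n : ℕ} {e t : ℤ} (h : IsPres a b m n e t)
    (hp : p.Prime) (hP : IsPGroup p P) (hker : ¬ p ∣ Nat.card f.ker)
    (hf : Function.Surjective f) :
    ∃ e₂, IsPres (f a) (f b) (p ^ m.factorization p) (p ^ n.factorization p) e₂ t ∧
      Int.gcd (p ^ m.factorization p : ℕ) e₂ = p ^ (Int.gcd m e).factorization p := by
  have hN : (Subgroup.zpowers (f a)).Normal := by
    rw [← MonoidHom.map_zpowers]
    exact h.normal.map f hf
  have hgen : ∀ g : P, ∃ (j : ℕ) (i : ℤ), g = f b ^ j * f a ^ i := by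
    intro g
    obtain ⟨g, rfl⟩ := hf g
    obtain ⟨j, i, rfl⟩ := h.gen g
    exact ⟨j, i, by simp⟩
  obtain ⟨e₂, t₂, h2⟩ := exists_isPres_of_gen hN hgen
  have h3 : orderOf (f a) = p ^ m.factorization p := by
    rw [← Nat.card_zpowers, ← MonoidHom.map_zpowers, card_map_eq_pow hp hP hker,
      Nat.card_zpowers, h.orderOf_left]
  have h4 : (Subgroup.zpowers (f a)).index = p ^ n.factorization p := by
    rw [← MonoidHom.map_zpowers, index_map_eq_pow hp hP hker hf, h.index_left]
  have h5 := h2.index_right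
  rw [h4, h3] at h2
  refine ⟨e₂, ⟨h3, ?_, h2.mem_iff, h2.pow_right, hgen⟩, ?_⟩
  · rw [← map_inv, ← map_mul, ← map_mul, h.conj, map_zpow]
  · rw [← h3, ← h5, ← MonoidHom.map_zpowers, index_map_eq_pow hp hP hker hf, h.index_right]

end Map

/-- Two metacyclic factorizations of `G` give rise to factorizations of the `p`-group obtained by
factoring out the normal `p`-complement. -/
theorem IsPres.exists_pGroup {G : Type u} [Group G] [Finite G] {a b a' b' : G} {m n m' n' : ℕ}
    {e t e' t' : ℤ} (h : IsPres a b m n e t) (h' : IsPres a' b' m' n' e' t') {p : ℕ}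
    (hp : p.Prime) (ht : (p : ℤ) ∣ t - 1) :
    ∃ (P : Type u) (_ : Group P) (_ : Finite P) (f : G →* P) (e₂ e₂' : ℤ),
      IsPres (f a) (f b) (p ^ m.factorization p) (p ^ n.factorization p) e₂ t ∧
      IsPres (f a') (f b') (p ^ m'.factorization p) (p ^ n'.factorization p) e₂' t' ∧
      Int.gcd (p ^ m.factorization p : ℕ) e₂ = p ^ (Int.gcd m e).factorization p ∧
      Int.gcd (p ^ m'.factorization p : ℕ) e₂' = p ^ (Int.gcd m' e').factorization p := by
  obtain ⟨N, hN, hN1, hN2⟩ := h.exists_normal_complement hp ht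
  have hP : IsPGroup p (G ⧸ N) := by
    intro x
    obtain ⟨g, rfl⟩ := QuotientGroup.mk_surjective x
    obtain ⟨k, hk⟩ := hN2 g
    exact ⟨k, by rw [← QuotientGroup.mk_pow, QuotientGroup.eq_one_iff]; exact hk⟩
  have hker : ¬ p ∣ Nat.card (QuotientGroup.mk' N).ker := by rwa [QuotientGroup.ker_mk']
  have hf := QuotientGroup.mk'_surjective N
  obtain ⟨e₂, h1, h2⟩ := h.exists_map hp hP hker hf
  obtain ⟨e₂', h3, h4⟩ := h'.exists_map hp hP hker hf
  exact ⟨G ⧸ N, inferInstance, inferInstance, QuotientGroup.mk' N, e₂, e₂', h1, h3, h2, h4⟩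

/-! ### The action on the part of `⟨a⟩` without fixed points -/

/-- A unit modulo `d` has a representative prime to `N`. -/
theorem exists_modEq_coprime {d i N : ℕ} (hd : d ≠ 0) (hN : N ≠ 0) (hi : i.Coprime d) :
    ∃ k : ℕ, k ≡ i [MOD d] ∧ k.Coprime N := by
  have : NeZero (d * N) := ⟨mul_ne_zero hd hN⟩
  have : NeZero d := ⟨hd⟩
  obtain ⟨v, hv⟩ := ZMod.unitsMap_surjective (Dvd.intro N rfl : d ∣ d * N) (ZMod.unitOfCoprime i hi)
  refine ⟨(v : ZMod (d * N)).val, ?_, ?_⟩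
  · rw [← ZMod.natCast_eq_natCast_iff]
    have h1 := congrArg (Units.val) hv
    rw [ZMod.unitsMap_def, Units.coe_map, ZMod.coe_unitOfCoprime] at h1
    rw [← h1, ← ZMod.cast_eq_val]
    rfl
  · exact (ZMod.val_coe_unit_coprime v).coprime_dvd_right (Dvd.intro_left d rfl)

namespace IsPres

variable {G : Type*} [Group G] {a b a' b' : G} {m n m' n' : ℕ} {e t e' t' : ℤ} {w : ℕ}

/-- If `w` is prime to `t - 1`, then the subgroup of order `w` of `⟨a⟩` lies in the commutator
subgroup, hence in `⟨a'⟩`. -/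
theorem zpow_mem_of_isCoprime (h : IsPres a b m n e t) (h' : IsPres a' b' m' n' e' t')
    (hw : w ∣ m) (hwt : IsCoprime (w : ℤ) (t - 1)) :
    a ^ (m / w) ∈ Subgroup.zpowers a' := by
  obtain ⟨u, v, huv⟩ := hwt
  obtain ⟨f, hf⟩ := Subgroup.mem_zpowers_iff.mp (h.zpow_sub_one_mem h')
  have hmw : (m : ℤ) = (m / w : ℕ) * w := by exact_mod_cast (Nat.div_mul_cancel hw).symm
  have h1 : a ^ (m / w) = a' ^ (f * (v * (m / w : ℕ))) := by
    rw [zpow_mul, hf, ← zpow_mul, ← zpow_natCast, h.zpow_eq_zpow_iff, hmw]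
    exact ⟨-u, by linear_combination (m / w : ℕ) * huv⟩
  rw [h1]
  exact Subgroup.zpow_mem _ (Subgroup.mem_zpowers a') _

theorem dvd_of_isCoprime [Finite G] (h : IsPres a b m n e t) (h' : IsPres a' b' m' n' e' t')
    (hw : w ∣ m) (hwt : IsCoprime (w : ℤ) (t - 1)) : w ∣ m' := by
  have h1 : orderOf (a ^ (m / w)) = w := by
    rw [orderOf_pow, h.orderOf_left, Nat.gcd_eq_right (Nat.div_dvd_of_dvd hw),
      Nat.div_div_self hw h.pos_left.ne']
  rw [← h1, ← h'.orderOf_left]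
  have h2 := Subgroup.orderOf_dvd_natCard _ (h.zpow_mem_of_isCoprime h' hw hwt)
  rwa [Nat.card_zpowers] at h2

/-- Conjugation by an element of `G` on the part `⟨a ^ (m / w)⟩` of order `w` prime to `t - 1`,
computed with two factorizations. -/
theorem dvd_pow_sub_pow [Finite G] (h : IsPres a b m n e t) (h' : IsPres a' b' m' n' e' t')
    (hw : w ∣ m) (hwt : IsCoprime (w : ℤ) (t - 1)) {j j' : ℕ} {i i' : ℤ}
    (hg : b ^ j * a ^ i = b' ^ j' * a' ^ i') : (w : ℤ) ∣ t ^ j - t' ^ j' := by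
  obtain ⟨f, hf⟩ := Subgroup.mem_zpowers_iff.mp (h.zpow_mem_of_isCoprime h' hw hwt)
  have h1 : (b ^ j * a ^ i)⁻¹ * a ^ (m / w) * (b ^ j * a ^ i) = a ^ ((m / w : ℕ) * t ^ j) := by
    have e1 : (b ^ j * a ^ i)⁻¹ * a ^ (m / w) * (b ^ j * a ^ i) =
      (a ^ i)⁻¹ * ((b ^ j)⁻¹ * a ^ (m / w) * b ^ j) * a ^ i := by group
    rw [e1, ← zpow_natCast a (m / w), inv_mul_zpow_mul_pow h.conj, ← zpow_neg, ← zpow_add,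
      ← zpow_add]
    congr 1
    ring
  have h2 : (b' ^ j' * a' ^ i')⁻¹ * a ^ (m / w) * (b' ^ j' * a' ^ i') =
      a ^ ((m / w : ℕ) * t' ^ j') := by
    have e1 : (b' ^ j' * a' ^ i')⁻¹ * a ^ (m / w) * (b' ^ j' * a' ^ i') =
      (a' ^ i')⁻¹ * ((b' ^ j')⁻¹ * a ^ (m / w) * b' ^ j') * a' ^ i' := by group
    rw [e1, ← hf, inv_mul_zpow_mul_pow h'.conj, ← zpow_neg, ← zpow_add, ← zpow_add]
    have e2 : -i' + f * t' ^ j' + i' = f * t' ^ j' := by ring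
    rw [e2, zpow_mul, hf, ← zpow_natCast a (m / w), ← zpow_mul]
  rw [← hg, h1, h.zpow_eq_zpow_iff, ← mul_sub] at h2
  have hmw : (m : ℤ) = (m / w : ℕ) * w := by exact_mod_cast (Nat.div_mul_cancel hw).symm
  have h0 : ((m / w : ℕ) : ℤ) ≠ 0 := by
    exact_mod_cast (Nat.div_pos (Nat.le_of_dvd h.pos_left hw)
      (Nat.pos_of_dvd_of_pos hw h.pos_left)).ne'
  rw [hmw] at h2
  rw [dvd_sub_comm]
  exact Int.dvd_of_mul_dvd_mul_left h0 h2

theorem dvd_orderOf_right (h : IsPres a b m n e t) : n ∣ orderOf b :=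
  (h.mem_iff _).mp (by rw [pow_orderOf_eq_one]; exact Subgroup.one_mem _)

/-- The generator `b` may be replaced by any other generator of `⟨b⟩`. -/
theorem pow_right_of_coprime [Finite G] (h : IsPres a b m n e t) {k : ℕ}
    (hk : k.Coprime (orderOf b)) : IsPres a (b ^ k) m n (e * k) (t ^ k) := by
  obtain ⟨l, hl⟩ := exists_pow_eq_self_of_coprime hk
  refine ⟨h.orderOf_left, ?_, fun j => ?_, ?_, fun g => ?_⟩
  · have := inv_mul_zpow_mul_pow h.conj 1 k
    rwa [zpow_one, one_mul] at this
  · rw [← pow_mul, h.mem_iff]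
    exact (hk.coprime_dvd_right h.dvd_orderOf_right).symm.dvd_mul_left
  · rw [← pow_mul, mul_comm, pow_mul, h.pow_right, ← zpow_natCast, ← zpow_mul]
  · obtain ⟨j, i, rfl⟩ := h.gen g
    exact ⟨l * j, i, by rw [pow_mul, hl]⟩

/-- A suitable generator of the right factor of another factorization acts like `b` on the part
of `⟨a⟩` of order prime to `t - 1`. -/
theorem exists_pow_of_isCoprime [Finite G] (h : IsPres a b m n e t)
    (h' : IsPres a' b' m' n' e' t') (hw : w ∣ m) (hwt : IsCoprime (w : ℤ) (t - 1)) :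
    ∃ k : ℕ, k.Coprime (Nat.card G) ∧ (w : ℤ) ∣ t' ^ k - t := by
  obtain ⟨i, l, hil⟩ := h'.gen b
  obtain ⟨j, z, hjz⟩ := h.gen b'
  have h1 : (w : ℤ) ∣ t - t' ^ i := by
    have := h.dvd_pow_sub_pow h' hw hwt (j := 1) (i := 0) (j' := i) (i' := l) (by simpa using hil)
    simpa using this
  have h2 : (w : ℤ) ∣ t ^ j - t' := by
    have := h.dvd_pow_sub_pow h' hw hwt (j := j) (i := z) (j' := 1) (i' := 0)
      (by simpa using hjz.symm)
    simpa using this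
  have hw0 : w ≠ 0 := ne_zero_of_dvd_ne_zero h.pos_left.ne' hw
  have : NeZero w := ⟨hw0⟩
  have hcop : IsCoprime t' (w : ℤ) := by
    have h3 : IsCoprime (t ^ j) (w : ℤ) :=
      ((h.isCoprime h.pos_right.ne').symm.of_isCoprime_of_dvd_right
        (Int.natCast_dvd_natCast.mpr hw)).pow_left
    obtain ⟨c, hc⟩ := h2
    have : t' = t ^ j + w * (-c) := by linear_combination -hc
    rw [this]
    exact h3.add_mul_left_left _
  obtain ⟨v, hv⟩ := (ZMod.coe_int_isUnit_iff_isCoprime t' w).mpr hcop.symm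
  have hpow : ∀ k : ℕ, ((v ^ k : (ZMod w)ˣ) : ZMod w) = ((t' ^ k : ℤ) : ZMod w) := fun k => by
    rw [Units.val_pow_eq_pow_val, hv, Int.cast_pow]
  -- `i` is a unit modulo the order of `v`, with inverse `j`
  have hij : v ^ (i * j) = v ^ 1 := by
    rw [Units.ext_iff, hpow, hpow, coe_eq_intCast_iff, pow_mul, pow_one]
    have h3 : (w : ℤ) ∣ t ^ j - (t' ^ i) ^ j := h1.trans (sub_dvd_pow_sub_pow _ _ j)
    have := dvd_sub h2 h3
    rwa [sub_sub_sub_cancel_left] at this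
  rw [pow_eq_pow_iff_modEq] at hij
  have hic : i.Coprime (orderOf v) := by
    have h3 := hij.gcd_eq
    rw [Nat.gcd_one_left] at h3
    exact Nat.Coprime.coprime_mul_right (k := j) h3
  obtain ⟨k, hk1, hk2⟩ := exists_modEq_coprime (orderOf_pos v).ne' (Nat.card_pos (α := G)).ne' hic
  refine ⟨k, hk2, ?_⟩
  have h3 : (w : ℤ) ∣ t' ^ k - t' ^ i := by
    rw [← coe_eq_intCast_iff, ← hpow, ← hpow, pow_eq_pow_iff_modEq.mpr hk1]
  have := dvd_sub h3 h1
  rwa [sub_sub_sub_cancel_right] at this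

end IsPres

/-! ### The conditions on the parameters in terms of exponents -/

/-- The conditions on `m, n, s` and `(r, ε, o)` that characterize minimal factorizations. -/
def IsMinimalData (m n s r : ℕ) (ε : ℤ) (o : ℕ) : Prop :=
  (ε = -1 →
    pPart m 2 / pPart r 2 ≤ pPart n 2 ∧ pPart m 2 ≤ 2 * pPart s 2 ∧
    pPart s 2 ≠ pPart n 2 * pPart r 2 ∧
    (4 ∣ n → 8 ∣ m → pPart o 2 < pPart n 2 → pPart r 2 ≤ pPart s 2)) ∧
  (∀ p ∈ r.primeFactors, ε ^ (p - 1) = 1 →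
    pPart m p / pPart r p ≤ pPart s p ∧ pPart s p ≤ pPart n p ∧
    (pPart s p < pPart r p → pPart n p < pPart s p * pPart o p))

/-- The conditions of `IsMinimalData` in terms of exponents of primes. -/
theorem isMinimalData_iff {m n s r o : ℕ} {ε : ℤ} (hm : m ≠ 0) (hn : n ≠ 0) (hr : r ∣ m) :
    IsMinimalData m n s r ε o ↔
      (ε = -1 →
        m.factorization 2 ≤ n.factorization 2 + r.factorization 2 ∧
        m.factorization 2 ≤ s.factorization 2 + 1 ∧
        s.factorization 2 ≠ n.factorization 2 + r.factorization 2 ∧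
        (2 ≤ n.factorization 2 → 3 ≤ m.factorization 2 →
          o.factorization 2 < n.factorization 2 → r.factorization 2 ≤ s.factorization 2)) ∧
      (∀ p ∈ r.primeFactors, ε ^ (p - 1) = 1 →
        m.factorization p ≤ s.factorization p + r.factorization p ∧
        s.factorization p ≤ n.factorization p ∧
        (s.factorization p < r.factorization p →
          n.factorization p < s.factorization p + o.factorization p)) := by
  have hle : ∀ p, r.factorization p ≤ m.factorization p :=
    (Nat.factorization_le_iff_dvd (ne_zero_of_dvd_ne_zero hm hr) hm).mpr hr
  have h4 : 4 ∣ n ↔ 2 ≤ n.factorization 2 := Nat.prime_two.pow_dvd_iff_le_factorization (k := 2) hn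
  have h8 : 8 ∣ m ↔ 3 ≤ m.factorization 2 := Nat.prime_two.pow_dvd_iff_le_factorization (k := 3) hm
  unfold IsMinimalData pPart
  have hdiv : ∀ p : ℕ, p.Prime → ∀ k : ℕ,
      (p ^ m.factorization p / p ^ r.factorization p ≤ p ^ k ↔
        m.factorization p ≤ k + r.factorization p) := by
    intro p hp k
    rw [Nat.pow_div (hle p) hp.pos, Nat.pow_le_pow_iff_right hp.one_lt]
    omega
  refine and_congr (imp_congr_right fun _ => ?_)
    (forall₂_congr fun p hp => imp_congr_right fun _ => ?_)
  · rw [hdiv 2 Nat.prime_two, ← pow_succ', Nat.pow_le_pow_iff_right one_lt_two, ← pow_add, Ne,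
      Nat.pow_right_inj one_lt_two, h4, h8, Nat.pow_lt_pow_iff_right one_lt_two,
      Nat.pow_le_pow_iff_right one_lt_two]
  · have hp' := Nat.prime_of_mem_primeFactors hp
    rw [hdiv p hp', Nat.pow_le_pow_iff_right hp'.one_lt, Nat.pow_lt_pow_iff_right hp'.one_lt,
      ← pow_add, Nat.pow_lt_pow_iff_right hp'.one_lt]

theorem mPrime_eq_pow {p m n s r o : ℕ} {ε : ℤ} (hp : p.Prime) (hm : m ≠ 0) (hr : r ∣ m)
    (hε : ε = 1 ∨ ε = -1) :
    ∃ M : ℕ, M ≤ m.factorization p ∧ mPrime p m n s r ε o = p ^ M :=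
  (Nat.dvd_prime_pow hp).mp (mPrime_dvd n s o hp hm hr hε)

/-- Upper bounds for the exponent of `m'_p` in the first case of its definition. -/
theorem exponent_mPrime_le {p m n s r o M : ℕ} {ε : ℤ} (hp : p.Prime) (hε : ε ^ (p - 1) = 1)
    (hM : mPrime p m n s r ε o = p ^ M) :
    M ≤ o.factorization p + r.factorization p ∧
      (M ≤ r.factorization p ∨ M ≤ s.factorization p ∨
        M + n.factorization p ≤ r.factorization p + s.factorization p + o.factorization p) := by
  unfold mPrime pPart at hM
  rw [if_pos hε] at hM
  constructor
  · refine (Nat.pow_le_pow_iff_right hp.one_lt).mp ?_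
    rw [← hM, pow_add]
    exact (min_le_right _ _).trans (min_le_left _ _)
  · have h1 : p ^ M ≤ max (p ^ r.factorization p) (max (p ^ s.factorization p)
        (p ^ r.factorization p * (p ^ s.factorization p * p ^ o.factorization p) /
          p ^ n.factorization p)) := by
      rw [← hM]
      exact (min_le_right _ _).trans (min_le_right _ _)
    rw [le_max_iff, le_max_iff, Nat.pow_le_pow_iff_right hp.one_lt,
      Nat.pow_le_pow_iff_right hp.one_lt, Nat.le_div_iff_mul_le (Nat.pow_pos hp.pos), ← pow_add,
      ← pow_add, ← pow_add, Nat.pow_le_pow_iff_right hp.one_lt] at h1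
    omega

/-- The exponent of `m'_p` is at least that of `r_p`. -/
theorem le_exponent_mPrime {p m n s r o M : ℕ} {ε : ℤ} (hp : p.Prime) (hm : m ≠ 0) (hr : r ∣ m)
    (hε : ε = 1 ∨ ε = -1) (hM : mPrime p m n s r ε o = p ^ M) : r.factorization p ≤ M := by
  have hle : ∀ p, r.factorization p ≤ m.factorization p :=
    (Nat.factorization_le_iff_dvd (ne_zero_of_dvd_ne_zero hm hr) hm).mpr hr
  refine (Nat.pow_le_pow_iff_right hp.one_lt).mp ?_
  rw [← hM]
  have hpos : ∀ k : ℕ, 1 ≤ p ^ k := fun k => Nat.pow_pos hp.pos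
  unfold mPrime pPart
  split_ifs with h1 h2 h3
  · refine le_min (Nat.pow_le_pow_right hp.pos (hle p)) (le_min ?_ (le_max_left _ _))
    exact Nat.le_mul_of_pos_left _ (hpos _)
  all_goals
    have hp2 : p = 2 := by
      by_contra hne
      rcases hε with rfl | rfl
      · simp at h1
      · exact h1 (Even.neg_one_pow (hp.even_sub_one hne))
    subst hp2
  · rfl
  · omega
  · exact Nat.pow_le_pow_right hp.pos (hle 2)

/-- Upper bounds for the exponent of `m'_2` in the case `ε = -1`. -/
theorem exponent_mPrime_two {m n s r o M : ℕ} (hM : mPrime 2 m n s r (-1) o = 2 ^ M)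
    (hσμ : s.factorization 2 ≤ m.factorization 2)
    (hμσ : m.factorization 2 ≤ s.factorization 2 + 1)
    (hμ : m.factorization 2 ≤ n.factorization 2 + r.factorization 2)
    (hρ : 2 ≤ r.factorization 2) :
    M ≤ r.factorization 2 ∨ 3 ≤ m.factorization 2 ∧
      (M + 1 ≤ m.factorization 2 ∨ n.factorization 2 ≤ o.factorization 2 ∨
        s.factorization 2 = m.factorization 2 ∨
        m.factorization 2 = n.factorization 2 + r.factorization 2) := by
  unfold mPrime pPart at hM
  rw [if_neg (by norm_num)] at hM
  have e1 : (2 ^ o.factorization 2 ≤ 2 ↔ o.factorization 2 ≤ 1) :=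
    Nat.pow_le_pow_iff_right (m := 1) one_lt_two
  have e2 : (2 ^ m.factorization 2 ≤ 2 * 2 ^ r.factorization 2 ↔
      m.factorization 2 ≤ r.factorization 2 + 1) := by
    rw [← pow_succ', Nat.pow_le_pow_iff_right one_lt_two]
  have e3 : (4 ≤ 2 ^ o.factorization 2 ↔ 2 ≤ o.factorization 2) :=
    Nat.pow_le_pow_iff_right (n := 2) one_lt_two
  have e4 : (4 * 2 ^ r.factorization 2 ≤ 2 ^ m.factorization 2 ↔
      r.factorization 2 + 2 ≤ m.factorization 2) := by
    rw [show 4 = 2 ^ 2 by norm_num, ← pow_add, Nat.pow_le_pow_iff_right one_lt_two, add_comm]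
  have e5 : (2 * 2 ^ s.factorization 2 = 2 ^ m.factorization 2 ↔
      s.factorization 2 + 1 = m.factorization 2) := by
    rw [← pow_succ']
    exact Nat.pow_right_injective le_rfl |>.eq_iff
  have e6 : ∀ i j : ℕ, 2 ^ i = 2 ^ j ↔ i = j := fun i j => Nat.pow_right_injective le_rfl |>.eq_iff
  simp only [e1, e2, e3, e4, e5, e6, Nat.pow_lt_pow_iff_right one_lt_two, ← pow_add, Ne] at hM
  split_ifs at hM with h1 h2
  · exact Or.inl (Nat.pow_right_injective le_rfl hM).ge
  · right
    refine ⟨by omega, Or.inl ?_⟩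
    have h3 : 2 ^ m.factorization 2 / 2 = 2 ^ (m.factorization 2 - 1) := by
      rw [← Nat.pow_div (by omega) two_pos, pow_one]
    rw [h3] at hM
    have := Nat.pow_right_injective le_rfl hM
    omega
  · right
    refine ⟨by omega, Or.inr ?_⟩
    omega

/-! ### Factorizations with minimal data -/

theorem factorization_piPart (m : ℕ) {ν : Finset ℕ} (hν : ν ⊆ m.primeFactors) (p : ℕ) :
    (piPart m ν).factorization p = if p ∈ ν then m.factorization p else 0 := by
  unfold piPart pPart
  rw [Nat.factorization_prod fun q hq =>
    pow_ne_zero _ (Nat.prime_of_mem_primeFactors (hν hq)).ne_zero]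
  rw [Finset.sum_congr rfl fun q hq => (Nat.prime_of_mem_primeFactors (hν hq)).factorization_pow]
  rw [Finsupp.finsetSum_apply]
  simp [Finsupp.single_apply]

theorem isTrivialAt_one_iff {p : ℕ} {t : ℤ} : IsTrivialAt p 1 t ↔ (p : ℤ) ∣ t - 1 := by
  unfold IsTrivialAt
  rw [pow_one]
  constructor
  · rintro (h | ⟨rfl, h⟩)
    · exact h
    · push_cast at h ⊢; omega
  · exact Or.inl

section

variable {m : ℕ} {τ : (ZMod m)ˣ} {t : ℤ} {p : ℕ}

theorem dvd_sub_one_of_dvd_invR (hm : m ≠ 0) (hτ : (τ : ZMod m) = (t : ZMod m)) (hp : p.Prime)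
    (hpr : p ∣ invR (Subgroup.zpowers τ)) : (p : ℤ) ∣ t - 1 := by
  rw [← isTrivialAt_one_iff]
  exact ((pow_dvd_invR_iff hm hτ hp).mp (by rwa [pow_one])).2

/-- The primes in `ν` are those prime divisors of `m` that do not divide `t - 1`. -/
theorem dvd_invR_iff (hm : m ≠ 0) (hτ : (τ : ZMod m) = (t : ZMod m)) (hp : p.Prime)
    (hpm : p ∣ m) : p ∣ invR (Subgroup.zpowers τ) ↔ (p : ℤ) ∣ t - 1 := by
  have := pow_dvd_invR_iff hm hτ hp (k := 1)
  rw [pow_one, isTrivialAt_one_iff] at this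
  rw [this]
  exact and_iff_right hpm

theorem factorization_invR_le (hm : m ≠ 0) (T : Subgroup (ZMod m)ˣ) (p : ℕ) :
    (invR T).factorization p ≤ m.factorization p :=
  (Nat.factorization_le_iff_dvd (invR_ne_zero hm T) hm).mpr (invR_dvd hm T) p

theorem gcd_eq_pow_of (hp : p.Prime) {k : ℤ} {μ ρ : ℕ} (hρμ : ρ ≤ μ) (h1 : (p : ℤ) ^ ρ ∣ k)
    (h2 : ∀ i ≤ μ, (p : ℤ) ^ i ∣ k → i ≤ ρ) : Int.gcd (p ^ μ : ℕ) k = p ^ ρ := by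
  obtain ⟨i, hi, hi'⟩ := (Nat.dvd_prime_pow hp).mp
    (Int.natCast_dvd_natCast.mp (Int.gcd_dvd_left ((p ^ μ : ℕ) : ℤ) k))
  have h3 := h2 i hi (pow_dvd_of_gcd_eq hi')
  have h4 := le_of_pow_dvd_of_gcd_eq hp hi' hρμ h1
  rw [hi', le_antisymm h3 h4]

/-- If `p` is odd or `ε = 1`, then `r_p = gcd (m_p, t - 1)`. -/
theorem gcd_sub_one_eq_of_invEps (hm : m ≠ 0) (hτ : (τ : ZMod m) = (t : ZMod m)) (hp : p.Prime)
    (hε : invEps (Subgroup.zpowers τ) ^ (p - 1) = 1) :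
    Int.gcd (p ^ m.factorization p : ℕ) (t - 1) =
      p ^ (invR (Subgroup.zpowers τ)).factorization p := by
  have h0 := (le_factorization_invR_iff hm hτ hp).mp le_rfl
  refine gcd_eq_pow_of hp h0.1 ?_ fun i hi hk =>
    (le_factorization_invR_iff hm hτ hp).mpr ⟨hi, Or.inl hk⟩
  rcases h0.2 with h1 | ⟨rfl, h1⟩
  · exact h1
  · rw [Nat.add_one_sub_one, pow_one, invEps_eq_one_iff hm hτ] at hε
    exact_mod_cast hε

/-- If `ε = -1`, then `t ≡ -1` modulo `4` and `r_2 = gcd (m_2, t + 1)`. -/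
theorem gcd_add_one_eq_of_invEps (hm : m ≠ 0) (hτ : (τ : ZMod m) = (t : ZMod m))
    (hε : invEps (Subgroup.zpowers τ) = -1) :
    2 ≤ (invR (Subgroup.zpowers τ)).factorization 2 ∧ (4 : ℤ) ∣ t + 1 ∧
    Int.gcd (2 ^ m.factorization 2 : ℕ) (t + 1) =
      2 ^ (invR (Subgroup.zpowers τ)).factorization 2 := by
  have hne : ¬ invEps (Subgroup.zpowers τ) = 1 := by rw [hε]; norm_num
  rw [invEps_eq_one_iff hm hτ] at hne
  have h0 := (le_factorization_invR_iff hm hτ Nat.prime_two).mp le_rfl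
  have h1 : (2 : ℤ) ^ (invR (Subgroup.zpowers τ)).factorization 2 ∣ t + 1 := by
    rcases h0.2 with h1 | ⟨-, h1⟩
    · exact absurd (by exact_mod_cast h1) hne
    · exact_mod_cast h1
  have h2 : 2 ≤ (invR (Subgroup.zpowers τ)).factorization 2 := by
    by_contra hlt
    interval_cases hr : (invR (Subgroup.zpowers τ)).factorization 2
    · simp at hne
    · rw [pow_one] at hne h1; omega
  refine ⟨h2, (pow_dvd_pow (2 : ℤ) h2).trans h1, gcd_eq_pow_of Nat.prime_two h0.1
    (by exact_mod_cast h1) fun i hi hk =>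
    (le_factorization_invR_iff hm hτ Nat.prime_two).mpr ⟨hi, Or.inr ⟨rfl, hk⟩⟩⟩

theorem piPart_invNu_dvd (T : Subgroup (ZMod m)ˣ) : piPart m (invNu T) ∣ m :=
  piPart_dvd m Finset.sdiff_subset

theorem isCoprime_piPart_invNu (hm : m ≠ 0) (hτ : (τ : ZMod m) = (t : ZMod m)) :
    IsCoprime (piPart m (invNu (Subgroup.zpowers τ)) : ℤ) (t - 1) := by
  unfold piPart pPart
  push_cast
  refine IsCoprime.prod_left fun p hp => IsCoprime.pow_left ?_
  obtain ⟨hp1, hp2, hp3⟩ := (mem_invNu_iff hm _).mp hp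
  rw [(Nat.prime_iff_prime_int.mp hp1).coprime_iff_not_dvd, ← dvd_invR_iff hm hτ hp1 hp2]
  exact hp3

end

namespace IsPres

section Compare

variable {G : Type u} [Group G] [Finite G] {a b a' b' : G} {m n m' n' : ℕ}
  {e t e' t' : ℤ} {τ : (ZMod m)ˣ} {p : ℕ}

/-- The factorizations of a `p`-group induced by two factorizations of `G`. If `b` and `b'` act in
the same way on the part of `⟨a⟩` of order `m_ν`, then `a' ∈ b ^ y ⟨a⟩` and `b' ∈ b ^ j ⟨a⟩` with
`y` and `j - 1` divisible by `o_p`, since `a'` and `b⁻¹ b'` centralize that part. -/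
theorem exists_pGroup_exponents (h : IsPres a b m n e t) (h' : IsPres a' b' m' n' e' t')
    (hτ : (τ : ZMod m) = (t : ZMod m)) (hw : (piPart m (invNu (Subgroup.zpowers τ)) : ℤ) ∣ t' - t)
    (hp : p.Prime) (hpr : p ∣ invR (Subgroup.zpowers τ)) :
    ∃ (P : Type u) (_ : Group P) (_ : Finite P) (α β α' β' : P) (e₂ e₂' : ℤ) (y j : ℕ) (x z : ℤ),
      IsPres α β (p ^ m.factorization p) (p ^ n.factorization p) e₂ t ∧
      IsPres α' β' (p ^ m'.factorization p) (p ^ n'.factorization p) e₂' t' ∧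
      Int.gcd (p ^ m.factorization p : ℕ) e₂ = p ^ (Int.gcd m e).factorization p ∧
      Int.gcd (p ^ m'.factorization p : ℕ) e₂' = p ^ (Int.gcd m' e').factorization p ∧
      α' = β ^ y * α ^ x ∧ β' = β ^ j * α ^ z ∧
      p ^ (invO (Subgroup.zpowers τ)).factorization p ∣ y ∧
      (p : ℤ) ^ (invO (Subgroup.zpowers τ)).factorization p ∣ j - 1 ∧
      (invO (Subgroup.zpowers τ)).factorization p ≤ n.factorization p := by
  have hm := h.pos_left.ne'
  have hpν : p ∉ invNu (Subgroup.zpowers τ) := fun hν => ((mem_invNu_iff hm _).mp hν).2.2 hpr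
  obtain ⟨d, hd0, hd, hdo⟩ := factorization_invO hm hτ hp hpν
  obtain ⟨P, hP1, hP2, f, e₂, e₂', h1, h2, h3, h4⟩ :=
    h.exists_pGroup h' hp (dvd_sub_one_of_dvd_invR hm hτ hp hpr)
  obtain ⟨y, x, hyx⟩ := h.gen a'
  obtain ⟨j, z, hjz⟩ := h.gen b'
  have hwm := piPart_invNu_dvd (Subgroup.zpowers τ)
  have hwt := isCoprime_piPart_invNu hm hτ
  have hpd : p ^ d.factorization p ∣ d := Nat.ordProj_dvd d p
  rw [hdo]
  refine ⟨P, hP1, hP2, f a, f b, f a', f b', e₂, e₂', y, j, x, z, h1, h2, h3, h4, ?_, ?_,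
    hpd.trans ((hd y).mpr ?_), ?_, ?_⟩
  · rw [hyx]; simp
  · rw [hjz]; simp
  · have := h.dvd_pow_sub_pow h' hwm hwt (j := y) (i := x) (j' := 0) (i' := 1)
      (by simpa using hyx.symm)
    simpa using this
  · have h5 : (piPart m (invNu (Subgroup.zpowers τ)) : ℤ) ∣ t ^ j - t := by
      have h6 := h.dvd_pow_sub_pow h' hwm hwt (j := j) (i := z) (j' := 1) (i' := 0)
        (by simpa using hjz.symm)
      have := dvd_add h6 hw
      rwa [pow_one, sub_add_sub_cancel] at this
    have hpdI : (p : ℤ) ^ d.factorization p ∣ d := by exact_mod_cast hpd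
    refine hpdI.trans ?_
    rcases Nat.eq_zero_or_pos j with rfl | hj
    · have h6 : d ∣ 1 := (hd 1).mpr (by
        rw [pow_zero, dvd_sub_comm] at h5
        simpa using h5)
      rw [Nat.dvd_one.mp h6]
      simp
    · obtain ⟨i, rfl⟩ := Nat.exists_eq_add_of_le hj
      have h6 : d ∣ i := (hd i).mpr (by
        rw [show t ^ (0 + 1 + i) - t = t * (t ^ i - 1) by ring] at h5
        refine IsCoprime.dvd_of_dvd_mul_left ?_ h5
        exact (h.isCoprime h.pos_right.ne').of_isCoprime_of_dvd_left
          (Int.natCast_dvd_natCast.mpr hwm))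
      have : ((0 + 1 + i : ℕ) : ℤ) - 1 = i := by push_cast; ring
      rw [Nat.succ_eq_add_one, this]
      exact_mod_cast h6
  · have h5 : d ∣ n := (hd n).mpr ((Int.natCast_dvd_natCast.mpr hwm).trans h.dvd_pow_sub_one)
    exact (Nat.factorization_le_iff_dvd hd0 h.pos_right.ne').mpr h5 p

/-- Comparison at a prime `p ∣ r` with `ε ^ (p - 1) = 1`, when `b` and `b'` act in the same way on
the part of order `m_ν`: `m_p`, `r_p` and `s_p` are least in lexicographic order, and the actions
agree modulo `m'_p`. -/
theorem compare_of_pos (h : IsPres a b m n e t) (h' : IsPres a' b' m' n' e' t')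
    (hτ : (τ : ZMod m) = (t : ZMod m)) (hw : (piPart m (invNu (Subgroup.zpowers τ)) : ℤ) ∣ t' - t)
    (hmin : IsMinimalData m n (Int.gcd m e) (invR (Subgroup.zpowers τ))
      (invEps (Subgroup.zpowers τ)) (invO (Subgroup.zpowers τ)))
    (hp : p.Prime) (hpr : p ∣ invR (Subgroup.zpowers τ))
    (hε : invEps (Subgroup.zpowers τ) ^ (p - 1) = 1) :
    m.factorization p ≤ m'.factorization p ∧
    (m' = m →
      (p : ℤ) ^ (invR (Subgroup.zpowers τ)).factorization p ∣ t' - 1 ∧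
      (Int.gcd m e).factorization p ≤ (Int.gcd m' e').factorization p ∧
      ∀ M : ℕ, mPrime p m n (Int.gcd m e) (invR (Subgroup.zpowers τ))
        (invEps (Subgroup.zpowers τ)) (invO (Subgroup.zpowers τ)) = p ^ M →
        (p : ℤ) ^ M ∣ t' - t) := by
  have hm := h.pos_left.ne'
  have hr0 := invR_ne_zero hm (Subgroup.zpowers τ)
  obtain ⟨P, _, _, α, β, α', β', e₂, e₂', y, j, x, z, h1, h2, h3, h4, hα, hβ, hy, hj, hω⟩ :=
    h.exists_pGroup_exponents h' hτ hw hp hpr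
  have hρ := gcd_sub_one_eq_of_invEps hm hτ hp hε
  have hρ0 : (invR (Subgroup.zpowers τ)).factorization p ≠ 0 :=
    (hp.factorization_pos_of_dvd hr0 hpr).ne'
  obtain ⟨-, hσ2, hσ3⟩ := ((isMinimalData_iff hm h.pos_right.ne' (invR_dvd hm _)).mp hmin).2 p
    (Nat.mem_primeFactors.mpr ⟨hp, hpr, hr0⟩) hε
  refine ⟨h1.exponent_le hp h2 h3 hρ hρ0 hω hσ2 (by omega) hα hy hβ hj, fun hmm => ?_⟩
  subst hmm
  refine ⟨pow_dvd_of_gcd_eq ((h1.gcd_sub_one_eq h2).trans hρ),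
    h1.index_exponent_le hp h2 h3 h4 (dvd_sub_one_of_dvd_invR hm hτ hp hpr) hσ2, fun M hM => ?_⟩
  obtain ⟨hM2, hM3⟩ := exponent_mPrime_le hp hε hM
  obtain ⟨M', hM', hM1⟩ := mPrime_eq_pow hp hm (invR_dvd hm (Subgroup.zpowers τ))
    (invEps_eq_or _) (n := n) (s := Int.gcd m' e) (o := invO (Subgroup.zpowers τ))
  rw [hM] at hM1
  have hMM : M = M' := Nat.pow_right_injective hp.two_le hM1
  exact h1.pow_dvd_sub hp h2 h3 hρ hρ0 hω hα hy hβ hj (by omega) hM2 (by omega)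

/-- Comparison at `p = 2` when `ε = -1`, to the same effect as `compare_of_pos`; the actions agree
modulo `m'_2` after replacing `b` by `b ^ k`, where `k ≡ 1` modulo `o_2` so that the action on the
part of order `m_ν` can be kept. -/
theorem compare_of_neg (h : IsPres a b m n e t) (h' : IsPres a' b' m' n' e' t')
    (hτ : (τ : ZMod m) = (t : ZMod m)) (hw : (piPart m (invNu (Subgroup.zpowers τ)) : ℤ) ∣ t' - t)
    (hmin : IsMinimalData m n (Int.gcd m e) (invR (Subgroup.zpowers τ))
      (invEps (Subgroup.zpowers τ)) (invO (Subgroup.zpowers τ)))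
    (hε : invEps (Subgroup.zpowers τ) = -1) :
    m.factorization 2 ≤ m'.factorization 2 ∧
    (m' = m →
      (2 : ℤ) ^ (invR (Subgroup.zpowers τ)).factorization 2 ∣ t' + 1 ∧
      (Int.gcd m e).factorization 2 ≤ (Int.gcd m' e').factorization 2 ∧
      ∀ M : ℕ, mPrime 2 m n (Int.gcd m e) (invR (Subgroup.zpowers τ))
        (invEps (Subgroup.zpowers τ)) (invO (Subgroup.zpowers τ)) = 2 ^ M →
        ∃ k : ℕ, Odd k ∧ (2 : ℤ) ^ (invO (Subgroup.zpowers τ)).factorization 2 ∣ k - 1 ∧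
          (2 : ℤ) ^ M ∣ t' - t ^ k) := by
  have hm := h.pos_left.ne'
  have hr0 := invR_ne_zero hm (Subgroup.zpowers τ)
  obtain ⟨hρ2, ht, hρ⟩ := gcd_add_one_eq_of_invEps hm hτ hε
  have hμ2 := hρ2.trans (factorization_invR_le hm _ 2)
  have hpr : 2 ∣ invR (Subgroup.zpowers τ) :=
    Nat.dvd_of_factorization_pos (by omega)
  obtain ⟨P, _, _, α, β, α', β', e₂, e₂', y, j, x, z, h1, h2, h3, h4, hα, hβ, hy, hj, hω⟩ :=
    h.exists_pGroup_exponents h' hτ hw Nat.prime_two hpr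
  obtain ⟨hc1, hc2, hc3, hc4⟩ :=
    ((isMinimalData_iff hm h.pos_right.ne' (invR_dvd hm _)).mp hmin).1 hε
  refine ⟨(h1.exponent_le_of_neg h2 hμ2 ht).1, fun hmm => ?_⟩
  subst hmm
  have hnn : n' = n := by
    have := h.card_eq.symm.trans h'.card_eq
    exact (Nat.eq_of_mul_eq_mul_left h.pos_left this).symm
  subst hnn
  refine ⟨h1.rho_le_of_neg h2 hμ2 ht h3 hρ hα hy hβ hc4,
    h1.sigma_le_of_neg h2 hμ2 ht h3 h4 hρ hc3, fun M hM => ?_⟩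
  obtain ⟨M', hM', hM1⟩ := mPrime_eq_pow Nat.prime_two hm (invR_dvd hm (Subgroup.zpowers τ))
    (invEps_eq_or _) (n := n') (s := Int.gcd m' e) (o := invO (Subgroup.zpowers τ))
  rw [hM] at hM1
  have hMM : M = M' := Nat.pow_right_injective le_rfl hM1
  have hM2 := hM
  rw [hε] at hM2
  refine h1.exists_pow_dvd_sub_of_neg h2 hμ2 ht h3 hρ hα hy hβ hj hc3 hc4 (by omega)
    (exponent_mPrime_two hM2 (le_of_gcd_eq Nat.prime_two h3) hc2 hc1 hρ2)

end Compare

end IsPres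

/-! ### Uniqueness of the invariants of a minimal factorization -/

theorem pow_sub_one_eq_one_or {ε : ℤ} (hε : ε = 1 ∨ ε = -1) {p : ℕ} (hp : p.Prime) :
    ε ^ (p - 1) = 1 ∨ p = 2 ∧ ε = -1 := by
  rcases hε with rfl | rfl
  · simp
  · rcases eq_or_ne p 2 with rfl | hp2
    · exact Or.inr ⟨rfl, rfl⟩
    · exact Or.inl (Even.neg_one_pow (hp.even_sub_one hp2))

theorem not_dvd_piPart {m p : ℕ} {ν : Finset ℕ} (hν : ν ⊆ m.primeFactors) (hp : p.Prime)
    (hpν : p ∉ ν) : ¬ p ∣ piPart m ν := by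
  unfold piPart pPart
  rw [hp.prime.dvd_finsetProd_iff]
  rintro ⟨q, hq, hpq⟩
  have h1 := (Nat.prime_dvd_prime_iff_eq hp (Nat.prime_of_mem_primeFactors (hν hq))).mp
    (hp.dvd_of_dvd_pow hpq)
  exact hpν (h1 ▸ hq)

/-- Divisibility by `[T, n, s]` is checked modulo `m_ν` and modulo each `m'_p`. -/
theorem bracket_dvd_of {m n s : ℕ} (hm : m ≠ 0) {T : Subgroup (ZMod m)ˣ} {x : ℤ}
    (h1 : (piPart m (invNu T) : ℤ) ∣ x)
    (h2 : ∀ p M : ℕ, p.Prime → p ∣ invR T →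
      mPrime p m n s (invR T) (invEps T) (invO T) = p ^ M → (p : ℤ) ^ M ∣ x) :
    (bracket T n s : ℤ) ∣ x := by
  unfold bracket
  push_cast
  have hM : ∀ p ∈ (invR T).primeFactors, ∃ M : ℕ,
      mPrime p m n s (invR T) (invEps T) (invO T) = p ^ M := fun p hp =>
    (mPrime_eq_pow (Nat.prime_of_mem_primeFactors hp) hm (invR_dvd hm T) (invEps_eq_or T)).imp
      fun _ h => h.2
  have hcop : ∀ p q : ℕ, p.Prime → q.Prime → p ≠ q → IsCoprime (p : ℤ) (q : ℤ) :=
    fun p q hp hq hpq => Nat.isCoprime_iff_coprime.mpr ((Nat.coprime_primes hp hq).mpr hpq)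
  refine IsCoprime.mul_dvd (IsCoprime.prod_right fun p hp => ?_) h1
    (Finset.prod_dvd_of_coprime (fun p hp q hq hpq => ?_) fun p hp => ?_)
  · obtain ⟨M, hM⟩ := hM p hp
    have hp' := Nat.prime_of_mem_primeFactors hp
    rw [hM]
    push_cast
    refine IsCoprime.pow_right (IsCoprime.symm ?_)
    rw [(Nat.prime_iff_prime_int.mp hp').coprime_iff_not_dvd, Int.natCast_dvd_natCast]
    refine not_dvd_piPart Finset.sdiff_subset hp' fun hν => ?_
    exact ((mem_invNu_iff hm T).mp hν).2.2 (Nat.dvd_of_mem_primeFactors hp)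
  · obtain ⟨M, hM1⟩ := hM p hp
    obtain ⟨M', hM2⟩ := hM q hq
    simp only [Function.onFun, hM1, hM2]
    push_cast
    exact (hcop p q (Nat.prime_of_mem_primeFactors hp) (Nat.prime_of_mem_primeFactors hq) hpq).pow
  · obtain ⟨M, hM⟩ := hM p hp
    rw [hM]
    exact_mod_cast h2 p M (Nat.prime_of_mem_primeFactors hp) (Nat.dvd_of_mem_primeFactors hp) hM

theorem dvd_pow_sub_pow_of_modEq {d t : ℤ} {q k l : ℕ} (h : d ∣ t ^ q - 1) (hkl : k ≡ l [MOD q]) :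
    d ∣ t ^ k - t ^ l := by
  have key : ∀ k : ℕ, d ∣ t ^ k - t ^ (k % q) := fun k => by
    have h1 : t ^ k - t ^ (k % q) = t ^ (k % q) * ((t ^ q) ^ (k / q) - 1) := by
      rw [mul_sub, ← pow_mul, ← pow_add, Nat.mod_add_div, mul_one]
    rw [h1]
    exact (dvd_pow_sub_one h _).mul_left _
  have h1 := key k
  rw [hkl] at h1
  have := dvd_sub h1 (key l)
  rwa [sub_sub_sub_cancel_right] at this

namespace IsPres

section Compare

variable {G : Type u} [Group G] [Finite G] {a b a' b' : G} {m n m' n' : ℕ}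
  {e t e' t' : ℤ} {τ : (ZMod m)ˣ} {τ' : (ZMod m')ˣ} {p : ℕ}

/-- The numerical conditions force `m` to be least. -/
theorem dvd_left_of_isMinimalData (h : IsPres a b m n e t) (h' : IsPres a' b' m' n' e' t')
    (hτ : (τ : ZMod m) = (t : ZMod m)) (hw : (piPart m (invNu (Subgroup.zpowers τ)) : ℤ) ∣ t' - t)
    (hmin : IsMinimalData m n (Int.gcd m e) (invR (Subgroup.zpowers τ))
      (invEps (Subgroup.zpowers τ)) (invO (Subgroup.zpowers τ))) : m ∣ m' := by
  have hm := h.pos_left.ne'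
  refine (Nat.factorization_le_iff_dvd hm h'.pos_left.ne').mp fun p => ?_
  by_cases hp : p.Prime
  swap
  · rw [Nat.factorization_eq_zero_of_not_prime _ hp]; exact Nat.zero_le _
  by_cases hpm : p ∣ m
  swap
  · rw [Nat.factorization_eq_zero_of_not_dvd hpm]; exact Nat.zero_le _
  by_cases hpr : p ∣ invR (Subgroup.zpowers τ)
  · rcases pow_sub_one_eq_one_or (invEps_eq_or (Subgroup.zpowers τ)) hp with hε | ⟨rfl, hε⟩
    · exact (h.compare_of_pos h' hτ hw hmin hp hpr hε).1
    · exact (h.compare_of_neg h' hτ hw hmin hε).1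
  · have h1 := h.dvd_of_isCoprime h' (piPart_invNu_dvd _) (isCoprime_piPart_invNu hm hτ)
    have h2 := (Nat.factorization_le_iff_dvd (ne_zero_of_dvd_ne_zero h'.pos_left.ne' h1)
      h'.pos_left.ne').mpr h1 p
    rwa [factorization_piPart m (ν := invNu (Subgroup.zpowers τ)) Finset.sdiff_subset,
      if_pos ((mem_invNu_iff hm _).mpr ⟨hp, hpm, hpr⟩)] at h2

/-- `s_ν = m_ν`, since `m` divides `e (t - 1)`. -/
theorem factorization_index_of_not_dvd (h : IsPres a b m n e t)
    (hτ : (τ : ZMod m) = (t : ZMod m)) (hp : p.Prime) (hpm : p ∣ m)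
    (hpr : ¬ p ∣ invR (Subgroup.zpowers τ)) :
    (Int.gcd m e).factorization p = m.factorization p := by
  have hm := h.pos_left.ne'
  rw [dvd_invR_iff hm hτ hp hpm] at hpr
  refine le_antisymm ((Nat.factorization_le_iff_dvd (Int.gcd_ne_zero_left (by exact_mod_cast hm))
    hm).mpr (Int.natCast_dvd_natCast.mp (Int.gcd_dvd_left ..)) p) ?_
  rw [← hp.pow_dvd_iff_le_factorization (Int.gcd_ne_zero_left (by exact_mod_cast hm))]
  have h1 : ((p ^ m.factorization p : ℕ) : ℤ) ∣ m :=
    Int.natCast_dvd_natCast.mpr (Nat.ordProj_dvd m p)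
  refine Int.natCast_dvd_natCast.mp (Int.dvd_coe_gcd h1 ?_)
  refine IsCoprime.dvd_of_dvd_mul_right ?_ (h1.trans h.dvd_mul_sub_one)
  push_cast
  exact ((Nat.prime_iff_prime_int.mp hp).coprime_iff_not_dvd.mpr hpr).pow_left

/-- The numerical conditions force `r` to be least for the given `m`. -/
theorem invR_dvd_of_isMinimalData {τ' : (ZMod m)ˣ} (h : IsPres a b m n e t)
    (h' : IsPres a' b' m n' e' t')
    (hτ : (τ : ZMod m) = (t : ZMod m)) (hτ' : (τ' : ZMod m) = (t' : ZMod m))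
    (hw : (piPart m (invNu (Subgroup.zpowers τ)) : ℤ) ∣ t' - t)
    (hmin : IsMinimalData m n (Int.gcd m e) (invR (Subgroup.zpowers τ))
      (invEps (Subgroup.zpowers τ)) (invO (Subgroup.zpowers τ))) :
    invR (Subgroup.zpowers τ) ∣ invR (Subgroup.zpowers τ') := by
  have hm := h.pos_left.ne'
  refine (Nat.factorization_le_iff_dvd (invR_ne_zero hm _) (invR_ne_zero hm _)).mp fun p => ?_
  by_cases hp : p.Prime
  swap
  · rw [Nat.factorization_eq_zero_of_not_prime _ hp]; exact Nat.zero_le _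
  by_cases hpr : p ∣ invR (Subgroup.zpowers τ)
  swap
  · rw [Nat.factorization_eq_zero_of_not_dvd hpr]; exact Nat.zero_le _
  rw [le_factorization_invR_iff hm hτ' hp]
  refine ⟨factorization_invR_le hm _ p, ?_⟩
  rcases pow_sub_one_eq_one_or (invEps_eq_or (Subgroup.zpowers τ)) hp with hε | ⟨rfl, hε⟩
  · exact Or.inl ((h.compare_of_pos h' hτ hw hmin hp hpr hε).2 rfl).1
  · exact Or.inr ⟨rfl, ((h.compare_of_neg h' hτ hw hmin hε).2 rfl).1⟩

/-- The numerical conditions force `s` to be least for the given `m` and `r`. -/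
theorem index_dvd_of_isMinimalData {τ' : (ZMod m)ˣ} (h : IsPres a b m n e t)
    (h' : IsPres a' b' m n' e' t')
    (hτ : (τ : ZMod m) = (t : ZMod m)) (hτ' : (τ' : ZMod m) = (t' : ZMod m))
    (hw : (piPart m (invNu (Subgroup.zpowers τ)) : ℤ) ∣ t' - t)
    (hmin : IsMinimalData m n (Int.gcd m e) (invR (Subgroup.zpowers τ))
      (invEps (Subgroup.zpowers τ)) (invO (Subgroup.zpowers τ)))
    (hr : invR (Subgroup.zpowers τ') = invR (Subgroup.zpowers τ)) :
    Int.gcd m e ∣ Int.gcd m e' := by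
  have hm := h.pos_left.ne'
  have hs : ∀ e : ℤ, Int.gcd m e ≠ 0 := fun e => Int.gcd_ne_zero_left (by exact_mod_cast hm)
  refine (Nat.factorization_le_iff_dvd (hs _) (hs _)).mp fun p => ?_
  by_cases hp : p.Prime
  swap
  · rw [Nat.factorization_eq_zero_of_not_prime _ hp]; exact Nat.zero_le _
  by_cases hpm : p ∣ m
  swap
  · rw [Nat.factorization_eq_zero_of_not_dvd fun hdvd =>
      hpm (hdvd.trans (Int.natCast_dvd_natCast.mp (Int.gcd_dvd_left ..)))]
    exact Nat.zero_le _
  by_cases hpr : p ∣ invR (Subgroup.zpowers τ)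
  · rcases pow_sub_one_eq_one_or (invEps_eq_or (Subgroup.zpowers τ)) hp with hε | ⟨rfl, hε⟩
    · exact ((h.compare_of_pos h' hτ hw hmin hp hpr hε).2 rfl).2.1
    · exact ((h.compare_of_neg h' hτ hw hmin hε).2 rfl).2.1
  · rw [h.factorization_index_of_not_dvd hτ hp hpm hpr,
      h'.factorization_index_of_not_dvd hτ' hp hpm (hr ▸ hpr)]

theorem invEps_eq_of_isMinimalData {τ' : (ZMod m)ˣ} (h : IsPres a b m n e t)
    (h' : IsPres a' b' m n' e' t')
    (hτ : (τ : ZMod m) = (t : ZMod m)) (hτ' : (τ' : ZMod m) = (t' : ZMod m))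
    (hw : (piPart m (invNu (Subgroup.zpowers τ)) : ℤ) ∣ t' - t)
    (hmin : IsMinimalData m n (Int.gcd m e) (invR (Subgroup.zpowers τ))
      (invEps (Subgroup.zpowers τ)) (invO (Subgroup.zpowers τ)))
    (hr : invR (Subgroup.zpowers τ') = invR (Subgroup.zpowers τ)) :
    invEps (Subgroup.zpowers τ') = invEps (Subgroup.zpowers τ) := by
  have hm := h.pos_left.ne'
  rcases invEps_eq_or (Subgroup.zpowers τ) with hε | hε
  · rw [hε, invEps_eq_one_iff hm hτ', hr]
    by_cases hpr : 2 ∣ invR (Subgroup.zpowers τ)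
    · exact ((h.compare_of_pos h' hτ hw hmin Nat.prime_two hpr (by simpa using hε)).2 rfl).1
    · rw [Nat.factorization_eq_zero_of_not_dvd hpr]
      simp
  · rw [hε]
    refine (invEps_eq_or _).resolve_left fun hε' => ?_
    rw [invEps_eq_one_iff hm hτ', hr] at hε'
    have h1 := ((h.compare_of_neg h' hτ hw hmin hε).2 rfl).1
    have h2 := (gcd_add_one_eq_of_invEps hm hτ hε).1
    have h3 := (pow_dvd_pow (2 : ℤ) h2).trans h1
    have h4 := (pow_dvd_pow (2 : ℤ) h2).trans hε'
    omega

theorem invNu_eq {τ' : (ZMod m)ˣ}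
    (hr : invR (Subgroup.zpowers τ') = invR (Subgroup.zpowers τ)) :
    invNu (Subgroup.zpowers τ') = invNu (Subgroup.zpowers τ) := by
  unfold invNu
  rw [hr]

theorem factorization_invO_eq {τ' : (ZMod m)ˣ} (hm : m ≠ 0)
    (hτ : (τ : ZMod m) = (t : ZMod m)) (hτ' : (τ' : ZMod m) = (t' : ZMod m))
    (hw : (piPart m (invNu (Subgroup.zpowers τ)) : ℤ) ∣ t' - t)
    (hr : invR (Subgroup.zpowers τ') = invR (Subgroup.zpowers τ)) (hp : p.Prime)
    (hpr : p ∣ invR (Subgroup.zpowers τ)) :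
    (invO (Subgroup.zpowers τ')).factorization p = (invO (Subgroup.zpowers τ)).factorization p := by
  have hpν : p ∉ invNu (Subgroup.zpowers τ) := fun hν => ((mem_invNu_iff hm _).mp hν).2.2 hpr
  obtain ⟨d, -, hd, hdo⟩ := factorization_invO hm hτ hp hpν
  obtain ⟨d', -, hd', hdo'⟩ := factorization_invO hm hτ' hp (invNu_eq hr ▸ hpν)
  rw [hdo, hdo']
  have key : ∀ j, d' ∣ j ↔ d ∣ j := fun j => by
    rw [hd, hd', invNu_eq hr]
    have h1 := hw.trans (sub_dvd_pow_sub_pow t' t j)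
    have h2 : t' ^ j - 1 = (t' ^ j - t ^ j) + (t ^ j - 1) := by ring
    rw [h2]
    exact dvd_add_right h1
  rw [Nat.dvd_antisymm ((key d).mpr dvd_rfl) ((key d').mp dvd_rfl)]

theorem bracket_eq {τ' : (ZMod m)ˣ} {s : ℕ}
    (hr : invR (Subgroup.zpowers τ') = invR (Subgroup.zpowers τ))
    (hε : invEps (Subgroup.zpowers τ') = invEps (Subgroup.zpowers τ))
    (ho : ∀ p, p.Prime → p ∣ invR (Subgroup.zpowers τ) →
      (invO (Subgroup.zpowers τ')).factorization p = (invO (Subgroup.zpowers τ)).factorization p) :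
    bracket (Subgroup.zpowers τ') n s = bracket (Subgroup.zpowers τ) n s := by
  unfold bracket
  rw [invNu_eq hr, hr, hε]
  congr 1
  refine Finset.prod_congr rfl fun p hp => ?_
  have hp1 := Nat.prime_of_mem_primeFactors hp
  have hp2 := Nat.dvd_of_mem_primeFactors hp
  have h1 : pPart (invO (Subgroup.zpowers τ')) p = pPart (invO (Subgroup.zpowers τ)) p := by
    unfold pPart; rw [ho p hp1 hp2]
  unfold mPrime
  rw [h1]
  rcases pow_sub_one_eq_one_or (invEps_eq_or (Subgroup.zpowers τ)) hp1 with h2 | ⟨rfl, -⟩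
  · rw [if_pos h2, if_pos h2]
  · rw [h1]

/-- Up to a change of the generator `b`, two minimal factorizations have the same action modulo
`[T, n, s]`. -/
theorem exists_bracket_dvd (h : IsPres a b m n e t) (h' : IsPres a' b' m n' e' t')
    (hτ : (τ : ZMod m) = (t : ZMod m))
    (hw : (piPart m (invNu (Subgroup.zpowers τ)) : ℤ) ∣ t' - t)
    (hmin : IsMinimalData m n (Int.gcd m e) (invR (Subgroup.zpowers τ))
      (invEps (Subgroup.zpowers τ)) (invO (Subgroup.zpowers τ))) :
    ∃ k : ℕ, k.Coprime (Nat.card G) ∧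
      (bracket (Subgroup.zpowers τ) n (Int.gcd m e) : ℤ) ∣ t' - t ^ k := by
  have hm := h.pos_left.ne'
  rcases invEps_eq_or (Subgroup.zpowers τ) with hε | hε
  · refine ⟨1, Nat.coprime_one_left _, bracket_dvd_of hm (by rwa [pow_one]) fun p M hp hpr hM => ?_⟩
    rw [pow_one]
    exact ((h.compare_of_pos h' hτ hw hmin hp hpr (by rw [hε, one_pow])).2 rfl).2.2 M hM
  obtain ⟨hρ2, ht, hρ⟩ := gcd_add_one_eq_of_invEps hm hτ hε
  have hμ2 := hρ2.trans (factorization_invR_le hm _ 2)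
  have hpr2 : 2 ∣ invR (Subgroup.zpowers τ) := Nat.dvd_of_factorization_pos (by omega)
  obtain ⟨M, hM, hM1⟩ := mPrime_eq_pow Nat.prime_two hm (invR_dvd hm (Subgroup.zpowers τ))
    (invEps_eq_or _) (n := n) (s := Int.gcd m e) (o := invO (Subgroup.zpowers τ))
  obtain ⟨k₀, hk1, hk2, hk3⟩ := ((h.compare_of_neg h' hτ hw hmin hε).2 rfl).2.2 M hM1
  -- `k` is chosen with `k ≡ k₀` modulo the `2`-part of `|G|` and `k ≡ 1` modulo its odd part
  have hN0 : Nat.card G ≠ 0 := Nat.card_pos.ne'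
  set v := (Nat.card G).factorization 2 with hv
  set N' := Nat.card G / 2 ^ v with hN'
  have hNN : 2 ^ v * N' = Nat.card G := Nat.ordProj_mul_ordCompl_eq_self _ 2
  have hcop : (2 ^ v).Coprime N' := (Nat.coprime_ordCompl Nat.prime_two hN0).pow_left _
  have hmN : m ∣ Nat.card G := h.card_eq ▸ dvd_mul_right m n
  have hnN : n ∣ Nat.card G := h.card_eq ▸ dvd_mul_left n m
  have hμv : m.factorization 2 ≤ v := (Nat.factorization_le_iff_dvd hm hN0).mpr hmN 2
  obtain ⟨k, hkv, hkN⟩ := Nat.chineseRemainder hcop k₀ 1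
  have hkodd : Odd k := by
    have h1 : k ≡ k₀ [MOD 2] := hkv.of_dvd (dvd_pow_self 2 (by omega))
    have h2 : k % 2 = k₀ % 2 := h1
    rw [Nat.odd_iff] at hk1 ⊢
    omega
  have hk1' : 1 ≤ k := hkodd.pos
  have hodd : ∀ q i : ℕ, q.Prime → q ≠ 2 → q ^ i ∣ Nat.card G → q ^ i ∣ N' := by
    intro q i hq hq2 hqi
    rw [← hNN] at hqi
    exact (Nat.Coprime.pow _ _ ((Nat.coprime_primes hq Nat.prime_two).mpr hq2)).dvd_of_dvd_mul_left
      hqi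
  refine ⟨k, ?_, bracket_dvd_of hm ?_ fun p M' hp hpr hM' => ?_⟩
  · rw [← hNN]
    refine Nat.Coprime.mul_right ?_ ?_
    · exact (Nat.coprime_two_right.mpr hkodd).pow_right _
    · have := hkN.gcd_eq
      rwa [Nat.gcd_one_left] at this
  · -- `t ^ k = t` modulo `m_ν`, since `k = 1` modulo the order of `t`
    have hpν : 2 ∉ invNu (Subgroup.zpowers τ) := fun hν => ((mem_invNu_iff hm _).mp hν).2.2 hpr2
    obtain ⟨d, hd0, hd, hdo⟩ := factorization_invO hm hτ Nat.prime_two hpν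
    have hdn : d ∣ n := (hd n).mpr
      ((Int.natCast_dvd_natCast.mpr (piPart_invNu_dvd _)).trans h.dvd_pow_sub_one)
    have hdv : d.factorization 2 ≤ v := (Nat.factorization_le_iff_dvd hd0 hN0).mpr (hdn.trans hnN) 2
    have hdk : k ≡ 1 [MOD d] := by
      refine (Nat.modEq_iff_dvd' hk1').mpr ?_ |>.symm
      refine dvd_of_forall_prime_pow_dvd fun q i hq hqi => ?_
      rcases eq_or_ne q 2 with rfl | hq2
      · have hi := (hq.pow_dvd_iff_le_factorization hd0).mp hqi
        have h1 : k₀ ≡ 1 [MOD 2 ^ i] := by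
          refine (Nat.modEq_iff_dvd' hk1.pos).mpr ?_ |>.symm
          have h2 : ((2 ^ i : ℕ) : ℤ) ∣ ((k₀ - 1 : ℕ) : ℤ) := by
            rw [Nat.cast_sub hk1.pos]
            push_cast
            exact (pow_dvd_pow _ (hdo ▸ hi)).trans hk2
          exact_mod_cast h2
        exact (Nat.modEq_iff_dvd' hk1').mp
          ((hkv.of_dvd (pow_dvd_pow 2 (hi.trans hdv))).trans h1).symm
      · have h1 : q ^ i ∣ N' := hodd q i hq hq2 (hqi.trans (hdn.trans hnN))
        exact (Nat.modEq_iff_dvd' hk1').mp (hkN.of_dvd h1).symm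
    have h1 := dvd_pow_sub_pow_of_modEq ((hd d).mp dvd_rfl) hdk
    have := dvd_sub hw h1
    rwa [pow_one, sub_sub_sub_cancel_right] at this
  · rcases pow_sub_one_eq_one_or (invEps_eq_or (Subgroup.zpowers τ)) hp with h1 | ⟨rfl, -⟩
    · rcases eq_or_ne p 2 with rfl | hp2
      · rw [hε] at h1; norm_num at h1
      obtain ⟨M'', hM2, hM3⟩ := mPrime_eq_pow hp hm (invR_dvd hm (Subgroup.zpowers τ))
        (invEps_eq_or _) (n := n) (s := Int.gcd m e) (o := invO (Subgroup.zpowers τ))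
      have hMM : M' = M'' := Nat.pow_right_injective hp.two_le (hM'.symm.trans hM3)
      have h2 := ((h.compare_of_pos h' hτ hw hmin hp hpr h1).2 rfl).2.2 M' hM'
      have h3 : (p : ℤ) ^ M' ∣ t ^ N' - 1 := by
        have h4 : p ^ M' ∣ N' := hodd p M' hp hp2
          (((pow_dvd_pow p (hMM ▸ hM2)).trans (Nat.ordProj_dvd m p)).trans hmN)
        have := pow_dvd_pow_sub_one (ρ := 1) one_ne_zero
          (by simpa using dvd_sub_one_of_dvd_invR hm hτ hp hpr) h4
        exact (pow_dvd_pow _ (by omega)).trans this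
      have := dvd_sub h2 (dvd_pow_sub_pow_of_modEq h3 hkN)
      rwa [pow_one, sub_sub_sub_cancel_right] at this
    · have hMM : M' = M := Nat.pow_right_injective le_rfl (hM'.symm.trans hM1)
      subst hMM
      have h3 : (2 : ℤ) ^ M' ∣ t ^ (2 ^ v) - 1 := by
        have := pow_dvd_pow_sub_one (p := 2) (ρ := 1) one_ne_zero
          (by simpa using dvd_sub_one_of_dvd_invR hm hτ hp hpr) (k := v) (N := 2 ^ v) dvd_rfl
        exact (pow_dvd_pow _ (by omega)).trans this
      have := dvd_sub hk3 (dvd_pow_sub_pow_of_modEq h3 hkv)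
      rw [sub_sub_sub_cancel_right] at this
      exact_mod_cast this

end Compare

end IsPres

theorem zpowers_pow_of_coprime {H : Type*} [Group H] {x : H} {k : ℕ} (hk : k.Coprime (orderOf x)) :
    Subgroup.zpowers (x ^ k) = Subgroup.zpowers x := by
  refine le_antisymm (Subgroup.zpowers_le.mpr (Subgroup.pow_mem _ (Subgroup.mem_zpowers x) k))
    (Subgroup.zpowers_le.mpr ?_)
  obtain ⟨l, hl⟩ := exists_pow_eq_self_of_coprime hk
  exact Subgroup.mem_zpowers_iff.mpr ⟨l, by rw [zpow_natCast, hl]⟩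

/-- The tuple `(m, n, s, Res_{[T, n, s]}(T))` attached to a subgroup `T` of `𝒰_m`. -/
noncomputable def dataTuple {m : ℕ} (hm : m ≠ 0) (T : Subgroup (ZMod m)ˣ) (n s : ℕ) :
    ℕ × ℕ × ℕ × (Σ k : ℕ, Subgroup (ZMod k)ˣ) :=
  (m, n, s, ⟨bracket T n s, Res (bracket_dvd hm T n s) T⟩)

/-- If `t' ≡ t ^ k` modulo `[T, n, s]` for some `k` prime to the order of `t`, then `t` and `t'`
generate the same subgroup modulo `[T, n, s]`. -/
theorem dataTuple_eq {m n s : ℕ} (hm : m ≠ 0) {τ τ' : (ZMod m)ˣ} {t t' : ℤ} {k : ℕ}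
    (hτ : (τ : ZMod m) = (t : ZMod m)) (hτ' : (τ' : ZMod m) = (t' : ZMod m))
    (hb : bracket (Subgroup.zpowers τ') n s = bracket (Subgroup.zpowers τ) n s)
    (hk : k.Coprime (orderOf τ)) (hdvd : (bracket (Subgroup.zpowers τ) n s : ℤ) ∣ t' - t ^ k) :
    dataTuple hm (Subgroup.zpowers τ') n s = dataTuple hm (Subgroup.zpowers τ) n s := by
  unfold dataTuple
  have hB := bracket_dvd hm (Subgroup.zpowers τ) n s
  have hB' := bracket_dvd hm (Subgroup.zpowers τ') n s
  have key : ∀ B B' : ℕ, B' = B → ∀ (hB : B ∣ m) (hB' : B' ∣ m), (B : ℤ) ∣ t' - t ^ k →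
      (⟨B', Res hB' (Subgroup.zpowers τ')⟩ : Σ k : ℕ, Subgroup (ZMod k)ˣ) =
        ⟨B, Res hB (Subgroup.zpowers τ)⟩ := by
    rintro B _ rfl hB - hd
    congr 1
    rw [Res_zpowers, Res_zpowers]
    have h1 : ZMod.unitsMap hB τ' = ZMod.unitsMap hB τ ^ k := by
      refine Units.ext ?_
      rw [coe_unitsMap_eq hB hτ', Units.val_pow_eq_pow_val, coe_unitsMap_eq hB hτ, ← Int.cast_pow,
        coe_eq_intCast_iff]
      exact hd
    rw [h1, zpowers_pow_of_coprime (hk.coprime_dvd_right (orderOf_map_dvd _ _))]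
  rw [key _ _ hb hB hB' hdvd]

namespace IsPres

variable {G : Type*} [Group G] {a b a' b' : G} {m n m' n' : ℕ} {e t e' t' : ℤ}

theorem orderOf_unit_dvd {τ : (ZMod m)ˣ} (h : IsPres a b m n e t)
    (hτ : (τ : ZMod m) = (t : ZMod m)) : orderOf τ ∣ n := by
  rw [orderOf_dvd_iff_pow_eq_one, pow_eq_one_iff_dvd hτ]
  exact h.dvd_pow_sub_one

/-- A factorization satisfying the numerical conditions is minimal, and the invariants of any
other minimal factorization are the same. -/
theorem dataTuple_eq_of_le [Finite G] {τ : (ZMod m)ˣ} {τ' : (ZMod m')ˣ} (h : IsPres a b m n e t)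
    (h' : IsPres a' b' m' n' e' t')
    (hτ : (τ : ZMod m) = (t : ZMod m)) (hτ' : (τ' : ZMod m') = (t' : ZMod m'))
    (hmin : IsMinimalData m n (Int.gcd m e) (invR (Subgroup.zpowers τ))
      (invEps (Subgroup.zpowers τ)) (invO (Subgroup.zpowers τ)))
    (hle : toLex (m', toLex (invR (Subgroup.zpowers τ'), Int.gcd m' e')) ≤
      toLex (m, toLex (invR (Subgroup.zpowers τ), Int.gcd m e))) :
    dataTuple h'.pos_left.ne' (Subgroup.zpowers τ') n' (Int.gcd m' e') =
      dataTuple h.pos_left.ne' (Subgroup.zpowers τ) n (Int.gcd m e) := by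
  have hm := h.pos_left.ne'
  -- choose the generator `b'` so that it acts like `b` on the part of order `m_ν`
  wlog hw : (piPart m (invNu (Subgroup.zpowers τ)) : ℤ) ∣ t' - t generalizing b' e' t' τ'
  · obtain ⟨k, hk, hkt⟩ := h.exists_pow_of_isCoprime h' (piPart_invNu_dvd (Subgroup.zpowers τ))
      (isCoprime_piPart_invNu hm hτ)
    have h'' := h'.pow_right_of_coprime (hk.coprime_dvd_right (orderOf_dvd_natCard b'))
    have hτ'' : ((τ' ^ k : (ZMod m')ˣ) : ZMod m') = ((t' ^ k : ℤ) : ZMod m') := by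
      rw [Units.val_pow_eq_pow_val, hτ', Int.cast_pow]
    have hs : Int.gcd m' (e' * k) = Int.gcd m' e' := by
      rw [← h''.index_right, ← h'.index_right,
        zpowers_pow_of_coprime (hk.coprime_dvd_right (orderOf_dvd_natCard b'))]
    have hT : Subgroup.zpowers (τ' ^ k) = Subgroup.zpowers τ' :=
      zpowers_pow_of_coprime (hk.coprime_dvd_right
        ((h'.orderOf_unit_dvd hτ').trans (h'.card_eq ▸ dvd_mul_left n' m')))
    have := this h'' hτ'' (by rwa [hs, hT]) hkt
    rwa [hs, hT] at this
  rw [Prod.Lex.toLex_le_toLex', Prod.Lex.toLex_le_toLex'] at hle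
  obtain ⟨hle1, hle2⟩ := hle
  obtain rfl : m' = m :=
    hle1.antisymm (Nat.le_of_dvd h'.pos_left (h.dvd_left_of_isMinimalData h' hτ hw hmin))
  obtain ⟨hle3, hle4⟩ := hle2 rfl
  have hr : invR (Subgroup.zpowers τ') = invR (Subgroup.zpowers τ) :=
    hle3.antisymm (Nat.le_of_dvd (Nat.pos_of_ne_zero (invR_ne_zero hm _))
      (h.invR_dvd_of_isMinimalData h' hτ hτ' hw hmin))
  have hs : Int.gcd m' e' = Int.gcd m' e :=
    (hle4 hr).antisymm (Nat.le_of_dvd (Int.gcd_pos_of_ne_zero_left _ (by exact_mod_cast hm))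
      (h.index_dvd_of_isMinimalData h' hτ hτ' hw hmin hr))
  obtain rfl : n' = n := Nat.eq_of_mul_eq_mul_left h.pos_left (h'.card_eq.symm.trans h.card_eq)
  have hε := h.invEps_eq_of_isMinimalData h' hτ hτ' hw hmin hr
  obtain ⟨k, hk, hkt⟩ := h.exists_bracket_dvd h' hτ hw hmin
  rw [hs]
  refine dataTuple_eq hm hτ hτ' (bracket_eq hr hε fun p hp hpr =>
    factorization_invO_eq hm hτ hτ' hw hr hp hpr) (hk.coprime_dvd_right ?_) hkt
  exact (h.orderOf_unit_dvd hτ).trans (h.card_eq ▸ dvd_mul_left n' m')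

end IsPres

namespace MetacyclicFactorization

variable {G : Type*} [Group G] [Finite G]

/-- Generators of the factors, with the data of the factorization expressed through them. -/
theorem exists_isPres_data (F : MetacyclicFactorization G) :
    ∃ (a b : G) (e t : ℤ) (τ : (ZMod (Nat.card F.A))ˣ),
      IsPres a b (Nat.card F.A) F.A.index e t ∧
      (τ : ZMod (Nat.card F.A)) = (t : ZMod (Nat.card F.A)) ∧
      actionUnits F.A = Subgroup.zpowers τ ∧ F.B.index = Int.gcd (Nat.card F.A) e ∧
      Subgroup.zpowers a = F.A ∧ Subgroup.zpowers b = F.B := by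
  obtain ⟨a, ha⟩ := (F.A.isCyclic_iff_exists_zpowers_eq_top).mp F.cyclic_left
  obtain ⟨b, hb⟩ := (F.B.isCyclic_iff_exists_zpowers_eq_top).mp F.cyclic_right
  obtain ⟨e, t, h⟩ := F.exists_isPres ha hb
  obtain ⟨τ, hτ, hT⟩ := h.actionUnits_eq ha
  exact ⟨a, b, e, t, τ, h, hτ, hT, by rw [← hb, h.index_right], ha, hb⟩

/-- The numerical conditions on the factorization `F`. -/
def HasMinimalData (F : MetacyclicFactorization G) : Prop :=
  IsMinimalData (Nat.card F.A) F.A.index F.B.index (invR (actionUnits F.A))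
    (invEps (actionUnits F.A)) (invO (actionUnits F.A))

/-- A factorization that is at most as large as one with minimal data has the same invariants. -/
theorem data_eq_of_key_le {F F' : MetacyclicFactorization G} (hF : F.HasMinimalData)
    (hle : F'.key ≤ F.key) : F'.data = F.data := by
  obtain ⟨a, b, e, t, τ, h, hτ, hT, hs, -, -⟩ := F.exists_isPres_data
  obtain ⟨a', b', e', t', τ', h', hτ', hT', hs', -, -⟩ := F'.exists_isPres_data
  unfold HasMinimalData at hF
  unfold key at hle
  rw [hT, hs] at hF
  rw [hT, hs, hT', hs'] at hle
  have := h.dataTuple_eq_of_le h' hτ hτ' hF hle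
  rw [← hT, ← hT', ← hs, ← hs'] at this
  exact this

end MetacyclicFactorization

/-! ### Modifications of a metacyclic factorization -/

namespace IsPres

variable {G : Type*} [Group G] {a b a' : G} {m n m' n' : ℕ} {e t e' t' : ℤ}

/-- Replacing `b` by `b a ^ z` changes `e` by a multiple of `1 + t + ⋯ + t ^ (n - 1)`. -/
theorem mul_zpow_right (h : IsPres a b m n e t) (z : ℤ) :
    IsPres a (b * a ^ z) m n (e + z * ∑ l ∈ Finset.range n, t ^ l) t := by
  have hpow : ∀ N : ℕ, (b * a ^ z) ^ N = b ^ N * a ^ (z * ∑ l ∈ Finset.range N, t ^ l) := by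
    intro N
    have := mul_zpow_pow h.conj z 1 N
    simpa only [pow_one, one_mul] using this
  refine ⟨h.orderOf_left, ?_, fun j => ?_, ?_, fun g => ?_⟩
  · have h1 : (b * a ^ z)⁻¹ * a * (b * a ^ z) = (a ^ z)⁻¹ * (b⁻¹ * a * b) * a ^ z := by group
    rw [h1, h.conj, ← zpow_neg, ← zpow_add, ← zpow_add]
    congr 1
    ring
  · rw [hpow, ← h.mem_iff]
    exact Subgroup.mul_mem_cancel_right _ (Subgroup.zpow_mem _ (Subgroup.mem_zpowers a) _)
  · rw [hpow, h.pow_right, ← zpow_add]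
  · obtain ⟨j, i, rfl⟩ := h.gen g
    refine ⟨j, i - z * ∑ l ∈ Finset.range j, t ^ l, ?_⟩
    rw [hpow, mul_assoc, ← zpow_add]
    congr 2
    ring

/-- A subgroup containing the commutator subgroup is normal. -/
theorem normal_of_zpow_mem (h : IsPres a b m n e t)
    (h1 : a ^ (t - 1) ∈ Subgroup.zpowers a') : (Subgroup.zpowers a').Normal := by
  have h2 : commutator G ≤ Subgroup.zpowers a' := by
    rw [h.commutator_eq]
    exact Subgroup.zpowers_le.mpr h1
  refine ⟨fun x hx g => ?_⟩
  have h3 : g * x * g⁻¹ = ⁅g, x⁆ * x := by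
    rw [commutatorElement_def]
    group
  rw [h3]
  exact Subgroup.mul_mem _
    (h2 (Subgroup.commutator_mem_commutator (Subgroup.mem_top _) (Subgroup.mem_top _))) hx

/-- A cyclic subgroup `⟨a'⟩` containing the commutator subgroup and supplementing `⟨b⟩` is the
left factor of a metacyclic factorization. -/
theorem exists_of_zpow_mem [Finite G] (h : IsPres a b m n e t)
    (h1 : a ^ (t - 1) ∈ Subgroup.zpowers a') {k : ℤ} (h2 : b ^ k * a ∈ Subgroup.zpowers a') :
    ∃ n' e' t', IsPres a' b (orderOf a') n' e' t' := by
  have hN := h.normal_of_zpow_mem h1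
  obtain ⟨e', t', h'⟩ := exists_isPres_of_gen (b := b) hN fun g => by
    obtain ⟨j, i, rfl⟩ := h.gen g
    have hQ : (a : G ⧸ Subgroup.zpowers a') = ((b ^ (-k) : G) : G ⧸ Subgroup.zpowers a') := by
      rw [eq_comm, QuotientGroup.eq, zpow_neg, inv_inv]
      exact h2
    obtain ⟨l, hl⟩ := (isOfFinOrder_of_finite b).mem_powers_iff_mem_zpowers.mpr
      (Subgroup.zpow_mem _ (Subgroup.mem_zpowers b) (j + -k * i))
    have hl' : b ^ l = b ^ (j + -k * i) := hl
    have h3 : ((b ^ l : G) : G ⧸ Subgroup.zpowers a') =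
        ((b ^ j * a ^ i : G) : G ⧸ Subgroup.zpowers a') := by
      rw [hl', QuotientGroup.mk_mul, QuotientGroup.mk_zpow _ a i, hQ, ← QuotientGroup.mk_zpow,
        ← QuotientGroup.mk_mul, zpow_add, zpow_natCast, zpow_mul]
    rw [QuotientGroup.eq] at h3
    obtain ⟨i', hi'⟩ := Subgroup.mem_zpowers_iff.mp h3
    exact ⟨l, i', by rw [hi', mul_inv_cancel_left]⟩
  exact ⟨_, e', t', h'⟩

/-- If `b ^ J` centralizes the subgroup `⟨a ^ q⟩` of order `u`, then so does `b ^ J a ^ (u x)`. -/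
theorem commute_modification (h : IsPres a b m n e t) {q u J : ℕ} (x : ℤ) (hm : m = q * u)
    (hJ : (u : ℤ) ∣ t ^ J - 1) : Commute (a ^ q) (b ^ J * a ^ (u * x)) := by
  refine Commute.mul_right ?_ (((Commute.refl a).pow_left q).zpow_right _)
  rw [Commute, SemiconjBy, ← zpow_natCast a q, zpow_mul_pow h.conj, mul_right_inj,
    h.zpow_eq_zpow_iff, hm]
  obtain ⟨c, hc⟩ := hJ
  push_cast
  exact ⟨-c, by linear_combination -q * hc⟩

/-- The modification `a' = a ^ q · b ^ J a ^ (u x)` of the generator `a`, where `m = q u` with `q`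
and `u` coprime, `a ^ q` has order `u` and `b ^ J a ^ (u x)` has order dividing `q`. -/
theorem exists_modification [Finite G] (h : IsPres a b m n e t) {q u J : ℕ} {x : ℤ}
    (hm : m = q * u) (hqu : q.Coprime u) (hx : IsCoprime (q : ℤ) x) (hJ : (u : ℤ) ∣ t ^ J - 1)
    (hc : (b ^ J * a ^ (u * x)) ^ q = 1)
    (hcomm : a ^ (u * (t - 1)) ∈ Subgroup.zpowers (b ^ J * a ^ (u * x))) :
    ∃ n' e' t', IsPres (a ^ q * (b ^ J * a ^ (u * x))) b
      (orderOf (a ^ q * (b ^ J * a ^ (u * x)))) n' e' t' := by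
  have hac := h.commute_modification x hm hJ
  set c := b ^ J * a ^ (u * x) with hcdef
  set A := Subgroup.zpowers (a ^ q * c) with hA
  have hquZ : IsCoprime (q : ℤ) u := Nat.isCoprime_iff_coprime.mpr hqu
  obtain ⟨α, β, hαβ⟩ := hquZ
  have hmem : a ^ q ∈ A := by
    refine Subgroup.mem_zpowers_iff.mpr ⟨q * α, ?_⟩
    rw [zpow_mul, zpow_natCast, hac.mul_pow, hc, mul_one, ← zpow_natCast, ← zpow_natCast,
      ← zpow_mul, ← zpow_mul, h.zpow_eq_zpow_iff, hm]
    push_cast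
    exact ⟨β, by linear_combination -(q : ℤ) * hαβ⟩
  have hcA : c ∈ A := by
    have : c = (a ^ q)⁻¹ * (a ^ q * c) := by group
    rw [this]
    exact A.mul_mem (A.inv_mem hmem) (Subgroup.mem_zpowers _)
  have h1 : a ^ (t - 1) ∈ A := by
    have : a ^ (t - 1) = (a ^ q) ^ (α * (t - 1)) * (a ^ (u * (t - 1))) ^ β := by
      rw [← zpow_natCast a q, ← zpow_mul, ← zpow_mul, ← zpow_add]
      congr 1
      linear_combination -(t - 1) * hαβ
    rw [this]
    exact A.mul_mem (A.zpow_mem hmem _)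
      (A.zpow_mem (Subgroup.zpowers_le.mpr hcA hcomm) _)
  have hN : A.Normal := h.normal_of_zpow_mem h1
  obtain ⟨γ, δ, hγδ⟩ := IsCoprime.mul_right ⟨α, β, hαβ⟩ hx
  refine h.exists_of_zpow_mem h1 (k := J * δ) ?_
  rw [← hA, ← QuotientGroup.eq_one_iff, QuotientGroup.mk_mul]
  have e1 : a = (a ^ (u * x : ℤ)) ^ δ * (a ^ q) ^ γ := by
    rw [← zpow_natCast a q, ← zpow_mul, ← zpow_mul, ← zpow_add]
    conv_lhs => rw [← zpow_one a]
    congr 1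
    linear_combination -hγδ
  have e2 : a ^ (u * x : ℤ) = (b ^ J)⁻¹ * c := by rw [hcdef]; group
  have e3 : (a : G ⧸ A) = ((b ^ J : G) : G ⧸ A)⁻¹ ^ δ := by
    conv_lhs => rw [e1, e2]
    rw [QuotientGroup.mk_mul, QuotientGroup.mk_zpow, QuotientGroup.mk_mul,
      (QuotientGroup.eq_one_iff c).mpr hcA, (QuotientGroup.eq_one_iff _).mpr (A.zpow_mem hmem γ),
      mul_one, mul_one, QuotientGroup.mk_inv]
  rw [e3, zpow_mul, zpow_natCast, QuotientGroup.mk_zpow, inv_zpow, mul_inv_cancel]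

/-- The action of `b` on the modified generator. -/
theorem modification_conj (h : IsPres a b m n e t) {q u J : ℕ} {x : ℤ}
    (hm : m = q * u) (hqu : q.Coprime u) (hm0 : m ≠ 0) (hJ : (u : ℤ) ∣ t ^ J - 1)
    (hc : (b ^ J * a ^ (u * x)) ^ q = 1)
    (h' : IsPres (a ^ q * (b ^ J * a ^ (u * x))) b m' n' e' t') :
    (u : ℤ) ∣ t' - t ∧ b ^ J * a ^ (u * x * t) = (b ^ J * a ^ (u * x)) ^ t' := by
  have hac := h.commute_modification x hm hJ
  have hq0 : (q : ℤ) ≠ 0 := by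
    rintro h0
    exact hm0 (by rw [hm]; simp [Nat.cast_eq_zero.mp h0])
  have hquZ : IsCoprime (q : ℤ) u := Nat.isCoprime_iff_coprime.mpr hqu
  have hconj : b⁻¹ * (b ^ J * a ^ (u * x)) * b = b ^ J * a ^ (u * x * t) := by
    have : b⁻¹ * (b ^ J * a ^ (u * x)) * b = b ^ J * (b⁻¹ * a ^ (u * x) * b) := by
      rw [← mul_assoc, ((Commute.refl b).pow_right J).inv_left.eq]; simp only [mul_assoc]
    rw [this, inv_mul_zpow_mul h.conj, mul_comm t]
  have hut : (u : ℤ) ∣ t' - t := by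
    have h1 := inv_mul_zpow_mul h'.conj q
    rw [mul_comm t', zpow_mul (a ^ q * (b ^ J * a ^ (u * x : ℤ))), zpow_natCast, hac.mul_pow,
      hc, mul_one, ← pow_mul, ← zpow_natCast,
      inv_mul_zpow_mul h.conj, ← zpow_mul, h.zpow_eq_zpow_iff, hm] at h1
    have h2 : (q : ℤ) * u ∣ q * (q * (t' - t)) := by
      push_cast at h1
      convert h1 using 1
      ring
    exact hquZ.symm.dvd_of_dvd_mul_left (Int.dvd_of_mul_dvd_mul_left hq0 h2)
  refine ⟨hut, ?_⟩
  have h1 := h'.conj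
  have h2 : b⁻¹ * (a ^ q * (b ^ J * a ^ (u * x))) * b =
      (b⁻¹ * a ^ (q : ℤ) * b) * (b⁻¹ * (b ^ J * a ^ (u * x)) * b) := by
    rw [zpow_natCast]; group
  have h3 : a ^ (t * q) = (a ^ q) ^ t' := by
    rw [← zpow_natCast a q, ← zpow_mul, h.zpow_eq_zpow_iff, hm]
    obtain ⟨c, hc⟩ := hut
    push_cast
    exact ⟨c, by linear_combination (q : ℤ) * hc⟩
  rw [h2, hconj, inv_mul_zpow_mul h.conj, hac.mul_zpow, h3, mul_right_inj] at h1
  exact h1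

end IsPres

/-! ### The numerical conditions hold for minimal factorizations -/

/-- The triple `(m, r, s)` is minimal among those of the metacyclic factorizations of `G`. -/
def IsMinimalTriple (G : Type*) [Group G] (m r s : ℕ) : Prop :=
  ∀ ⦃a b : G⦄ ⦃m' n' : ℕ⦄ ⦃e' t' : ℤ⦄ ⦃τ' : (ZMod m')ˣ⦄, IsPres a b m' n' e' t' →
    (τ' : ZMod m') = (t' : ZMod m') →
    toLex (m, toLex (r, s)) ≤ toLex (m', toLex (invR (Subgroup.zpowers τ'), Int.gcd m' e'))

theorem gcd_pow_factorization {m p : ℕ} (hm : m ≠ 0) (hp : p.Prime) (e : ℤ) :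
    Int.gcd (p ^ m.factorization p : ℕ) e = p ^ (Int.gcd m e).factorization p := by
  have hs : Int.gcd m e ≠ 0 := Int.gcd_ne_zero_left (by exact_mod_cast hm)
  refine gcd_eq_pow_of hp ?_ ?_ fun i hi hie => ?_
  · exact (Nat.factorization_le_iff_dvd hs hm).mpr
      (Int.natCast_dvd_natCast.mp (Int.gcd_dvd_left ..)) p
  · have h1 : ((p ^ (Int.gcd m e).factorization p : ℕ) : ℤ) ∣ e :=
      (Int.natCast_dvd_natCast.mpr (Nat.ordProj_dvd _ p)).trans (Int.gcd_dvd_right ..)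
    exact_mod_cast h1
  · rw [← hp.pow_dvd_iff_le_factorization hs]
    refine Int.natCast_dvd_natCast.mp (Int.dvd_coe_gcd ?_ (by exact_mod_cast hie))
    exact Int.natCast_dvd_natCast.mpr ((hp.pow_dvd_iff_le_factorization hm).mpr hi)

namespace IsPres

variable {G : Type*} [Group G] [Finite G] {a b : G} {m n p : ℕ} {e t : ℤ} {τ : (ZMod m)ˣ}

theorem exists_unit (h : IsPres a b m n e t) : ∃ τ : (ZMod m)ˣ, (τ : ZMod m) = (t : ZMod m) :=
  (ZMod.coe_int_isUnit_iff_isCoprime t m).mpr (h.isCoprime h.pos_right.ne')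

omit [Finite G] in
/-- If some power of `c` generates the subgroup of `⟨a ^ u⟩` of index `p ^ j` and `p ^ j ∣ t - 1`,
then `⟨c⟩` contains the `p`-part of the commutator subgroup. -/
theorem zpow_mem_zpowers_of_pow_eq (h : IsPres a b m n e t) {c : G} {u i j μ : ℕ} {f : ℤ}
    (hm : m = p ^ μ * u) (hpow : c ^ p ^ i = a ^ (u * p ^ j * f : ℤ)) (hf : IsCoprime (p : ℤ) f)
    (hj : (p : ℤ) ^ j ∣ t - 1) : a ^ (u * (t - 1)) ∈ Subgroup.zpowers c := by
  obtain ⟨g, hg⟩ := hj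
  obtain ⟨δ, γ, hγ⟩ := hf.pow_left (m := μ)
  refine Subgroup.mem_zpowers_iff.mpr ⟨(p ^ i : ℕ) * (g * γ), ?_⟩
  rw [zpow_mul, zpow_natCast, hpow, ← zpow_mul, h.zpow_eq_zpow_iff, hm]
  push_cast
  refine ⟨δ * p ^ j * g, ?_⟩
  rw [hg]
  linear_combination -(u : ℤ) * p ^ j * g * hγ

omit [Finite G] in
theorem pow_eq_one_of_pow_eq (h : IsPres a b m n e t) {c : G} {u i j μ k : ℕ} {f : ℤ}
    (hm : m = p ^ μ * u) (hpow : c ^ p ^ i = a ^ (u * p ^ j * f : ℤ)) (hk : μ ≤ j + k) :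
    c ^ p ^ (i + k) = 1 := by
  rw [pow_add, pow_mul, hpow, ← zpow_natCast, ← zpow_mul, h.zpow_eq_one_iff, hm]
  push_cast
  have h1 : (p : ℤ) ^ μ ∣ p ^ j * p ^ k := by
    rw [← pow_add]
    exact pow_dvd_pow _ hk
  obtain ⟨w, hw⟩ := h1
  exact ⟨w * f, by linear_combination (u : ℤ) * f * hw⟩

/-- For a suitable exponent `J`, the element `b ^ J` centralizes the `p'`-part of `⟨a⟩`. -/
theorem ordCompl_dvd_pow_sub_one (h : IsPres a b m n e t) (hτ : (τ : ZMod m) = (t : ZMod m))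
    (hp : p.Prime) (hpr : p ∣ invR (Subgroup.zpowers τ)) {k : ℕ}
    (hk : (invO (Subgroup.zpowers τ)).factorization p ≤ k) :
    ((m / p ^ m.factorization p : ℕ) : ℤ) ∣
      t ^ (p ^ k * (n / p ^ n.factorization p) * (m / p ^ m.factorization p)) - 1 := by
  have hm := h.pos_left.ne'
  set u := m / p ^ m.factorization p with hu
  have hum : u ∣ m := Nat.ordCompl_dvd m p
  have hpν : p ∉ invNu (Subgroup.zpowers τ) := fun hν => ((mem_invNu_iff hm _).mp hν).2.2 hpr
  obtain ⟨d, hd0, hd, hdo⟩ := factorization_invO hm hτ hp hpν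
  have hdn : d ∣ n := (hd n).mpr
    ((Int.natCast_dvd_natCast.mpr (piPart_invNu_dvd _)).trans h.dvd_pow_sub_one)
  have hdJ : d ∣ p ^ k * (n / p ^ n.factorization p) := by
    refine dvd_of_forall_prime_pow_dvd fun q i hq hqi => ?_
    rcases eq_or_ne q p with rfl | hqp
    · have hi := (hq.pow_dvd_iff_le_factorization hd0).mp hqi
      exact (pow_dvd_pow q (by omega)).trans (dvd_mul_right _ _)
    · have h1 : q ^ i ∣ p ^ n.factorization p * (n / p ^ n.factorization p) := by
        rw [Nat.ordProj_mul_ordCompl_eq_self]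
        exact hqi.trans hdn
      exact ((Nat.Coprime.pow _ _ ((Nat.coprime_primes hq hp).mpr hqp)).dvd_of_dvd_mul_left
        h1).trans (dvd_mul_left _ _)
  refine Int.natCast_dvd.mpr (dvd_of_forall_prime_pow_dvd fun q i hq hqi => ?_)
  rw [← Int.natCast_dvd]
  push_cast
  rcases Nat.eq_zero_or_pos i with rfl | hi
  · simp
  have hqm : q ∣ m := ((dvd_pow_self q hi.ne').trans hqi).trans hum
  by_cases hqr : q ∣ invR (Subgroup.zpowers τ)
  · have := pow_dvd_pow_sub_one (ρ := 1) one_ne_zero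
      (by simpa using dvd_sub_one_of_dvd_invR hm hτ hq hqr)
      (hqi.trans (dvd_mul_left u (p ^ k * (n / p ^ n.factorization p))))
    exact (pow_dvd_pow _ (by omega)).trans this
  · have hqν : q ∈ invNu (Subgroup.zpowers τ) := (mem_invNu_iff hm _).mpr ⟨hq, hqm, hqr⟩
    have h1 : q ^ i ∣ piPart m (invNu (Subgroup.zpowers τ)) := by
      have h0 : piPart m (invNu (Subgroup.zpowers τ)) ≠ 0 :=
        ne_zero_of_dvd_ne_zero hm (piPart_invNu_dvd _)
      rw [hq.pow_dvd_iff_le_factorization h0,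
        factorization_piPart m (ν := invNu (Subgroup.zpowers τ)) Finset.sdiff_subset, if_pos hqν,
        ← hq.pow_dvd_iff_le_factorization hm]
      exact hqi.trans hum
    have h2 := (hd _).mp (hdJ.trans (dvd_mul_right _ u))
    exact (by exact_mod_cast Int.natCast_dvd_natCast.mpr h1 : (q : ℤ) ^ i ∣ _).trans h2

section Minimal

variable (hG : IsMinimalTriple G m (invR (Subgroup.zpowers τ)) (Int.gcd m e))
include hG

/-- Otherwise some `b a ^ z` would generate a right factor of smaller index. -/
theorem index_dvd_geomSum (h : IsPres a b m n e t) (hτ : (τ : ZMod m) = (t : ZMod m)) :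
    (Int.gcd m e : ℤ) ∣ ∑ l ∈ Finset.range n, t ^ l := by
  by_contra hcon
  obtain ⟨z, hz⟩ := exists_gcd_add_mul_lt h.pos_left.ne' hcon
  have := hG (h.mul_zpow_right z) hτ
  rw [Prod.Lex.toLex_le_toLex', Prod.Lex.toLex_le_toLex'] at this
  exact absurd ((this.2 rfl).2 rfl) (not_le.mpr hz)

end Minimal

theorem four_dvd_sub_one_of_invEps (h : IsPres a b m n e t) (hτ : (τ : ZMod m) = (t : ZMod m))
    (hε : invEps (Subgroup.zpowers τ) = 1) (hμ : 2 ≤ m.factorization 2) : (4 : ℤ) ∣ t - 1 := by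
  have hm := h.pos_left.ne'
  have hodd : ¬ (2 : ℤ) ∣ t := by
    intro h2
    have h3 : (2 : ℤ) ∣ m := by
      exact_mod_cast Nat.dvd_of_factorization_pos (by omega : m.factorization 2 ≠ 0)
    have := (h.isCoprime h.pos_right.ne').isUnit_of_dvd' h3 h2
    rw [Int.isUnit_iff] at this
    omega
  have hρ : 2 ≤ (invR (Subgroup.zpowers τ)).factorization 2 := by
    rw [le_factorization_invR_iff hm hτ Nat.prime_two]
    refine ⟨hμ, ?_⟩
    unfold IsTrivialAt
    norm_num
    omega
  exact (pow_dvd_pow (2 : ℤ) hρ).trans ((invEps_eq_one_iff hm hτ).mp hε)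

section Pos

variable (h : IsPres a b m n e t) (hτ : (τ : ZMod m) = (t : ZMod m)) (hp : p.Prime)
  (hε : invEps (Subgroup.zpowers τ) ^ (p - 1) = 1)
include h hτ hp hε

theorem pow_invR_dvd_sub_one :
    (p : ℤ) ^ (invR (Subgroup.zpowers τ)).factorization p ∣ t - 1 :=
  pow_dvd_of_gcd_eq (gcd_sub_one_eq_of_invEps h.pos_left.ne' hτ hp hε)

/-- `m` divides `e (t - 1)`. -/
theorem exponent_left_le : m.factorization p ≤
    (Int.gcd m e).factorization p + (invR (Subgroup.zpowers τ)).factorization p := by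
  have hm := h.pos_left.ne'
  by_contra hlt
  have hσ := gcd_pow_factorization hm hp e
  have hρ := gcd_sub_one_eq_of_invEps hm hτ hp hε
  have h1 : ¬ (p : ℤ) ^ ((Int.gcd m e).factorization p + 1) ∣ e := fun h1 => by
    have := le_of_pow_dvd_of_gcd_eq hp hσ (by omega) h1
    omega
  have h2 : ¬ (p : ℤ) ^ ((invR (Subgroup.zpowers τ)).factorization p + 1) ∣ t - 1 := fun h1 => by
    have := le_of_pow_dvd_of_gcd_eq hp hρ (by omega) h1
    omega
  refine not_pow_succ_dvd_mul hp h1 h2 ?_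
  have h3 : ((p ^ m.factorization p : ℕ) : ℤ) ∣ m :=
    Int.natCast_dvd_natCast.mpr (Nat.ordProj_dvd m p)
  push_cast at h3
  exact (pow_dvd_pow _ (by omega)).trans (h3.trans h.dvd_mul_sub_one)

/-- `s` divides `1 + t + ⋯ + t ^ (n - 1)`, which has the same `p`-part as `n`. -/
theorem exponent_index_le (hpr : p ∣ invR (Subgroup.zpowers τ))
    (hG : IsMinimalTriple G m (invR (Subgroup.zpowers τ)) (Int.gcd m e)) :
    (Int.gcd m e).factorization p ≤ n.factorization p := by
  have hm := h.pos_left.ne'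
  have hσ := le_of_gcd_eq hp (gcd_pow_factorization hm hp e)
  have hpt := dvd_sub_one_of_dvd_invR hm hτ hp hpr
  have h1 : ((p ^ (Int.gcd m e).factorization p : ℕ) : ℤ) ∣ ∑ l ∈ Finset.range n, t ^ l :=
    (Int.natCast_dvd_natCast.mpr (Nat.ordProj_dvd _ p)).trans (h.index_dvd_geomSum hG hτ)
  rw [← hp.pow_dvd_iff_le_factorization h.pos_right.ne']
  by_cases h4 : p = 2 ∧ m.factorization 2 ≤ 1
  -- if `m_2 ≤ 2`, then `t` may be `-1` modulo `4`, but only the sum modulo `2` matters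
  · obtain ⟨rfl, h4⟩ := h4
    have h2 := dvd_geomSum_sub hpt n
    have h3 : ((2 ^ (Int.gcd m e).factorization 2 : ℕ) : ℤ) ∣ (2 : ℕ) :=
      Int.natCast_dvd_natCast.mpr ((pow_dvd_pow 2 (hσ.trans h4)).trans (by norm_num))
    have h5 := dvd_sub h1 (h3.trans h2)
    rw [sub_sub_cancel] at h5
    exact Int.natCast_dvd_natCast.mp h5
  · refine (pow_dvd_geomSum_iff hp hpt ?_ _ _).mp (by exact_mod_cast h1)
    rintro rfl
    exact h.four_dvd_sub_one_of_invEps hτ (by simpa using hε) (by omega)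

end Pos

end IsPres

theorem pow_sub_mul_ordCompl_mul {p n k : ℕ} (u : ℕ) (hk : k ≤ n.factorization p) :
    p ^ (n.factorization p - k) * (n / p ^ n.factorization p) * u * p ^ k = n * u := by
  have h1 : p ^ (n.factorization p - k) * (n / p ^ n.factorization p) * u * p ^ k =
    p ^ (n.factorization p - k) * p ^ k * (n / p ^ n.factorization p) * u := by ring
  rw [h1, ← pow_add, Nat.sub_add_cancel hk, Nat.ordProj_mul_ordCompl_eq_self]

namespace IsPres

variable {G : Type*} [Group G] [Finite G] {a b : G} {m n p : ℕ} {e t : ℤ} {τ : (ZMod m)ˣ}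

omit [Finite G] in
theorem modification_pow (h : IsPres a b m n e t) {J N u : ℕ} (x : ℤ) (hJ : J * N = n * u) :
    (b ^ J * a ^ (u * x)) ^ N =
      a ^ (u * (e + x * ∑ l ∈ Finset.range N, (t ^ J) ^ l)) := by
  rw [mul_zpow_pow h.conj, hJ, pow_mul, h.pow_right, ← zpow_natCast, ← zpow_mul, ← zpow_add]
  congr 1
  ring

/-- If `s_p < r_p` and `s_p o_p ≤ n_p`, then `b ^ J` with `J = (n / s_p) · (m / m_p)` centralizes
the `p'`-part of `⟨a⟩` and, for suitable `x`, the corresponding modification of `a` has order at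
most `m / p`. -/
theorem exponent_index_lt (h : IsPres a b m n e t) (hτ : (τ : ZMod m) = (t : ZMod m))
    (hp : p.Prime) (hε : invEps (Subgroup.zpowers τ) ^ (p - 1) = 1)
    (hpr : p ∣ invR (Subgroup.zpowers τ))
    (hG : IsMinimalTriple G m (invR (Subgroup.zpowers τ)) (Int.gcd m e))
    (hσρ : (Int.gcd m e).factorization p < (invR (Subgroup.zpowers τ)).factorization p) :
    n.factorization p <
      (Int.gcd m e).factorization p + (invO (Subgroup.zpowers τ)).factorization p := by
  have hm := h.pos_left.ne'
  by_contra hlt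
  push Not at hlt
  have hρt := h.pow_invR_dvd_sub_one hτ hp hε
  have hρμ := factorization_invR_le hm (Subgroup.zpowers τ) p
  have hgcd := gcd_pow_factorization hm hp e
  have hJ := h.ordCompl_dvd_pow_sub_one hτ hp hpr
    (k := n.factorization p - (Int.gcd m e).factorization p) (by omega)
  set σ := (Int.gcd m e).factorization p with hσdef
  set ρ := (invR (Subgroup.zpowers τ)).factorization p with hρdef
  set μ := m.factorization p with hμdef
  set η := n.factorization p with hηdef
  set u := m / p ^ μ with hu
  set J := p ^ (η - σ) * (n / p ^ η) * u with hJdef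
  have hmu : m = p ^ μ * u := (Nat.ordProj_mul_ordCompl_eq_self m p).symm
  have hu0 : 0 < u := Nat.pos_of_ne_zero fun h0 => hm (by rw [hmu, h0, mul_zero])
  have hqu : (p ^ μ).Coprime u := (Nat.coprime_ordCompl hp hm).pow_left _
  have hJn : J * p ^ σ = n * u := pow_sub_mul_ordCompl_mul u (by omega)
  -- the geometric sum `W` is `p ^ σ` times an integer prime to `p`
  set W := ∑ l ∈ Finset.range (p ^ σ), (t ^ J) ^ l with hW
  have hpt := dvd_sub_one_of_dvd_invR hm hτ hp hpr
  have hWdvd : (p : ℤ) ^ σ ∣ W := pow_dvd_geomSum (_root_.dvd_pow_sub_one hpt J) σ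
  have hWnot : ¬ (p : ℤ) ^ (σ + 1) ∣ W := by
    rcases Nat.eq_zero_or_pos σ with h0 | h0
    · rw [hW, h0]
      simp only [pow_zero, Finset.range_one, Finset.sum_singleton, zero_add, pow_one]
      intro h1
      exact (Nat.prime_iff_prime_int.mp hp).not_dvd_one h1
    · rw [hW, pow_dvd_geomSum_iff hp (_root_.dvd_pow_sub_one hpt J),
        Nat.pow_dvd_pow_iff_le_right hp.one_lt]
      · omega
      · rintro rfl
        refine _root_.dvd_pow_sub_one ((pow_dvd_pow (2 : ℤ) (by omega : 2 ≤ ρ)).trans hρt) J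
  obtain ⟨w, hw⟩ := hWdvd
  have hpw : IsCoprime (p : ℤ) w := by
    rw [(Nat.prime_iff_prime_int.mp hp).coprime_iff_not_dvd]
    rintro ⟨v, hv⟩
    exact hWnot ⟨v, by rw [hw, hv]; ring⟩
  obtain ⟨e₁, he₁⟩ := pow_dvd_of_gcd_eq hgcd
  have hpe : ¬ (p : ℤ) ∣ e₁ := by
    rintro ⟨v, hv⟩
    have := le_of_pow_dvd_of_gcd_eq hp hgcd (i := σ + 1) (by omega)
      ⟨v, by rw [he₁, hv]; ring⟩
    omega
  obtain ⟨β, α, hαβ⟩ := hpw.pow_left (m := 2)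
  -- `x` is chosen so that `e + x W` is `p ^ (σ + 1)` times an integer prime to `p`
  set x := α * (p - e₁) with hx
  set f := 1 - β * p * (p - e₁) with hf
  have hexW : e + x * W = p ^ (σ + 1) * f := by
    rw [he₁, hw, hx, hf]
    linear_combination (p : ℤ) ^ σ * (p - e₁) * hαβ
  have hpx : IsCoprime (p : ℤ) x := by
    refine IsCoprime.mul_right ⟨β * p, w, by linear_combination hαβ⟩ ?_
    rw [(Nat.prime_iff_prime_int.mp hp).coprime_iff_not_dvd, dvd_sub_right dvd_rfl]
    exact hpe
  have hpf : IsCoprime (p : ℤ) f := ⟨β * (p - e₁), 1, by rw [hf]; ring⟩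
  have hpow : (b ^ J * a ^ (u * x)) ^ p ^ σ = a ^ (u * p ^ (σ + 1) * f : ℤ) := by
    rw [h.modification_pow x hJn, ← hW, hexW, mul_assoc]
  have hcomm := h.zpow_mem_zpowers_of_pow_eq hmu hpow hpf
    ((pow_dvd_pow _ (by omega : σ + 1 ≤ ρ)).trans hρt)
  have hone := h.pow_eq_one_of_pow_eq hmu hpow (k := μ - 1 - σ) (by omega)
  rw [show σ + (μ - 1 - σ) = μ - 1 by omega] at hone
  have hqq : p ^ μ = p ^ (μ - 1) * p := by rw [← pow_succ, Nat.sub_add_cancel (by omega)]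
  obtain ⟨n', e', t', h'⟩ := h.exists_modification hmu hqu
    (by push_cast; exact hpx.pow_left) hJ (by rw [hqq, pow_mul, hone, one_pow]) hcomm
  have hord : orderOf (a ^ p ^ μ * (b ^ J * a ^ (u * x))) ∣ u * p ^ (μ - 1) := by
    rw [orderOf_dvd_iff_pow_eq_one, (h.commute_modification x hmu hJ).mul_pow,
      pow_mul' (b ^ J * a ^ (u * x : ℤ)), hone, one_pow, mul_one, ← pow_mul,
      ← orderOf_dvd_iff_pow_eq_one, h.orderOf_left]
    conv_lhs => rw [hmu]
    exact ⟨p ^ (μ - 1), by ring⟩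
  obtain ⟨τ', hτ'⟩ := h'.exists_unit
  have hle := hG h' hτ'
  rw [Prod.Lex.toLex_le_toLex'] at hle
  have h1 := hle.1.trans (Nat.le_of_dvd (by positivity [hp.pos]) hord)
  have h2 : u * p ^ (μ - 1) < m := by
    conv_rhs => rw [hmu, hqq]
    have h3 : 0 < u * p ^ (μ - 1) := Nat.mul_pos hu0 (Nat.pow_pos hp.pos)
    calc u * p ^ (μ - 1) < u * p ^ (μ - 1) * p := lt_mul_of_one_lt_right h3 hp.one_lt
      _ = _ := by ring
  omega

section Neg

variable (h : IsPres a b m n e t) (hτ : (τ : ZMod m) = (t : ZMod m))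
  (hε : invEps (Subgroup.zpowers τ) = -1)
include h hτ hε

/-- These inequalities hold for every factorization with `ε = -1`. -/
theorem exponent_of_invEps :
    n.factorization 2 ≠ 0 ∧
    m.factorization 2 ≤ n.factorization 2 + (invR (Subgroup.zpowers τ)).factorization 2 ∧
      m.factorization 2 ≤ (Int.gcd m e).factorization 2 + 1 := by
  have hm := h.pos_left.ne'
  obtain ⟨hρ2, ht4, hρ⟩ := gcd_add_one_eq_of_invEps hm hτ hε
  have hμ2 := hρ2.trans (factorization_invR_le hm _ 2)
  obtain ⟨P, _, _, α, β, α', β', e₂, e₂', y, j, x, z, h₁, -, hσ, -⟩ :=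
    h.exists_pGroup_exponents h hτ (by simp) Nat.prime_two
      (Nat.dvd_of_factorization_pos (by omega))
  refine ⟨h₁.ne_zero_of_neg hμ2 ht4, ?_, h₁.le_succ_of_neg ht4 hσ⟩
  rw [add_comm]
  exact h₁.le_add_of_neg hμ2 ht4 hρ

/-- Minimality of `s` makes `s_2` divide `1 + t + ⋯ + t ^ (n - 1)`, whose `2`-part is `n_2 r_2 / 2`
if `r_2 < m_2`, as is the case when `s_2 = n_2 r_2` with `n` even. -/
theorem exponent_index_ne
    (hG : IsMinimalTriple G m (invR (Subgroup.zpowers τ)) (Int.gcd m e)) :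
    (Int.gcd m e).factorization 2 ≠
      n.factorization 2 + (invR (Subgroup.zpowers τ)).factorization 2 := by
  intro heq
  have hm := h.pos_left.ne'
  obtain ⟨hη, -, -⟩ := h.exponent_of_invEps hτ hε
  obtain ⟨hρ2, ht4, hρ⟩ := gcd_add_one_eq_of_invEps hm hτ hε
  have hσ := le_of_gcd_eq Nat.prime_two (gcd_pow_factorization hm Nat.prime_two e)
  obtain ⟨N, hN⟩ : 2 ∣ n := Nat.dvd_of_factorization_pos hη
  have hN0 : N ≠ 0 := by rintro rfl; exact h.pos_right.ne' hN
  have hNη : n.factorization 2 = N.factorization 2 + 1 := by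
    rw [hN, Nat.factorization_mul two_ne_zero hN0, Finsupp.add_apply,
      Nat.prime_two.factorization_self, add_comm]
  have h1 : ¬ (2 : ℤ) ^ ((invR (Subgroup.zpowers τ)).factorization 2 + 1) ∣ t + 1 := fun h1 => by
    have := le_of_pow_dvd_of_gcd_eq Nat.prime_two hρ
      (i := (invR (Subgroup.zpowers τ)).factorization 2 + 1) (by omega) h1
    omega
  refine not_two_pow_dvd_geomSum ht4 h1 (k := N.factorization 2) (N := N)
    (Nat.pow_succ_factorization_not_dvd hN0 Nat.prime_two) ?_
  rw [← hN]
  refine Dvd.dvd.trans ?_ (h.index_dvd_geomSum hG hτ)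
  have h2 := Int.natCast_dvd_natCast.mpr (Nat.ordProj_dvd (Int.gcd m e) 2)
  rw [heq, hNη] at h2
  push_cast at h2
  refine Dvd.dvd.trans (pow_dvd_pow _ ?_) h2
  omega

/-- If `s_2 < r_2`, then `r_2 = m_2` and `s_2 = m_2 / 2`, and the modification of `a` with `J = (n
/ 2) · (m / m_2)` and `x = 1` has order at most `m`, but `b` acts on its `2`-part as `-1 + m_2 /
2`, which gives a smaller `r`. -/
theorem exponent_invR_le (hn : 2 ≤ n.factorization 2) (hm3 : 3 ≤ m.factorization 2)
    (ho : (invO (Subgroup.zpowers τ)).factorization 2 < n.factorization 2)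
    (hG : IsMinimalTriple G m (invR (Subgroup.zpowers τ)) (Int.gcd m e)) :
    (invR (Subgroup.zpowers τ)).factorization 2 ≤ (Int.gcd m e).factorization 2 := by
  have hm := h.pos_left.ne'
  by_contra hlt
  obtain ⟨-, -, hμσ⟩ := h.exponent_of_invEps hτ hε
  obtain ⟨-, ht4, hρ⟩ := gcd_add_one_eq_of_invEps hm hτ hε
  have hρμ := factorization_invR_le hm (Subgroup.zpowers τ) 2
  have hρt := pow_dvd_of_gcd_eq hρ
  have hgcd := gcd_pow_factorization hm Nat.prime_two e
  have hJ := h.ordCompl_dvd_pow_sub_one hτ Nat.prime_two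
    (Nat.dvd_of_factorization_pos (by omega)) (k := n.factorization 2 - 1) (by omega)
  obtain ⟨e₁, he₁⟩ := pow_dvd_of_gcd_eq hgcd
  have hoddE : ¬ (2 : ℤ) ∣ e₁ := by
    rintro ⟨v, hv⟩
    have := le_of_pow_dvd_of_gcd_eq Nat.prime_two hgcd
      (i := (Int.gcd m e).factorization 2 + 1) (by omega)
      ⟨v, by push_cast at he₁ ⊢; linear_combination he₁ + 2 ^ (Int.gcd m e).factorization 2 * hv⟩
    omega
  have hρeq : (invR (Subgroup.zpowers τ)).factorization 2 = m.factorization 2 := by omega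
  have hσeq : (Int.gcd m e).factorization 2 = m.factorization 2 - 1 := by omega
  rw [hρeq] at hρt
  rw [hσeq] at he₁
  set μ := m.factorization 2 with hμdef
  set η := n.factorization 2 with hηdef
  set u := m / 2 ^ μ with hu
  set J := 2 ^ (η - 1) * (n / 2 ^ η) * u with hJdef
  push_cast at he₁ hρt
  have hmu : m = 2 ^ μ * u := (Nat.ordProj_mul_ordCompl_eq_self m 2).symm
  have hqu : (2 ^ μ).Coprime u := (Nat.coprime_ordCompl Nat.prime_two hm).pow_left _
  have hquZ : IsCoprime ((2 : ℤ) ^ μ) u := by exact_mod_cast Nat.isCoprime_iff_coprime.mpr hqu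
  have hu0 : (u : ℤ) ≠ 0 := by
    rintro h0
    exact hm (by rw [hmu, Nat.cast_eq_zero.mp h0, mul_zero])
  have hJn : J * 2 ^ 1 = n * u := pow_sub_mul_ordCompl_mul u (by omega)
  have h2μ : (2 : ℤ) ^ μ = 2 * 2 ^ (μ - 1) := by
    rw [← pow_succ', Nat.sub_add_cancel (by omega)]
  have h4μ : (4 : ℤ) ∣ 2 ^ (μ - 1) := pow_dvd_pow (2 : ℤ) (by omega : 2 ≤ μ - 1)
  have htJ : (2 : ℤ) ^ μ ∣ t ^ J - 1 := by
    have hJ2 : J = 2 * (2 ^ (η - 2) * (n / 2 ^ η) * u) := by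
      rw [hJdef, show η - 1 = (η - 2) + 1 by omega, pow_succ]; ring
    rw [hJ2, pow_mul]
    refine _root_.dvd_pow_sub_one ?_ _
    rw [show t ^ 2 - 1 = (t + 1) * (t - 1) by ring]
    exact hρt.mul_right _
  -- the square of `b ^ J a ^ u` is `a ^ (u (e + 1 + t ^ J))`, and `e + 1 + t ^ J` is twice an odd
  -- number
  obtain ⟨f, hf⟩ : ∃ f : ℤ, e + (1 + t ^ J) = 2 * f ∧ ¬ (2 : ℤ) ∣ f := by
    have h1 : (4 : ℤ) ∣ e := he₁ ▸ h4μ.mul_right _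
    have h2 : (4 : ℤ) ∣ t ^ J - 1 := (h4μ.trans (Dvd.intro_left 2 h2μ.symm)).trans htJ
    generalize t ^ J = T at h2
    exact ⟨(e + (1 + T)) / 2, by omega, by omega⟩
  have hpf : IsCoprime ((2 : ℕ) : ℤ) f := by
    rw [(Nat.prime_iff_prime_int.mp Nat.prime_two).coprime_iff_not_dvd]
    exact hf.2
  have hpow : (b ^ J * a ^ (u * 1 : ℤ)) ^ 2 ^ 1 = a ^ (u * ((2 : ℕ) : ℤ) ^ 1 * f : ℤ) := by
    rw [h.modification_pow 1 hJn]
    congr 1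
    simp only [pow_one, Finset.sum_range_succ, Finset.sum_range_zero, pow_zero]
    push_cast
    linear_combination (u : ℤ) * hf.1
  have hcomm := h.zpow_mem_zpowers_of_pow_eq hmu hpow hpf (by push_cast; omega)
  have hone := h.pow_eq_one_of_pow_eq hmu hpow (k := μ - 1) (by omega)
  rw [show 1 + (μ - 1) = μ by omega] at hone
  obtain ⟨n', e', t', h'⟩ := h.exists_modification hmu hqu isCoprime_one_right hJ hone hcomm
  obtain ⟨hut, hct⟩ := h.modification_conj hmu hqu hm hJ hone h'
  have hord : orderOf (a ^ 2 ^ μ * (b ^ J * a ^ (u * 1 : ℤ))) ∣ m := by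
    rw [orderOf_dvd_iff_pow_eq_one, (h.commute_modification 1 hmu hJ).mul_pow, hmu,
      pow_mul (b ^ J * a ^ (u * 1 : ℤ)), hone, one_pow, mul_one, ← pow_mul,
      ← orderOf_dvd_iff_pow_eq_one, h.orderOf_left]
    conv_lhs => rw [hmu]
    exact ⟨2 ^ μ, by ring⟩
  obtain ⟨m', hm'⟩ : ∃ m', m' = orderOf (a ^ 2 ^ μ * (b ^ J * a ^ (u * 1 : ℤ))) := ⟨_, rfl⟩
  rw [← hm'] at h' hord
  obtain ⟨τ', hτ'⟩ := h'.exists_unit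
  have hle := hG h' hτ'
  rw [Prod.Lex.toLex_le_toLex', Prod.Lex.toLex_le_toLex'] at hle
  obtain rfl : m = m' := hle.1.antisymm (Nat.le_of_dvd h.pos_left hord)
  have hrr := (hle.2 rfl).1
  -- the new action is `-1 + 2 ^ (μ - 1)` modulo `2 ^ μ`, and unchanged modulo `u`
  have hodd : ¬ (2 : ℤ) ∣ t' := by
    intro h2
    have h3 : (2 : ℤ) ∣ m := by
      exact_mod_cast Nat.dvd_of_factorization_pos (by omega : m.factorization 2 ≠ 0)
    have := (h'.isCoprime h'.pos_right.ne').isUnit_of_dvd' h3 h2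
    rw [Int.isUnit_iff] at this
    omega
  obtain ⟨k, hk⟩ : ∃ k : ℤ, t' = 1 + 2 * k := ⟨(t' - 1) / 2, by omega⟩
  have hkey : (2 : ℤ) ^ μ ∣ t - (1 + 2 * f * k) := by
    have h1 : b ^ J * a ^ (u * 1 * t) = b ^ J * a ^ (u * 1 + u * ((2 : ℕ) : ℤ) ^ 1 * f * k) := by
      rw [hct, hk, zpow_add, zpow_one, zpow_mul (b ^ J * a ^ (u * 1 : ℤ)), zpow_add, ← mul_assoc,
        zpow_mul a _ k, ← hpow]
      norm_cast
    rw [mul_right_inj, h.zpow_eq_zpow_iff, hmu] at h1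
    have h2 : (u : ℤ) * 2 ^ μ ∣ u * (1 + 2 * f * k - t) := by
      push_cast at h1
      convert h1 using 1 <;> ring
    exact dvd_sub_comm.mp (Int.dvd_of_mul_dvd_mul_left hu0 h2)
  obtain ⟨X, hX⟩ : ∃ X : ℤ, X = 2 ^ (μ - 1) := ⟨_, rfl⟩
  rw [← hX] at he₁ h2μ h4μ
  rw [h2μ] at hρt htJ hkey
  have hX0 : X ≠ 0 := by rw [hX]; positivity
  obtain ⟨α, hα⟩ := hρt
  obtain ⟨β, hβ⟩ := htJ
  obtain ⟨γ, hγ⟩ := hkey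
  -- with `X = 2 ^ (μ - 1)`, the number `t' + 1` is an odd multiple of `X`
  have hd : t' + 1 = X * (2 * α - e₁ * k - 2 * β * k - 2 * γ) := by
    linear_combination hk + hα - hγ - k * he₁ - k * hβ + k * hf.1
  have hkodd : ¬ (2 : ℤ) ∣ k := by
    have := h4μ.mul_right (2 * α - e₁ * k - 2 * β * k - 2 * γ)
    rw [← hd] at this
    omega
  have hdodd : ¬ (2 : ℤ) ∣ 2 * α - e₁ * k - 2 * β * k - 2 * γ := by
    intro h2
    have h3 : (2 : ℤ) ∣ e₁ * k := by
      obtain ⟨v, hv⟩ := h2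
      exact ⟨α - β * k - γ - v, by linear_combination -hv⟩
    exact (Int.prime_two.dvd_or_dvd h3).elim hoddE hkodd
  have hlt2 : (invR (Subgroup.zpowers τ')).factorization 2 < μ := by
    rw [← not_le, le_factorization_invR_iff hm hτ' Nat.prime_two]
    rintro ⟨-, h1 | ⟨-, h1⟩⟩
    · have h2 := h4μ.mul_right (2 * α - e₁ * k - 2 * β * k - 2 * γ)
      have h3 : (4 : ℤ) ∣ t' - 1 := (pow_dvd_pow (2 : ℤ) (by omega : 2 ≤ μ)).trans h1
      rw [← hd] at h2
      omega
    · have h2 : X * 2 ∣ X * (2 * α - e₁ * k - 2 * β * k - 2 * γ) := by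
        rw [← hd, mul_comm X, ← h2μ]
        exact h1
      exact hdodd (Int.dvd_of_mul_dvd_mul_left hX0 h2)
  have hdvd : invR (Subgroup.zpowers τ') ∣ invR (Subgroup.zpowers τ) := by
    refine (Nat.factorization_le_iff_dvd (invR_ne_zero hm _) (invR_ne_zero hm _)).mp fun q => ?_
    by_cases hq : q.Prime
    swap
    · rw [Nat.factorization_eq_zero_of_not_prime _ hq]; exact Nat.zero_le _
    rcases eq_or_ne q 2 with rfl | hq2
    · omega
    · rw [le_factorization_invR_iff hm hτ hq]
      obtain ⟨h1, h2 | ⟨h2, -⟩⟩ := (le_factorization_invR_iff hm hτ' hq).mp le_rfl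
      · refine ⟨h1, Or.inl ?_⟩
        have h3 : q ^ (invR (Subgroup.zpowers τ')).factorization q ∣ u := by
          have h4 : q ^ (invR (Subgroup.zpowers τ')).factorization q ∣ 2 ^ μ * u :=
            hmu ▸ (hq.pow_dvd_iff_le_factorization hm).mpr h1
          exact (Nat.Coprime.pow _ _ ((Nat.coprime_primes hq Nat.prime_two).mpr
            hq2)).dvd_of_dvd_mul_left h4
        have h4 : (q : ℤ) ^ (invR (Subgroup.zpowers τ')).factorization q ∣ t' - t :=
          (by exact_mod_cast Int.natCast_dvd_natCast.mpr h3 :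
            (q : ℤ) ^ (invR (Subgroup.zpowers τ')).factorization q ∣ u).trans hut
        have := dvd_sub h2 h4
        rwa [show t' - 1 - (t' - t) = t - 1 by ring] at this
      · exact absurd h2 hq2
  have heq : invR (Subgroup.zpowers τ) = invR (Subgroup.zpowers τ') :=
    hrr.antisymm (Nat.le_of_dvd (Nat.pos_of_ne_zero (invR_ne_zero hm _)) hdvd)
  rw [← heq] at hlt2
  omega

end Neg

/-- The numerical conditions are necessary: a factorization violating one of them can be modified
into a smaller one. -/
theorem isMinimalData_of_isMinimalTriple (h : IsPres a b m n e t)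
    (hτ : (τ : ZMod m) = (t : ZMod m))
    (hG : IsMinimalTriple G m (invR (Subgroup.zpowers τ)) (Int.gcd m e)) :
    IsMinimalData m n (Int.gcd m e) (invR (Subgroup.zpowers τ))
      (invEps (Subgroup.zpowers τ)) (invO (Subgroup.zpowers τ)) := by
  have hm := h.pos_left.ne'
  rw [isMinimalData_iff hm h.pos_right.ne' (invR_dvd hm _)]
  refine ⟨fun hε => ?_, fun p hp hε => ?_⟩
  · obtain ⟨-, h1, h2⟩ := h.exponent_of_invEps hτ hε
    exact ⟨h1, h2, h.exponent_index_ne hτ hε hG, fun h3 h4 h5 =>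
      h.exponent_invR_le hτ hε h3 h4 h5 hG⟩
  · have hp1 := Nat.prime_of_mem_primeFactors hp
    have hp2 := Nat.dvd_of_mem_primeFactors hp
    exact ⟨h.exponent_left_le hτ hp1 hε, h.exponent_index_le hτ hp1 hε hp2 hG,
      h.exponent_index_lt hτ hp1 hε hp2 hG⟩

end IsPres

namespace MetacyclicFactorization

variable {G : Type*} [Group G] [Finite G]

/-- Minimal factorizations satisfy the numerical conditions. -/
theorem IsMinimal.hasMinimalData {F : MetacyclicFactorization G} (hF : F.IsMinimal) :
    F.HasMinimalData := by
  obtain ⟨a, b, e, t, τ, h, hτ, hT, hs, -, -⟩ := F.exists_isPres_data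
  unfold HasMinimalData
  rw [hT, hs]
  refine h.isMinimalData_of_isMinimalTriple hτ fun a' b' m' n' e' t' τ' h' hτ' => ?_
  obtain ⟨F', hA, hB⟩ : ∃ F' : MetacyclicFactorization G,
      Subgroup.zpowers a' = F'.A ∧ Subgroup.zpowers b' = F'.B :=
    ⟨ofGenerators a' b' h'.normal h'.gen, rfl, rfl⟩
  have hkey := hF F'
  unfold key at hkey
  rw [hT, hs, ← hB, h'.index_right] at hkey
  obtain rfl : m' = Nat.card F'.A := by rw [← hA, Nat.card_zpowers, h'.orderOf_left]
  obtain ⟨τ'', hτ'', hT'⟩ := h'.actionUnits_eq hA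
  rw [hT', show τ'' = τ' from Units.ext (hτ''.trans hτ'.symm)] at hkey
  exact hkey

end MetacyclicFactorization

/-! ### Construction of a metacyclic group with given parameters -/

theorem IsPres.map_equiv {G H : Type*} [Group G] [Group H] (f : G ≃* H) {a b : G} {m n : ℕ}
    {e t : ℤ} (h : IsPres a b m n e t) : IsPres (f a) (f b) m n e t := by
  refine ⟨?_, ?_, fun j => ?_, ?_, fun g => ?_⟩
  · rw [← h.orderOf_left]
    exact orderOf_injective f.toMonoidHom f.injective a
  · rw [← map_inv, ← map_mul, ← map_mul, h.conj, map_zpow]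
  · rw [← h.mem_iff, ← map_pow, Subgroup.mem_zpowers_iff, Subgroup.mem_zpowers_iff]
    simp only [← map_zpow, f.injective.eq_iff]
  · rw [← map_pow, h.pow_right, map_zpow]
  · obtain ⟨j, i, hg⟩ := h.gen (f.symm g)
    refine ⟨j, i, ?_⟩
    rw [← map_pow, ← map_zpow, ← map_mul, ← hg, f.apply_symm_apply]

/-- A group containing elements `a` and `b` subject to the metacyclic relations, in which `b` has
infinite order modulo `⟨a⟩`: the semidirect product of `ℤ / m ℤ` and `ℤ`. -/
theorem exists_semidirect {m : ℕ} (τ : (ZMod m)ˣ) {t : ℤ} (hτ : (τ : ZMod m) = (t : ZMod m)) :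
    ∃ (K : Type) (_ : Group K) (a b : K) (f : K →* Multiplicative ℤ),
      orderOf a = m ∧ b⁻¹ * a * b = a ^ t ∧ f a = 1 ∧ f b = Multiplicative.ofAdd 1 ∧
      ∀ g : K, ∃ j i : ℤ, g = b ^ j * a ^ i := by
  let E : MulAut (Multiplicative (ZMod m)) :=
    AddEquiv.toMultiplicative (DistribMulAction.toAddEquiv (ZMod m) τ)
  let φ : Multiplicative ℤ →* MulAut (Multiplicative (ZMod m)) := zpowersHom _ E⁻¹
  have hφ : φ (Multiplicative.ofAdd 1) = E⁻¹ := by simp [φ]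
  have ha : ∀ i : ℤ, (SemidirectProduct.inl (Multiplicative.ofAdd (1 : ZMod m)) :
      Multiplicative (ZMod m) ⋊[φ] Multiplicative ℤ) ^ i =
        SemidirectProduct.inl (Multiplicative.ofAdd (i : ZMod m)) := fun i => by
    rw [← map_zpow, ← ofAdd_zsmul, zsmul_one]
  refine ⟨Multiplicative (ZMod m) ⋊[φ] Multiplicative ℤ, inferInstance,
    SemidirectProduct.inl (Multiplicative.ofAdd 1), SemidirectProduct.inr (Multiplicative.ofAdd 1),
    SemidirectProduct.rightHom, ?_, ?_, by simp, by simp, fun g => ?_⟩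
  · rw [orderOf_injective _ SemidirectProduct.inl_injective, orderOf_ofAdd_eq_addOrderOf,
      ZMod.addOrderOf_one]
  · rw [ha, ← map_inv, ← SemidirectProduct.inl_aut_inv, hφ, inv_inv]
    congr 1
    change Multiplicative.ofAdd (τ • (1 : ZMod m)) = _
    rw [Units.smul_def, smul_eq_mul, mul_one, hτ]
  · obtain ⟨x, hx⟩ := ZMod.intCast_surjective (Multiplicative.toAdd ((φ g.right)⁻¹ g.left))
    refine ⟨Multiplicative.toAdd g.right, x, ?_⟩
    have hb : (SemidirectProduct.inr (Multiplicative.ofAdd 1) :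
        Multiplicative (ZMod m) ⋊[φ] Multiplicative ℤ) ^ (Multiplicative.toAdd g.right) =
          SemidirectProduct.inr g.right := by
      rw [← map_zpow, ← ofAdd_zsmul, zsmul_one]
      rfl
    rw [hb, ha, hx, ofAdd_toAdd, SemidirectProduct.inl_aut_inv, map_inv,
      ← mul_assoc, mul_inv_cancel_left, SemidirectProduct.inl_left_mul_inr_right]

/-- Existence of a metacyclic group with presentation
`⟨a, b | a ^ m = 1, b ^ n = a ^ s, b⁻¹ a b = a ^ t⟩` in which `a` has order `m` and `⟨a⟩` has
index `n`. -/
theorem exists_isPres {m n : ℕ} {s t : ℤ} (hm : m ≠ 0) (hn : n ≠ 0) (ht : (m : ℤ) ∣ t ^ n - 1)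
    (hs : (m : ℤ) ∣ s * (t - 1)) :
    ∃ (G : Type u) (_ : Group G) (_ : Finite G) (a b : G), IsPres a b m n s t := by
  have hcop : IsCoprime t (m : ℤ) := by
    obtain ⟨c, hc⟩ := ht
    obtain ⟨k, rfl⟩ := Nat.exists_eq_succ_of_ne_zero hn
    refine ⟨t ^ k, -c, ?_⟩
    rw [Nat.succ_eq_add_one, pow_succ] at hc
    linear_combination hc
  obtain ⟨τ, hτ⟩ := (ZMod.coe_int_isUnit_iff_isCoprime t m).mpr hcop.symm
  obtain ⟨K, _, a, b, f, ha, hconj, hfa, hfb, hgen⟩ := exists_semidirect τ hτ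
  have haa : ∀ i j : ℤ, a ^ i = a ^ j ↔ (m : ℤ) ∣ j - i := fun i j => by
    rw [zpow_eq_zpow_iff_modEq, ha, Int.modEq_iff_dvd]
  set z := b ^ n * a ^ (-s) with hz
  have hza : Commute z a := by
    have h1 : a * b ^ n = b ^ n * a := by
      have := zpow_mul_pow hconj 1 n
      rw [zpow_one, one_mul] at this
      rw [this]
      congr 1
      conv_rhs => rw [← zpow_one a]
      rw [haa, dvd_sub_comm]
      exact ht
    exact Commute.mul_left h1.symm ((Commute.refl a).zpow_left _)
  have hzb : Commute z b := by
    refine Commute.mul_left ((Commute.refl b).pow_left n) ?_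
    have h1 := zpow_mul_pow hconj (-s) 1
    rw [pow_one, pow_one] at h1
    rw [Commute, SemiconjBy, h1, mul_right_inj, haa]
    obtain ⟨c, hc⟩ := hs
    exact ⟨c, by linear_combination hc⟩
  have hN : (Subgroup.zpowers z).Normal := by
    refine ⟨fun x hx g => ?_⟩
    obtain ⟨k, rfl⟩ := Subgroup.mem_zpowers_iff.mp hx
    obtain ⟨j, i, rfl⟩ := hgen g
    have h1 : Commute (b ^ j * a ^ i) (z ^ k) :=
      Commute.mul_left (hzb.symm.zpow_zpow _ _) (hza.symm.zpow_zpow _ _)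
    rwa [h1.eq, mul_inv_cancel_right]
  -- an element `b ^ j a ^ i` lies in `⟨z⟩` only if `n ∣ j`
  have hfz : f z = Multiplicative.ofAdd (n : ℤ) := by
    rw [hz, map_mul, map_pow, map_zpow, hfa, hfb, one_zpow, mul_one, ← ofAdd_nsmul, nsmul_one]
  have hfmem : ∀ x : K, x ∈ Subgroup.zpowers z → ∃ k : ℤ, x = z ^ k ∧
      Multiplicative.toAdd (f x) = k * n := by
    intro x hx
    obtain ⟨k, rfl⟩ := Subgroup.mem_zpowers_iff.mp hx
    refine ⟨k, rfl, ?_⟩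
    rw [map_zpow, hfz, ← ofAdd_zsmul, toAdd_ofAdd, smul_eq_mul]
  have hfba : ∀ j i : ℤ, Multiplicative.toAdd (f (b ^ j * a ^ i)) = j := by
    intro j i
    rw [map_mul, map_zpow, map_zpow, hfa, hfb, one_zpow, mul_one, ← ofAdd_zsmul, toAdd_ofAdd,
      smul_eq_mul, mul_one]
  set Q := K ⧸ Subgroup.zpowers z with hQ
  have hamem : ∀ i : ℤ, (a : Q) ^ i = 1 ↔ (m : ℤ) ∣ i := by
    intro i
    rw [← QuotientGroup.mk_zpow, QuotientGroup.eq_one_iff]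
    constructor
    · intro h
      obtain ⟨k, hk, hk'⟩ := hfmem _ h
      have h1 := hfba 0 i
      rw [zpow_zero, one_mul, hk'] at h1
      have h2 : k = 0 := by
        rcases mul_eq_zero.mp h1 with h2 | h2
        · exact h2
        · exact absurd (by exact_mod_cast h2) hn
      rw [h2, zpow_zero, ← zpow_zero a, haa, zero_sub, dvd_neg] at hk
      exact hk
    · intro h
      have : a ^ i = 1 := by
        rw [← zpow_zero a, haa, zero_sub, dvd_neg]
        exact h
      rw [this]
      exact Subgroup.one_mem _
  have hpow : (b : Q) ^ n = (a : Q) ^ s := by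
    rw [← QuotientGroup.mk_pow, ← QuotientGroup.mk_zpow, eq_comm, QuotientGroup.eq]
    have : (a ^ s)⁻¹ * b ^ n = z := by
      rw [hz, zpow_neg]
      have := (hza.zpow_right s).eq
      rw [hz, zpow_neg, inv_mul_cancel_right] at this
      rw [inv_mul_eq_iff_eq_mul, ← this]
    rw [this]
    exact Subgroup.mem_zpowers z
  have hgenQ : ∀ g : Q, ∃ (j : ℕ) (i : ℤ), j < n ∧ g = (b : Q) ^ j * (a : Q) ^ i := by
    intro g
    obtain ⟨x, rfl⟩ := QuotientGroup.mk_surjective g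
    obtain ⟨j, i, rfl⟩ := hgen x
    have hn' : (n : ℤ) ≠ 0 := by exact_mod_cast hn
    obtain ⟨k, hk⟩ := Int.eq_ofNat_of_zero_le (Int.emod_nonneg j hn')
    refine ⟨k, s * (j / n) + i, ?_, ?_⟩
    · have := Int.emod_lt_of_pos j (by positivity : (0 : ℤ) < n)
      omega
    · have h1 : j = k + n * (j / n) := by
        have := Int.emod_add_mul_ediv j n
        omega
      rw [zpow_add, zpow_mul, ← hpow, ← mul_assoc, ← zpow_natCast (b : Q) n, ← zpow_mul,
        ← zpow_natCast (b : Q) k, ← zpow_add, ← h1]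
      rfl
  have hpres : IsPres (a : Q) (b : Q) m n s t := by
    refine ⟨?_, ?_, fun j => ?_, hpow, fun g => ?_⟩
    · refine Nat.dvd_antisymm ?_ ?_
      · rw [orderOf_dvd_iff_pow_eq_one, ← zpow_natCast, hamem]
      · rw [← Int.natCast_dvd_natCast, ← hamem, zpow_natCast, pow_orderOf_eq_one]
    · rw [← QuotientGroup.mk_zpow, ← hconj]
      rfl
    · constructor
      · intro h
        obtain ⟨i, hi⟩ := Subgroup.mem_zpowers_iff.mp h
        rw [← QuotientGroup.mk_zpow, ← QuotientGroup.mk_pow, eq_comm, QuotientGroup.eq] at hi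
        obtain ⟨k, -, hk⟩ := hfmem _ hi
        have h1 : (b ^ j)⁻¹ * a ^ i = b ^ (-j : ℤ) * a ^ i := by rw [zpow_neg, zpow_natCast]
        rw [h1, hfba] at hk
        exact Int.natCast_dvd_natCast.mp ⟨-k, by linear_combination -hk⟩
      · rintro ⟨c, rfl⟩
        rw [pow_mul, hpow]
        exact Subgroup.pow_mem _ (Subgroup.zpow_mem _ (Subgroup.mem_zpowers _) _) _
    · obtain ⟨j, i, -, h⟩ := hgenQ g
      exact ⟨j, i, h⟩
  have hfin : Finite Q := by
    have : NeZero m := ⟨hm⟩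
    refine Finite.of_surjective (fun x : Fin n × ZMod m => (b : Q) ^ (x.1 : ℕ) * (a : Q) ^ x.2.val)
      fun g => ?_
    obtain ⟨j, i, hj, h⟩ := hgenQ g
    refine ⟨(⟨j, hj⟩, (i : ZMod m)), ?_⟩
    change (b : Q) ^ j * (a : Q) ^ (i : ZMod m).val = g
    rw [h, mul_right_inj, ← zpow_natCast, hpres.zpow_eq_zpow_iff,
      ← ZMod.intCast_eq_intCast_iff_dvd_sub]
    simp
  exact ⟨ULift.{u} Q, inferInstance, inferInstance, _, _, hpres.map_equiv MulEquiv.ulift.symm⟩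

/-! ### Comparison of the invariants of `T` and of `Res_{m'}(T)` -/

theorem piPart_eq_iff {m n : ℕ} {ν : Finset ℕ} (hν : ∀ p ∈ ν, p.Prime) :
    piPart m ν = piPart n ν ↔ ∀ p ∈ ν, m.factorization p = n.factorization p := by
  constructor
  · intro h p hp
    have key : ∀ k : ℕ, (piPart k ν).factorization p = k.factorization p := fun k => by
      unfold piPart pPart
      rw [Nat.factorization_prod fun q hq => pow_ne_zero _ (hν q hq).ne_zero,
        Finset.sum_congr rfl fun q hq => (hν q hq).factorization_pow, Finsupp.finsetSum_apply]
      simp only [Finsupp.single_apply]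
      rw [Finset.sum_ite_eq' ν p fun q => k.factorization q, if_pos hp]
    rw [← key m, h, key n]
  · intro h
    exact Finset.prod_congr rfl fun p hp => by unfold pPart; rw [h p hp]

section

variable {m m' : ℕ} {τ : (ZMod m)ˣ} {δ : (ZMod m')ˣ} {t d : ℤ}

/-- If `r ∣ m'`, restricting `T` to `𝒰_{m'}` does not change `r`. -/
theorem invR_eq_of_dvd (hm : m ≠ 0) (hm' : m' ∣ m) (hτ : (τ : ZMod m) = (t : ZMod m))
    (hδ : (δ : ZMod m') = (t : ZMod m')) (hr : invR (Subgroup.zpowers τ) ∣ m') :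
    invR (Subgroup.zpowers δ) = invR (Subgroup.zpowers τ) := by
  have hm'0 := ne_zero_of_dvd_ne_zero hm hm'
  refine Nat.eq_of_factorization_eq (invR_ne_zero hm'0 _) (invR_ne_zero hm _) fun p => ?_
  by_cases hp : p.Prime
  swap
  · rw [Nat.factorization_eq_zero_of_not_prime _ hp, Nat.factorization_eq_zero_of_not_prime _ hp]
  refine le_antisymm ?_ ?_
  · obtain ⟨h1, h2⟩ := (le_factorization_invR_iff hm'0 hδ hp).mp le_rfl
    exact (le_factorization_invR_iff hm hτ hp).mpr
      ⟨h1.trans ((Nat.factorization_le_iff_dvd hm'0 hm).mpr hm' p), h2⟩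
  · obtain ⟨-, h2⟩ := (le_factorization_invR_iff hm hτ hp).mp le_rfl
    exact (le_factorization_invR_iff hm'0 hδ hp).mpr
      ⟨(Nat.factorization_le_iff_dvd (invR_ne_zero hm _) hm'0).mpr hr p, h2⟩

theorem invEps_eq_of_invR_eq (hm : m ≠ 0) (hm' : m' ∣ m) (hτ : (τ : ZMod m) = (t : ZMod m))
    (hδ : (δ : ZMod m') = (t : ZMod m'))
    (hr : invR (Subgroup.zpowers δ) = invR (Subgroup.zpowers τ)) :
    invEps (Subgroup.zpowers δ) = invEps (Subgroup.zpowers τ) := by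
  have hm'0 := ne_zero_of_dvd_ne_zero hm hm'
  have h1 : invEps (Subgroup.zpowers δ) = 1 ↔ invEps (Subgroup.zpowers τ) = 1 := by
    rw [invEps_eq_one_iff hm'0 hδ, invEps_eq_one_iff hm hτ, hr]
  rcases invEps_eq_or (Subgroup.zpowers τ) with h2 | h2
  · rw [h2, h1, h2]
  · rw [h2]
    refine (invEps_eq_or _).resolve_left fun h3 => ?_
    rw [h1, h2] at h3
    norm_num at h3

theorem invNu_eq_of_invR_eq (hm : m ≠ 0) (hm' : m' ∣ m)
    (hr : invR (Subgroup.zpowers δ) = invR (Subgroup.zpowers τ))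
    (hν : piPart m' (invNu (Subgroup.zpowers τ)) = piPart m (invNu (Subgroup.zpowers τ))) :
    invNu (Subgroup.zpowers δ) = invNu (Subgroup.zpowers τ) := by
  have hm'0 := ne_zero_of_dvd_ne_zero hm hm'
  ext p
  rw [mem_invNu_iff hm'0, mem_invNu_iff hm, hr]
  refine ⟨fun ⟨h1, h2, h3⟩ => ⟨h1, h2.trans hm', h3⟩, fun ⟨h1, h2, h3⟩ => ⟨h1, ?_, h3⟩⟩
  rw [piPart_eq_iff fun q hq => ((mem_invNu_iff hm _).mp hq).1] at hν
  have := hν p ((mem_invNu_iff hm _).mpr ⟨h1, h2, h3⟩)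
  refine Nat.dvd_of_factorization_pos ?_
  rw [this]
  exact (h1.factorization_pos_of_dvd hm h2).ne'

/-- The `p`-part of `o`, for `p ∉ ν`, only depends on `T` modulo `m_ν = m'_ν`. -/
theorem pPart_invO_eq (hm : m ≠ 0) (hm' : m' ∣ m) (hτ : (τ : ZMod m) = (t : ZMod m))
    (hδ : (δ : ZMod m') = (t : ZMod m'))
    (hr : invR (Subgroup.zpowers δ) = invR (Subgroup.zpowers τ))
    (hν : piPart m' (invNu (Subgroup.zpowers τ)) = piPart m (invNu (Subgroup.zpowers τ)))
    {p : ℕ} (hp : p.Prime) (hpν : p ∉ invNu (Subgroup.zpowers τ)) :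
    pPart (invO (Subgroup.zpowers δ)) p = pPart (invO (Subgroup.zpowers τ)) p := by
  have hm'0 := ne_zero_of_dvd_ne_zero hm hm'
  have hνν := invNu_eq_of_invR_eq hm hm' hr hν
  obtain ⟨d, -, hd, hdo⟩ := factorization_invO hm hτ hp hpν
  obtain ⟨d', -, hd', hdo'⟩ := factorization_invO hm'0 hδ hp (hνν ▸ hpν)
  unfold pPart
  rw [hdo, hdo']
  have key : ∀ j, d' ∣ j ↔ d ∣ j := fun j => by rw [hd, hd', hνν, hν]
  rw [Nat.dvd_antisymm ((key d).mpr dvd_rfl) ((key d').mp dvd_rfl)]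

end

/-- `m'_p` only depends on the `p`-part of `o`. -/
theorem mPrime_congr {p m n s r o o' : ℕ} {ε : ℤ} (hp : p.Prime) (hε : ε = 1 ∨ ε = -1)
    (ho : pPart o p = pPart o' p) : mPrime p m n s r ε o = mPrime p m n s r ε o' := by
  unfold mPrime
  rw [ho]
  rcases pow_sub_one_eq_one_or hε hp with h2 | ⟨rfl, -⟩
  · rw [if_pos h2, if_pos h2]
  · rw [ho]

theorem isMinimalData_congr {m n s r o o' : ℕ} {ε : ℤ} (hε : ε = -1 → 2 ∣ r)
    (ho : ∀ p, p.Prime → p ∣ r → pPart o p = pPart o' p) (h : IsMinimalData m n s r ε o) :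
    IsMinimalData m n s r ε o' := by
  refine ⟨fun h1 => ?_, fun p hp h1 => ?_⟩
  · rw [← ho 2 Nat.prime_two (hε h1)]
    exact h.1 h1
  · rw [← ho p (Nat.prime_of_mem_primeFactors hp) (Nat.dvd_of_mem_primeFactors hp)]
    exact h.2 p hp h1

/-! ### Lifting a cyclic group of units -/

/-- Choice of an integer in a given class modulo `M` with prescribed `p`-adic distance to given
integers. -/
theorem exists_lift (M : ℕ) (S : Finset ℕ) (hS : ∀ p ∈ S, p.Prime) (d : ℤ) (c : ℕ → ℤ) (ρ : ℕ → ℕ)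
    (h1 : ∀ p ∈ S, ((p ^ ρ p : ℕ) : ℤ) ∣ M) (h2 : ∀ p ∈ S, ((p ^ ρ p : ℕ) : ℤ) ∣ d - c p)
    (h3 : ∀ p ∈ S, ((p ^ (ρ p + 1) : ℕ) : ℤ) ∣ M → ¬ ((p ^ (ρ p + 1) : ℕ) : ℤ) ∣ d - c p) :
    ∃ t : ℤ, (M : ℤ) ∣ t - d ∧ ∀ p ∈ S, ((p ^ ρ p : ℕ) : ℤ) ∣ t - c p ∧
      ¬ ((p ^ (ρ p + 1) : ℕ) : ℤ) ∣ t - c p := by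
  classical
  set S' := S.filter fun p => ¬ ((p ^ (ρ p + 1) : ℕ) : ℤ) ∣ d - c p with hS'
  set y : ℤ := ∏ p ∈ S', (p : ℤ) with hy
  -- `y` is divisible by `p` exactly if the `p`-adic distance of `d` need not be changed
  refine ⟨d + M * y, ⟨y, by ring⟩, fun p hp => ?_⟩
  have e : d + M * y - c p = (d - c p) + M * y := by ring
  refine ⟨?_, ?_⟩
  · rw [e]
    exact dvd_add (h2 p hp) ((h1 p hp).mul_right _)
  · rw [e]
    by_cases hp' : ((p ^ (ρ p + 1) : ℕ) : ℤ) ∣ d - c p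
    · rw [dvd_add_right hp']
      intro h4
      have hpp := Nat.prime_iff_prime_int.mp (hS p hp)
      have hpy : ¬ (p : ℤ) ∣ y := by
        rw [hy, hpp.dvd_finsetProd_iff]
        rintro ⟨q, hq, hpq⟩
        rw [hS', Finset.mem_filter] at hq
        have := (Nat.prime_dvd_prime_iff_eq (hS p hp) (hS q hq.1)).mp
          (Int.natCast_dvd_natCast.mp hpq)
        exact hq.2 (this ▸ hp')
      refine h3 p hp ?_ hp'
      refine IsCoprime.dvd_of_dvd_mul_right ?_ h4
      push_cast
      exact (hpp.coprime_iff_not_dvd.mpr hpy).pow_left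
    · intro h4
      refine hp' ((dvd_add_left ?_).mp h4)
      have hpy : (p : ℤ) ∣ y := Finset.dvd_prod_of_mem _ (Finset.mem_filter.mpr ⟨hp, hp'⟩)
      rw [pow_succ]
      push_cast
      have := h1 p hp
      push_cast at this
      exact mul_dvd_mul this hpy

section

variable {m m' : ℕ} {δ : (ZMod m')ˣ} {d : ℤ}

theorem isCoprime_of_unit (hδ : (δ : ZMod m') = (d : ZMod m')) : IsCoprime (m' : ℤ) d :=
  (ZMod.coe_int_isUnit_iff_isCoprime d m').mp (hδ ▸ δ.isUnit)

/-- If `r ∣ m'` and `m_ν = m'_ν`, then `m` and `m'` have the same prime divisors. -/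
theorem dvd_of_dvd_of_piPart_eq (hm : m ≠ 0) {r : ℕ} (hr : r ∣ m')
    (hν : piPart m (m.primeFactors \ r.primeFactors) = piPart m' (m.primeFactors \ r.primeFactors))
    {p : ℕ} (hp : p.Prime) (hpm : p ∣ m) : p ∣ m' := by
  by_cases hpr : p ∣ r
  · exact hpr.trans hr
  · rw [piPart_eq_iff fun q hq => Nat.prime_of_mem_primeFactors (Finset.mem_sdiff.mp hq).1] at hν
    have := hν p (Finset.mem_sdiff.mpr ⟨hp.mem_primeFactors hpm hm, fun h =>
      hpr (Nat.dvd_of_mem_primeFactors h)⟩)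
    refine Nat.dvd_of_factorization_pos ?_
    rw [← this]
    exact (hp.factorization_pos_of_dvd hm hpm).ne'

/-- A cyclic subgroup of `𝒰_{m'}` lifts to a cyclic subgroup of `𝒰_m` with the same `r`. -/
theorem exists_lift_invR (hm : m ≠ 0) (hm' : m' ∣ m) (hδ : (δ : ZMod m') = (d : ZMod m'))
    (h4 : 4 ∣ m → 4 ∣ invR (Subgroup.zpowers δ))
    (hν : piPart m (m.primeFactors \ (invR (Subgroup.zpowers δ)).primeFactors) =
      piPart m' (m.primeFactors \ (invR (Subgroup.zpowers δ)).primeFactors)) :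
    ∃ (t : ℤ) (τ : (ZMod m)ˣ), (τ : ZMod m) = (t : ZMod m) ∧ (m' : ℤ) ∣ t - d ∧
      invR (Subgroup.zpowers τ) = invR (Subgroup.zpowers δ) := by
  have hm'0 := ne_zero_of_dvd_ne_zero hm hm'
  set r := invR (Subgroup.zpowers δ) with hr
  set ε := invEps (Subgroup.zpowers δ) with hε
  have hr0 : r ≠ 0 := invR_ne_zero hm'0 _
  have hrm' : r ∣ m' := invR_dvd hm'0 _
  set c : ℕ → ℤ := fun p => if p = 2 then ε else 1 with hc
  have hcase : ∀ p, p.Prime → c p = 1 ∧ ε ^ (p - 1) = 1 ∨ p = 2 ∧ ε = -1 ∧ c p = -1 := by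
    intro p hp
    rcases pow_sub_one_eq_one_or (invEps_eq_or (Subgroup.zpowers δ)) hp with h1 | ⟨rfl, h1⟩
    · refine Or.inl ⟨?_, h1⟩
      rw [hc]
      dsimp only
      split_ifs with h2
      · subst h2
        simpa using h1
      · rfl
    · exact Or.inr ⟨rfl, h1, h1⟩
  have h2 : ∀ p, p.Prime → ((p ^ r.factorization p : ℕ) : ℤ) ∣ d - c p := by
    intro p hp
    push_cast
    rcases hcase p hp with ⟨h1, h2⟩ | ⟨rfl, h1, h2⟩
    · rw [h1]
      exact pow_dvd_of_gcd_eq (gcd_sub_one_eq_of_invEps hm'0 hδ hp h2)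
    · rw [h2, sub_neg_eq_add]
      exact pow_dvd_of_gcd_eq (gcd_add_one_eq_of_invEps hm'0 hδ h1).2.2
  obtain ⟨t, ht, htp⟩ := exists_lift m' r.primeFactors (fun p => Nat.prime_of_mem_primeFactors) d c
    (fun p => r.factorization p)
    (fun p hp => Int.natCast_dvd_natCast.mpr ((Nat.ordProj_dvd r p).trans hrm'))
    (fun p hp => h2 p (Nat.prime_of_mem_primeFactors hp))
    (fun p hp h3 h5 => by
      have hp1 := Nat.prime_of_mem_primeFactors hp
      have h6 : r.factorization p + 1 ≤ r.factorization p := by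
        rw [hr, le_factorization_invR_iff hm'0 hδ hp1, ← hr,
          ← hp1.pow_dvd_iff_le_factorization hm'0]
        refine ⟨Int.natCast_dvd_natCast.mp h3, ?_⟩
        push_cast at h5
        rcases hcase p hp1 with ⟨h1, -⟩ | ⟨rfl, -, h1⟩
        · exact Or.inl (h1 ▸ h5)
        · rw [h1, sub_neg_eq_add] at h5
          exact Or.inr ⟨rfl, h5⟩
      omega)
  have hcop : IsCoprime (m : ℤ) t := by
    rw [Int.isCoprime_iff_gcd_eq_one]
    refine Nat.coprime_of_dvd fun p hp hpm hpt => ?_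
    have h3 : (p : ℤ) ∣ m' := Int.natCast_dvd_natCast.mpr
      (dvd_of_dvd_of_piPart_eq hm hrm' hν hp (by simpa using hpm))
    have h5 : (p : ℤ) ∣ d := by
      have := dvd_sub (Int.natCast_dvd.mpr hpt) (h3.trans ht)
      rwa [sub_sub_cancel] at this
    exact (Nat.prime_iff_prime_int.mp hp).not_isUnit ((isCoprime_of_unit hδ).isUnit_of_dvd' h3 h5)
  obtain ⟨τ, hτ⟩ := (ZMod.coe_int_isUnit_iff_isCoprime t m).mpr hcop
  refine ⟨t, τ, hτ, ht, ?_⟩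
  refine Nat.eq_of_factorization_eq (invR_ne_zero hm _) hr0 fun p => ?_
  by_cases hp : p.Prime
  swap
  · rw [Nat.factorization_eq_zero_of_not_prime _ hp, Nat.factorization_eq_zero_of_not_prime _ hp]
  by_cases hpr : p ∣ r
  · obtain ⟨h5, h6⟩ := htp p (hp.mem_primeFactors hpr hr0)
    have hρμ : r.factorization p ≤ m.factorization p :=
      (Nat.factorization_le_iff_dvd hr0 hm).mpr (hrm'.trans hm') p
    push_cast at h5 h6
    refine le_antisymm ?_ ?_
    · by_contra hlt
      obtain ⟨h7, h8⟩ := (le_factorization_invR_iff hm hτ hp (k := r.factorization p + 1)).mp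
        (by omega)
      rcases hcase p hp with ⟨h1, h9⟩ | ⟨rfl, h9, h1⟩
      · rw [h1] at h5 h6
        rcases h8 with h8 | ⟨rfl, h8⟩
        · exact h6 h8
        · -- here `4 ∣ m`, so `4 ∣ r`, and `t` would be `1` and `-1` modulo `4`
          have h10 : 4 ∣ r := h4 ((Nat.prime_two.pow_dvd_iff_le_factorization (k := 2) hm).mpr (by
            have := hp.factorization_pos_of_dvd hr0 hpr
            omega))
          have h11 := (Nat.prime_two.pow_dvd_iff_le_factorization (k := 2) hr0).mp h10
          have h12 := (pow_dvd_pow (2 : ℤ) h11).trans h5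
          have h13 := (pow_dvd_pow (2 : ℤ) (h11.trans (Nat.le_succ _))).trans h8
          omega
      · rw [h1, sub_neg_eq_add] at h5 h6
        rcases h8 with h8 | ⟨-, h8⟩
        · have h11 := (gcd_add_one_eq_of_invEps hm'0 hδ h9).1
          have h12 := (pow_dvd_pow (2 : ℤ) h11).trans h5
          have h13 := (pow_dvd_pow (2 : ℤ) (h11.trans (Nat.le_succ _))).trans h8
          omega
        · exact h6 h8
    · rw [le_factorization_invR_iff hm hτ hp]
      refine ⟨hρμ, ?_⟩
      rcases hcase p hp with ⟨h1, -⟩ | ⟨rfl, -, h1⟩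
      · exact Or.inl (h1 ▸ h5)
      · rw [h1, sub_neg_eq_add] at h5
        exact Or.inr ⟨rfl, h5⟩
  · rw [Nat.factorization_eq_zero_of_not_dvd hpr]
    refine Nat.factorization_eq_zero_of_not_dvd fun h5 => hpr ?_
    have hpm := h5.trans (invR_dvd hm _)
    have hpm' := dvd_of_dvd_of_piPart_eq hm hrm' hν hp hpm
    rw [hr, dvd_invR_iff hm'0 hδ hp hpm']
    have h6 := (dvd_invR_iff hm hτ hp hpm).mp h5
    have := dvd_sub h6 ((Int.natCast_dvd_natCast.mpr hpm').trans ht)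
    rwa [show t - 1 - (t - d) = d - 1 by ring] at this

end

/-! ### The modulus `[T, n, s]` -/

section Bracket

variable {m m' n s : ℕ} {T : Subgroup (ZMod m)ˣ}

theorem exists_factorization_bracket (hm : m ≠ 0) (T : Subgroup (ZMod m)ˣ) (n s : ℕ) :
    ∃ M : ℕ → ℕ, (∀ p, p.Prime → mPrime p m n s (invR T) (invEps T) (invO T) = p ^ M p) ∧
      ∀ p, (bracket T n s).factorization p = (if p ∈ invNu T then m.factorization p else 0) +
        if p ∈ (invR T).primeFactors then M p else 0 := by
  have hex : ∀ p : ℕ, ∃ M : ℕ, p.Prime → mPrime p m n s (invR T) (invEps T) (invO T) = p ^ M := by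
    intro p
    by_cases hp : p.Prime
    · obtain ⟨M, -, hM⟩ := mPrime_eq_pow hp hm (invR_dvd hm T) (invEps_eq_or T) (n := n) (s := s)
        (o := invO T)
      exact ⟨M, fun _ => hM⟩
    · exact ⟨0, fun h => absurd h hp⟩
  choose M hM using hex
  refine ⟨M, hM, fun p => ?_⟩
  have h0 : piPart m (invNu T) ≠ 0 := ne_zero_of_dvd_ne_zero hm (piPart_invNu_dvd T)
  unfold bracket
  rw [Finset.prod_congr rfl fun q hq => hM q (Nat.prime_of_mem_primeFactors hq),
    Nat.factorization_mul h0 (Finset.prod_ne_zero_iff.mpr fun q hq =>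
      pow_ne_zero _ (Nat.prime_of_mem_primeFactors hq).ne_zero), Finsupp.add_apply,
    factorization_piPart m (ν := invNu T) Finset.sdiff_subset,
    Nat.factorization_prod fun q hq => pow_ne_zero _ (Nat.prime_of_mem_primeFactors hq).ne_zero,
    Finset.sum_congr rfl fun q hq => (Nat.prime_of_mem_primeFactors hq).factorization_pow,
    Finsupp.finsetSum_apply]
  simp only [Finsupp.single_apply]
  rw [Finset.sum_ite_eq' (invR T).primeFactors p fun q => M q]

theorem factorization_bracket_of_mem_invNu (hm : m ≠ 0) {p : ℕ} (hp : p ∈ invNu T) :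
    (bracket T n s).factorization p = m.factorization p := by
  obtain ⟨M, -, hM⟩ := exists_factorization_bracket hm T n s
  rw [hM, if_pos hp, if_neg (Finset.mem_sdiff.mp hp).2, add_zero]

theorem pPart_bracket (hm : m ≠ 0) {p : ℕ} (hp : p ∈ (invR T).primeFactors) :
    pPart (bracket T n s) p = mPrime p m n s (invR T) (invEps T) (invO T) := by
  obtain ⟨M, hM1, hM⟩ := exists_factorization_bracket hm T n s
  have h1 : p ∉ invNu T := fun h => (Finset.mem_sdiff.mp h).2 hp
  unfold pPart
  rw [hM, if_pos hp, if_neg h1, zero_add, hM1 p (Nat.prime_of_mem_primeFactors hp)]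

theorem bracket_ne_zero (hm : m ≠ 0) (T : Subgroup (ZMod m)ˣ) (n s : ℕ) : bracket T n s ≠ 0 :=
  ne_zero_of_dvd_ne_zero hm (bracket_dvd hm T n s)

/-- Consequently restricting `T` to `𝒰_{[T, n, s]}` does not change `r`. -/
theorem invR_dvd_bracket (hm : m ≠ 0) (T : Subgroup (ZMod m)ˣ) (n s : ℕ) :
    invR T ∣ bracket T n s := by
  refine (Nat.factorization_le_iff_dvd (invR_ne_zero hm T) (bracket_ne_zero hm T n s)).mp
    fun p => ?_
  by_cases hp : p ∈ (invR T).primeFactors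
  · have hp1 := Nat.prime_of_mem_primeFactors hp
    exact le_exponent_mPrime hp1 hm (invR_dvd hm T) (invEps_eq_or T) (pPart_bracket hm hp).symm
  · have : (invR T).factorization p = 0 := by
      rwa [← Finsupp.notMem_support_iff, Nat.support_factorization]
    omega

theorem piPart_bracket (hm : m ≠ 0) : piPart (bracket T n s) (invNu T) = piPart m (invNu T) :=
  (piPart_eq_iff fun _ hq => ((mem_invNu_iff hm T).mp hq).1).mpr fun _ hp =>
    factorization_bracket_of_mem_invNu hm hp

/-- `[T, n, s]` is determined by its part at `ν` and its `p`-parts for `p ∣ r`. -/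
theorem eq_bracket (hm : m ≠ 0) (hm' : m' ∣ m) (h1 : piPart m' (invNu T) = piPart m (invNu T))
    (h2 : ∀ p ∈ (invR T).primeFactors,
      pPart m' p = mPrime p m n s (invR T) (invEps T) (invO T)) : m' = bracket T n s := by
  have hm'0 := ne_zero_of_dvd_ne_zero hm hm'
  refine Nat.eq_of_factorization_eq hm'0 (bracket_ne_zero hm T n s) fun p => ?_
  by_cases hp : p.Prime
  swap
  · rw [Nat.factorization_eq_zero_of_not_prime _ hp, Nat.factorization_eq_zero_of_not_prime _ hp]
  by_cases hpr : p ∣ invR T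
  · have hpr' := hp.mem_primeFactors hpr (invR_ne_zero hm T)
    have := (h2 p hpr').trans (pPart_bracket hm hpr').symm
    exact Nat.pow_right_injective hp.two_le this
  by_cases hpm : p ∣ m
  · have hpν : p ∈ invNu T := (mem_invNu_iff hm T).mpr ⟨hp, hpm, hpr⟩
    rw [factorization_bracket_of_mem_invNu hm hpν]
    exact (piPart_eq_iff fun q hq => ((mem_invNu_iff hm T).mp hq).1).mp h1 p hpν
  · rw [Nat.factorization_eq_zero_of_not_dvd fun h => hpm (h.trans hm'),
      Nat.factorization_eq_zero_of_not_dvd fun h => hpm (h.trans (bracket_dvd hm T n s))]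

end Bracket

/-! ### The characterization of the invariants -/

theorem two_dvd_of_invEps {m : ℕ} {τ : (ZMod m)ˣ} {t : ℤ} (hm : m ≠ 0)
    (hτ : (τ : ZMod m) = (t : ZMod m)) (hε : invEps (Subgroup.zpowers τ) = -1) :
    2 ∣ invR (Subgroup.zpowers τ) := by
  have := (gcd_add_one_eq_of_invEps hm hτ hε).1
  exact Nat.dvd_of_factorization_pos (by omega)

theorem notMem_invNu_of_dvd {m p : ℕ} (hm : m ≠ 0) {T : Subgroup (ZMod m)ˣ} (hp : p ∣ invR T) :
    p ∉ invNu T := fun h => ((mem_invNu_iff hm T).mp h).2.2 hp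

/-- The conditions hold for the invariants computed from a factorization with minimal data. -/
theorem IsPres.conditions_of_isMinimalData {G : Type*} [Group G] [Finite G] {a b : G} {m n : ℕ}
    {e t : ℤ} {τ : (ZMod m)ˣ} (h : IsPres a b m n e t) (hτ : (τ : ZMod m) = (t : ZMod m))
    {T : Subgroup (ZMod m)ˣ} (hT : T = Subgroup.zpowers τ) {s : ℕ} (hs : s = Int.gcd m e)
    (hmin : IsMinimalData m n s (invR T) (invEps T) (invO T)) {m' : ℕ} {Δ : Subgroup (ZMod m')ˣ}
    (hΔ : (⟨m', Δ⟩ : Σ k : ℕ, Subgroup (ZMod k)ˣ) =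
      ⟨bracket T n s, Res (bracket_dvd h.pos_left.ne' T n s) T⟩) :
    (s ∣ m ∧ Nat.card Δ ∣ n ∧
      piPart m (m.primeFactors \ (invR Δ).primeFactors) =
        piPart s (m.primeFactors \ (invR Δ).primeFactors) ∧
      piPart s (m.primeFactors \ (invR Δ).primeFactors) =
        piPart m' (m.primeFactors \ (invR Δ).primeFactors) ∧
      (4 ∣ m → 4 ∣ invR Δ)) ∧
    (∀ p ∈ (invR Δ).primeFactors, pPart m' p = mPrime p m n s (invR Δ) (invEps Δ) (invO Δ)) ∧
    IsMinimalData m n s (invR Δ) (invEps Δ) (invO Δ) := by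
  subst hT
  obtain ⟨rfl, hΔ'⟩ := Sigma.mk.inj hΔ
  obtain rfl := eq_of_heq hΔ'
  have hm := h.pos_left.ne'
  have hB := bracket_dvd hm (Subgroup.zpowers τ) n s
  have hδ := coe_unitsMap_eq hB hτ
  rw [Res_zpowers]
  have hr := invR_eq_of_dvd hm hB hτ hδ (invR_dvd_bracket hm _ n s)
  have hε := invEps_eq_of_invR_eq hm hB hτ hδ hr
  have hν : piPart (bracket (Subgroup.zpowers τ) n s) (invNu (Subgroup.zpowers τ)) =
    piPart m (invNu (Subgroup.zpowers τ)) := piPart_bracket hm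
  have ho : ∀ p, p.Prime → p ∣ invR (Subgroup.zpowers τ) →
      pPart (invO (Subgroup.zpowers (ZMod.unitsMap hB τ))) p =
        pPart (invO (Subgroup.zpowers τ)) p := fun p hp hpr =>
    pPart_invO_eq hm hB hτ hδ hr hν hp (notMem_invNu_of_dvd hm hpr)
  have hms : piPart m (invNu (Subgroup.zpowers τ)) = piPart s (invNu (Subgroup.zpowers τ)) := by
    refine (piPart_eq_iff fun q hq => ((mem_invNu_iff hm _).mp hq).1).mpr fun p hp => ?_
    obtain ⟨h1, h2, h3⟩ := (mem_invNu_iff hm _).mp hp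
    rw [hs, h.factorization_index_of_not_dvd hτ h1 h2 h3]
  rw [hr, hε]
  refine ⟨⟨?_, ?_, hms, hms.symm.trans hν.symm, fun h4 => ?_⟩, fun p hp => ?_, ?_⟩
  · rw [hs]
    exact Int.natCast_dvd_natCast.mp (Int.gcd_dvd_left ..)
  · rw [Nat.card_zpowers]
    exact (orderOf_map_dvd _ _).trans (h.orderOf_unit_dvd hτ)
  · have hodd : ¬ (2 : ℤ) ∣ t := fun h2 => by
      have h3 : (2 : ℤ) ∣ m := by exact_mod_cast (by norm_num : 2 ∣ 4).trans h4
      have := (h.isCoprime h.pos_right.ne').isUnit_of_dvd' h3 h2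
      rw [Int.isUnit_iff] at this
      omega
    refine (pow_dvd_invR_iff hm hτ Nat.prime_two (k := 2)).mpr ⟨h4, ?_⟩
    unfold IsTrivialAt
    norm_num
    omega
  · have hp1 := Nat.prime_of_mem_primeFactors hp
    rw [pPart_bracket hm hp]
    exact mPrime_congr hp1 (invEps_eq_or _) (ho p hp1 (Nat.dvd_of_mem_primeFactors hp)).symm
  · exact isMinimalData_congr (two_dvd_of_invEps hm hτ) (fun p hp hpr => (ho p hp hpr).symm) hmin

/-- The congruences required for the existence of a group with the given parameters. -/
theorem dvd_of_isMinimalData {m n s : ℕ} {τ : (ZMod m)ˣ} {t : ℤ} (hm : m ≠ 0) (hn : n ≠ 0)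
    (hs0 : s ≠ 0) (hτ : (τ : ZMod m) = (t : ZMod m))
    (hmin : IsMinimalData m n s (invR (Subgroup.zpowers τ)) (invEps (Subgroup.zpowers τ))
      (invO (Subgroup.zpowers τ)))
    (hs : piPart m (invNu (Subgroup.zpowers τ)) = piPart s (invNu (Subgroup.zpowers τ)))
    (hν : (piPart m (invNu (Subgroup.zpowers τ)) : ℤ) ∣ t ^ n - 1)
    (hr : (invR (Subgroup.zpowers τ) : ℤ) ∣ t ^ n - 1) :
    (m : ℤ) ∣ t ^ n - 1 ∧ (m : ℤ) ∣ s * (t - 1) := by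
  set T := Subgroup.zpowers τ with hT
  rw [isMinimalData_iff hm hn (invR_dvd hm T)] at hmin
  suffices key : ∀ p, p.Prime → p ∣ m → (p : ℤ) ^ m.factorization p ∣ t ^ n - 1 ∧
      (p : ℤ) ^ m.factorization p ∣ s * (t - 1) by
    have key' : ∀ x : ℤ, (∀ p, p.Prime → p ∣ m → (p : ℤ) ^ m.factorization p ∣ x) →
        (m : ℤ) ∣ x := by
      intro x hx
      refine Int.natCast_dvd.mpr (dvd_of_forall_prime_pow_dvd fun p k hp hk => ?_)
      rcases Nat.eq_zero_or_pos k with rfl | hk0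
      · simp
      rw [← Int.natCast_dvd]
      push_cast
      exact (pow_dvd_pow _ ((hp.pow_dvd_iff_le_factorization hm).mp hk)).trans
        (hx p hp ((dvd_pow_self p hk0.ne').trans hk))
    exact ⟨key' _ fun p hp hpm => (key p hp hpm).1, key' _ fun p hp hpm => (key p hp hpm).2⟩
  intro p hp hpm
  have hps : ∀ k ≤ s.factorization p, (p : ℤ) ^ k ∣ s := fun k hk => by
    exact_mod_cast (hp.pow_dvd_iff_le_factorization hs0).mpr hk
  by_cases hpr : p ∣ invR T
  swap
  · have hpν : p ∈ invNu T := (mem_invNu_iff hm T).mpr ⟨hp, hpm, hpr⟩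
    refine ⟨Dvd.dvd.trans ?_ hν, (hps _ ?_).mul_right _⟩
    · have h1 : p ^ m.factorization p ∣ piPart m (invNu T) :=
        Finset.dvd_prod_of_mem (fun p => pPart m p) hpν
      exact_mod_cast Int.natCast_dvd_natCast.mpr h1
    · exact ((piPart_eq_iff fun q hq => ((mem_invNu_iff hm T).mp hq).1).mp hs p hpν).le
  have hρ0 : (invR T).factorization p ≠ 0 :=
    (hp.factorization_pos_of_dvd (invR_ne_zero hm T) hpr).ne'
  rcases pow_sub_one_eq_one_or (invEps_eq_or T) hp with hε | ⟨rfl, hε⟩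
  · obtain ⟨h1, h2, -⟩ := hmin.2 p (hp.mem_primeFactors hpr (invR_ne_zero hm T)) hε
    have hρ : (p : ℤ) ^ (invR T).factorization p ∣ t - 1 :=
      pow_dvd_of_gcd_eq (gcd_sub_one_eq_of_invEps hm hτ hp hε)
    constructor
    · exact (pow_dvd_pow _ (by omega)).trans
        (pow_dvd_pow_sub_one hρ0 hρ (Nat.ordProj_dvd n p))
    · refine (pow_dvd_pow _ h1).trans ?_
      rw [pow_add]
      exact mul_dvd_mul (hps _ le_rfl) hρ
  · obtain ⟨h1, h2, -, -⟩ := hmin.1 hε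
    obtain ⟨hρ2, ht4, hρ⟩ := gcd_add_one_eq_of_invEps hm hτ hε
    have hρt := pow_dvd_of_gcd_eq hρ
    rw [← hT] at hρ2 hρt
    have hr4 : (2 : ℤ) ^ (invR T).factorization 2 ∣ t ^ n - 1 := by
      refine Dvd.dvd.trans ?_ hr
      exact_mod_cast Int.natCast_dvd_natCast.mpr (Nat.ordProj_dvd (invR T) 2)
    -- `n` is even, since `t = -1` modulo `4`
    have hη : n.factorization 2 ≠ 0 := fun h0 => by
      have hodd : Odd n := by
        rw [← Nat.not_even_iff_odd, even_iff_two_dvd]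
        exact fun h3 => (Nat.prime_two.factorization_pos_of_dvd hn h3).ne' h0
      have h3 : (4 : ℤ) ∣ t ^ n + 1 := ht4.trans (by simpa using hodd.add_dvd_pow_add_pow t 1)
      have h4 := (pow_dvd_pow (2 : ℤ) hρ2).trans hr4
      generalize t ^ n = x at h3 h4
      omega
    obtain ⟨N, hN⟩ : 2 ∣ n := Nat.dvd_of_factorization_pos hη
    have hN0 : N ≠ 0 := by rintro rfl; exact hn hN
    have hNη : n.factorization 2 = N.factorization 2 + 1 := by
      rw [hN, Nat.factorization_mul two_ne_zero hN0, Finsupp.add_apply,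
        Nat.prime_two.factorization_self, add_comm]
    constructor
    · rw [hN]
      refine Dvd.dvd.trans (pow_dvd_pow _ ?_)
        (two_pow_dvd_pow_sub_one ht4 hρt (Nat.ordProj_dvd N 2))
      omega
    · refine (pow_dvd_pow _ h2).trans ?_
      rw [pow_succ]
      refine mul_dvd_mul (hps _ le_rfl) ?_
      push_cast
      omega

/-- Every tuple satisfying the conditions comes from a factorization with minimal data. -/
theorem exists_isPres_of_conditions {m n s m' : ℕ} {Δ : Subgroup (ZMod m')ˣ} (hm : m ≠ 0)
    (hn : n ≠ 0) (hm' : m' ∣ m) (hΔ : IsCyclic Δ) (hsm : s ∣ m) (hcard : Nat.card Δ ∣ n)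
    (hν1 : piPart m (m.primeFactors \ (invR Δ).primeFactors) =
      piPart s (m.primeFactors \ (invR Δ).primeFactors))
    (hν2 : piPart s (m.primeFactors \ (invR Δ).primeFactors) =
      piPart m' (m.primeFactors \ (invR Δ).primeFactors))
    (h4 : 4 ∣ m → 4 ∣ invR Δ)
    (hB : ∀ p ∈ (invR Δ).primeFactors,
      pPart m' p = mPrime p m n s (invR Δ) (invEps Δ) (invO Δ))
    (hmin : IsMinimalData m n s (invR Δ) (invEps Δ) (invO Δ)) :
    ∃ (G : Type u) (_ : Group G) (_ : Finite G) (a b : G) (t : ℤ) (τ : (ZMod m)ˣ),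
      IsPres a b m n s t ∧ (τ : ZMod m) = (t : ZMod m) ∧
      IsMinimalData m n s (invR (Subgroup.zpowers τ)) (invEps (Subgroup.zpowers τ))
        (invO (Subgroup.zpowers τ)) ∧
      dataTuple hm (Subgroup.zpowers τ) n s = (m, n, s, ⟨m', Δ⟩) := by
  have hm'0 := ne_zero_of_dvd_ne_zero hm hm'
  obtain ⟨δ, rfl⟩ := (Δ.isCyclic_iff_exists_zpowers_eq_top).mp hΔ
  obtain ⟨d, hd⟩ := ZMod.intCast_surjective (δ : ZMod m')
  obtain ⟨t, τ, hτ, htd, hr⟩ := exists_lift_invR hm hm' hd.symm h4 (hν1.trans hν2)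
  have hδ : (δ : ZMod m') = (t : ZMod m') := by
    rw [← hd, eq_comm, coe_eq_intCast_iff]
    exact htd
  have hν : invNu (Subgroup.zpowers τ) =
      m.primeFactors \ (invR (Subgroup.zpowers δ)).primeFactors := by
    unfold invNu
    rw [hr]
  rw [← hν] at hν1 hν2
  have hν3 := (hν1.trans hν2).symm
  have hε := invEps_eq_of_invR_eq hm hm' hτ hδ hr.symm
  have ho : ∀ p, p.Prime → p ∣ invR (Subgroup.zpowers δ) →
      pPart (invO (Subgroup.zpowers δ)) p = pPart (invO (Subgroup.zpowers τ)) p := fun p hp hpr =>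
    pPart_invO_eq hm hm' hτ hδ hr.symm hν3 hp (notMem_invNu_of_dvd hm (hr ▸ hpr))
  have hmin' : IsMinimalData m n s (invR (Subgroup.zpowers τ)) (invEps (Subgroup.zpowers τ))
      (invO (Subgroup.zpowers τ)) := by
    rw [hr, ← hε]
    exact isMinimalData_congr (two_dvd_of_invEps hm'0 hδ) ho hmin
  have hbr : m' = bracket (Subgroup.zpowers τ) n s := by
    refine eq_bracket hm hm' hν3 fun p hp => ?_
    rw [hr] at hp
    have hp1 := Nat.prime_of_mem_primeFactors hp
    rw [hB p hp, hr, ← hε]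
    exact mPrime_congr hp1 (invEps_eq_or _) (ho p hp1 (Nat.dvd_of_mem_primeFactors hp))
  have htn : (m' : ℤ) ∣ t ^ n - 1 := by
    rw [← pow_eq_one_iff_dvd hδ, ← orderOf_dvd_iff_pow_eq_one, ← Nat.card_zpowers]
    exact hcard
  have hνm' : piPart m (invNu (Subgroup.zpowers τ)) ∣ m' := by
    rw [← hν3, ← invNu_eq_of_invR_eq hm hm' hr.symm hν3]
    exact piPart_invNu_dvd _
  obtain ⟨h1, h2⟩ := dvd_of_isMinimalData hm hn (ne_zero_of_dvd_ne_zero hm hsm) hτ hmin' hν1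
    ((Int.natCast_dvd_natCast.mpr hνm').trans htn)
    ((Int.natCast_dvd_natCast.mpr (hr ▸ invR_dvd hm'0 _)).trans htn)
  obtain ⟨G, hG1, hG2, a, b, h⟩ := exists_isPres.{u} hm hn h1 h2
  refine ⟨G, hG1, hG2, a, b, t, τ, h, hτ, hmin', ?_⟩
  unfold dataTuple
  have key : ∀ B (hBm : B ∣ m), m' = B → (⟨B, Res hBm (Subgroup.zpowers τ)⟩ :
      Σ k : ℕ, Subgroup (ZMod k)ˣ) = ⟨m', Subgroup.zpowers δ⟩ := by
    rintro _ hBm rfl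
    rw [Res_zpowers, show ZMod.unitsMap hBm τ = δ from
      Units.ext ((coe_unitsMap_eq hBm hτ).trans hδ.symm)]
  rw [key _ _ hbr]

theorem IsPres.isMetacyclic {G : Type*} [Group G] {a b : G} {m n : ℕ} {e t : ℤ}
    (h : IsPres a b m n e t) : IsMetacyclic G := by
  have hN := h.normal
  refine ⟨Subgroup.zpowers a, hN, inferInstance, ⟨(b : G ⧸ Subgroup.zpowers a), fun x => ?_⟩⟩
  obtain ⟨g, rfl⟩ := QuotientGroup.mk_surjective x
  obtain ⟨j, i, rfl⟩ := h.gen g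
  refine Subgroup.mem_zpowers_iff.mpr ⟨j, ?_⟩
  rw [zpow_natCast, ← QuotientGroup.mk_pow, QuotientGroup.eq, inv_mul_cancel_left]
  exact Subgroup.zpow_mem _ (Subgroup.mem_zpowers a) i

/-- The invariants of `G` can be computed from any factorization with minimal data. -/
theorem IsPres.MCINV_eq {G : Type*} [Group G] [Finite G] {a b : G} {m n s : ℕ} {t : ℤ}
    {τ : (ZMod m)ˣ} (h : IsPres a b m n s t) (hsm : s ∣ m) (hτ : (τ : ZMod m) = (t : ZMod m))
    (hmin : IsMinimalData m n s (invR (Subgroup.zpowers τ)) (invEps (Subgroup.zpowers τ))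
      (invO (Subgroup.zpowers τ))) :
    MCINV G h.isMetacyclic = dataTuple h.pos_left.ne' (Subgroup.zpowers τ) n s := by
  have hidx := h.index_right
  have hn := h.index_left
  have hN := h.isMetacyclic
  obtain ⟨F, hA, hB⟩ : ∃ F : MetacyclicFactorization G,
      Subgroup.zpowers a = F.A ∧ Subgroup.zpowers b = F.B :=
    ⟨MetacyclicFactorization.ofGenerators a b h.normal h.gen, rfl, rfl⟩
  obtain rfl : m = Nat.card F.A := by rw [← hA, Nat.card_zpowers, h.orderOf_left]
  obtain ⟨τ', hτ', hT⟩ := h.actionUnits_eq hA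
  obtain rfl : τ' = τ := Units.ext (hτ'.trans hτ.symm)
  obtain rfl : F.A.index = n := by rw [← hA, hn]
  obtain rfl : F.B.index = s := by
    rw [← hB, hidx, Int.gcd_natCast_natCast, Nat.gcd_eq_right hsm]
  have hF : F.HasMinimalData := by
    unfold MetacyclicFactorization.HasMinimalData
    rw [hT]
    exact hmin
  have := MetacyclicFactorization.data_eq_of_key_le hF
    ((MetacyclicFactorization.exists_isMinimal h.isMetacyclic).choose_spec F)
  refine this.trans ?_
  rw [← hT]
  rfl

theorem mainTheorem2 (m n s m' : ℕ) (hm : 0 < m) (hn : 0 < n) (hs : 0 < s) (hm' : m' ∣ m)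
    (Δ : Subgroup (ZMod m')ˣ) (hΔ : IsCyclic Δ)
    (r : ℕ) (ε : ℤ) (o : ℕ) (hinv : inv Δ = (r, ε, o))
    (ν : Finset ℕ) (hν : ν = m.primeFactors \ r.primeFactors) :
    (∃ (G : Type*) (_ : Group G) (_ : Finite G) (hG : IsMetacyclic G),
      (m, n, s, ⟨m', Δ⟩) = MCINV G hG) ↔
    ((s ∣ m ∧ Nat.card Δ ∣ n ∧ piPart m ν = piPart s ν ∧ piPart s ν = piPart m' ν ∧
        (4 ∣ m → 4 ∣ r)) ∧
      (∀ p ∈ r.primeFactors, pPart m' p = mPrime p m n s r ε o) ∧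
      (ε = -1 →
        pPart m 2 / pPart r 2 ≤ pPart n 2 ∧ pPart m 2 ≤ 2 * pPart s 2 ∧
        pPart s 2 ≠ pPart n 2 * pPart r 2 ∧
        (4 ∣ n → 8 ∣ m → pPart o 2 < pPart n 2 → pPart r 2 ≤ pPart s 2)) ∧
      (∀ p ∈ r.primeFactors, ε ^ (p - 1) = 1 →
        pPart m p / pPart r p ≤ pPart s p ∧ pPart s p ≤ pPart n p ∧
        (pPart s p < pPart r p → pPart n p < pPart s p * pPart o p))) := by
  obtain ⟨rfl, h2⟩ := Prod.mk.inj hinv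
  obtain ⟨rfl, rfl⟩ := Prod.mk.inj h2
  subst hν
  constructor
  · rintro ⟨G, _, _, hG, hdata⟩
    have hF := (MetacyclicFactorization.exists_isMinimal hG).choose_spec
    unfold MCINV at hdata
    generalize (MetacyclicFactorization.exists_isMinimal hG).choose = F at hF hdata
    obtain ⟨a, b, e, t, τ, h, hτ, hT, hidx, -, -⟩ := F.exists_isPres_data
    have hmin := hF.hasMinimalData
    unfold MetacyclicFactorization.HasMinimalData at hmin
    unfold MetacyclicFactorization.data at hdata
    obtain ⟨hd1, hd2⟩ := Prod.mk.inj hdata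
    obtain ⟨hd3, hd4⟩ := Prod.mk.inj hd2
    obtain ⟨hd5, hd6⟩ := Prod.mk.inj hd4
    clear hdata hd2 hd4
    subst hd1 hd3 hd5
    exact h.conditions_of_isMinimalData hτ hT hidx hmin hd6
  · rintro ⟨⟨h1, h2, h3, h4, h5⟩, h6, h7⟩
    obtain ⟨G, _, _, a, b, t, τ, h, hτ, hmin, hdata⟩ :=
      exists_isPres_of_conditions hm.ne' hn.ne' hm' hΔ h1 h2 h3 h4 h5 h6 h7
    exact ⟨G, inferInstance, inferInstance, h.isMetacyclic,
      hdata.symm.trans (h.MCINV_eq h1 hτ hmin).symm⟩
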